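/- \textbf{Theorem.} Let $\mathbb K=\mathbb R$ or $\mathbb C$, let $\mathfrak t$ be the transpose resp. conjugate transpose, $\mathrm{Tr}_{\mathbb R}$ the real part of the trace, $\mathrm{sym}\,X=\frac12(X+X^{\mathfrak t})$, and let $\alpha_0,\alpha_1,\beta>0$. Let $\mathcal E=\mathbb K^{n\times p}\times\mathbb K^{p\times p}$ with the inner product $\langle\omega,\omega'\rangle=\mathrm{Tr}_{\mathbb R}(\omega_Y\omega_Y'^{\mathfrak t}+\omega_P\omega_P'^{\mathfrak t})$, and let $\mathcal M\subset\mathcal E$ be the set of $S=(Y,P)$ with $Y^{\mathfrak t}Y=I_p$ and $P$ $\mathfrak t$-symmetric positive definite. A unitary (orthogonal) matrix $U\in U(p)$ acts by $(Y,P)\mapsto(YU,U^{\mathfrak t}PU)$. Let $\mathcal B$ be the manifold of positive-semidefinite $n\times n$ matrices over $\mathbb K$ of rank $p$ and $\pi(Y,P)=YPY^{\mathfrak t}$. Vector fields are smooth and are regarded as functions with values in the ambient space, and $\mathrm D_\xi$ denotes the directional derivative along the manifold. 1. (Quotient.) $U(p)$ preserves $\mathcal M$, $\pi$ maps $\mathcal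 M$ onto $\mathcal B$, its fibers in $\mathcal M$ are exactly the $U(p)$-orbits, and a real function $f$ on $\mathcal B$ is smooth if and only if $f\circ\pi$ is smooth on $\mathcal M$. 2. (Metric.) For $S\in\mathcal M$ the operator $$\mathsf g(S)(\omega_Y,\omega_P)=\big(\alpha_0\omega_Y+(\alpha_1-\alpha_0)YY^{\mathfrak t}\omega_Y,\ \beta P^{-1}\omega_PP^{-1}\big)$$ on $\mathcal E$ is self-adjoint, invertible and positive definite, with $$\langle\omega,\mathsf g(S)\omega'\rangle=\mathrm{Tr}_{\mathbb R}\big(\alpha_0\omega_Y^{\mathfrak t}\omega_Y'+(\alpha_1-\alpha_0)\omega_Y^{\mathfrak t}YY^{\mathfrak t}\omega_Y'+\beta\omega_P^{\mathfrak t}P^{-1}\omega_P'P^{-1}\big).$$ It is invariant under $U(p)$ and induces a Riemannian metric on $\mathcal M$. 3. (Horizontal space.) Let $\mathcal H_S$ be the set of vectors in $T_S\mathcal M$ that are orthogonal, for $\mathsf g(S)$, to the tangent space at $S$ of the $U(p)$-orbit of $S$. A tangent vector $\eta\in T_S\mathcal M$ is in $\mathcal H_S$ if and only if $$\alpha_1Y^{\mathfrak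 t}\eta_Y+\beta\eta_PP^{-1}-\beta P^{-1}\eta_P=0;$$ and $\eta\in\mathcal E$ is in $\mathcal H_S$ if and only if $\eta_P^{\mathfrak t}=\eta_P$ and this equation holds. If $(Y|Y_\perp)\in U(n)$, the linear map $$\mathrm N(S)(B,D)=\big(\beta Y(P^{-1}D-DP^{-1})+Y_\perp B,\ \alpha_1D\big)$$ restricts to a bijection from $\{(B,D): B\in\mathbb K^{(n-p)\times p},\ D\in\mathbb K^{p\times p},\ D^{\mathfrak t}=D\}$ onto $\mathcal H_S$. The differential $d\pi_S$ maps $\mathcal H_S$ bijectively onto $T_{\pi(S)}\mathcal B$, and every vector field on $\mathcal B$ has a horizontal lift that is a (smooth) vector field on $\mathcal M$. 4. (Projection.) The operator $L(P)X=(\alpha_1-2\beta)X+\beta(PXP^{-1}+P^{-1}XP)$ on $\mathbb K^{p\times p}$ is bijective. If $P=U\,\mathrm{diag}(\Lambda)\,U^{\mathfrak t}$ with $U\in U(p)$ and $\Lambda$ real, then $L(P)^{-1}B=U\{(U^{\mathfrak t}BU)/M\}U^{\mathfrak t}$ (entrywise division) with $M_{ij}=\alpha_1+\beta(\Lambda_i^{-1}\Lambda_j+\Lambda_i\Lambda_j^{-1}-2)$.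 The projection $\Pi_{\mathcal H}(S)$ of $\mathcal E$ to $\mathcal H_S$, orthogonal for $\mathsf g(S)$, is $$\Pi_{\mathcal H}(S)\omega=\big(\beta Y(P^{-1}\mathcal D-\mathcal DP^{-1})+\omega_Y-YY^{\mathfrak t}\omega_Y,\ \alpha_1\mathcal D\big),\qquad \mathcal D=\mathcal D(S)\omega=L(P)^{-1}\mathrm{sym}(\omega_P+Y^{\mathfrak t}\omega_YP-PY^{\mathfrak t}\omega_Y).$$ 5. (Derivative of the projection.) For every constant $\omega\in\mathcal E$, $\mathcal D(S)\omega$ and $\Pi_{\mathcal H}(S)\omega$ are smooth in $S\in\mathcal M$, and for $\xi\in T_S\mathcal M$ the derivative $\mathring{\mathcal D}=(\mathrm D_\xi\mathcal D)\omega$ is $$\begin{aligned}\mathring{\mathcal D}=L(P)^{-1}\{&\mathrm{sym}(\xi_Y^{\mathfrak t}\omega_YP-P\xi_Y^{\mathfrak t}\omega_Y+Y^{\mathfrak t}\omega_Y\xi_P-\xi_PY^{\mathfrak t}\omega_Y)\\&-\beta(\xi_P\mathcal DP^{-1}+P^{-1}\mathcal D\xi_P-P\mathcal DP^{-1}\xi_PP^{-1}-P^{-1}\xi_PP^{-1}\mathcal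 DP)\},\end{aligned}$$ while $(\mathrm D_\xi\Pi_{\mathcal H})\omega$ has $P$-component $\alpha_1\mathring{\mathcal D}$ and $Y$-component $$\beta\xi_Y(P^{-1}\mathcal D-\mathcal DP^{-1})+\beta Y(P^{-1}\mathring{\mathcal D}-\mathring{\mathcal D}P^{-1}+\mathcal DP^{-1}\xi_PP^{-1}-P^{-1}\xi_PP^{-1}\mathcal D)-(\xi_YY^{\mathfrak t}+Y\xi_Y^{\mathfrak t})\omega_Y.$$ 6. (Christoffel metric term.) Define $\mathrm K(\xi,\eta)=\frac12((\mathrm D_\xi\mathsf g)\eta+(\mathrm D_\eta\mathsf g)\xi-\mathcal X(\xi,\eta))$, where $\mathcal X(\xi,\eta)\in\mathcal E$ is determined by $\langle\mathcal X(\xi,\eta),\varphi\rangle=\langle\xi,(\mathrm D_\varphi\mathsf g)\eta\rangle$ for all $\varphi\in\mathcal E$ (with $\mathsf g$ given by the formula in 2 wherever $P$ is invertible). For $\xi,\eta\in T_S\mathcal M$, $$\mathrm K(\xi,\eta)_Y=\tfrac{\alpha_1-\alpha_0}{2}\big(Y(\eta_Y^{\mathfrak t}\xi_Y+\xi_Y^{\mathfrak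 t}\eta_Y)-2(\eta_Y\xi_Y^{\mathfrak t}+\xi_Y\eta_Y^{\mathfrak t})Y\big),$$ $$\mathrm K(\xi,\eta)_P=-\tfrac\beta2\big(P^{-1}\eta_PP^{-1}\xi_PP^{-1}+P^{-1}\xi_PP^{-1}\eta_PP^{-1}\big).$$ 7. (Connection.) Let $\nabla$ be the Levi-Civita connection of $\mathcal M$, which exists. For horizontal vector fields $\xi,\eta$ on $\mathcal M$, $$\Pi_{\mathcal H}\nabla_\xi\eta=\mathrm D_\xi\eta-(\mathrm D_\xi\Pi_{\mathcal H})\eta+\Pi_{\mathcal H}\mathsf g^{-1}\mathrm K(\xi,\eta).$$ There is a Riemannian metric on $\mathcal B$ for which all maps $d\pi_S:\mathcal H_S\to T_{\pi(S)}\mathcal B$ are isometries (the quotient metric). It has a Levi-Civita connection $\nabla^{\mathcal B}$, and if $\xi,\eta$ are the horizontal lifts of vector fields $u,v$ on $\mathcal B$, the horizontal lift of $\nabla^{\mathcal B}_uv$ is given by the right-hand side above. 8. (Hessian.) Let $f$ be a smooth function on $\mathcal B$ and let $F:\mathcal M\to\mathcal E$ be a smooth ambient gradient of $f\circ\pi$,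 that is, $\langle\eta,F(S)\rangle=\mathrm D_\eta(f\circ\pi)(S)$ for all $\eta\in T_S\mathcal M$, $S\in\mathcal M$. Then $f$ has a (smooth) Riemannian gradient $\mathrm{rgrad}_f$ on $\mathcal B$, with horizontal lift $\Pi_{\mathcal H}\mathsf g^{-1}F$, and for every vector field $u$ on $\mathcal B$ with horizontal lift $\xi$ the horizontal lift of the Riemannian Hessian product $\nabla^{\mathcal B}_u\mathrm{rgrad}_f$ is $$\begin{aligned}&\Pi_{\mathcal H}\mathsf g^{-1}\big(\mathrm D_\xi F+\mathsf g(\mathrm D_\xi(\Pi_{\mathcal H}\mathsf g^{-1}))F+\mathrm K(\xi,\Pi_{\mathcal H}\mathsf g^{-1}F)\big)\\&=\Pi_{\mathcal H}\mathsf g^{-1}\big(\mathrm D_\xi F+\mathsf g(\mathrm D_\xi\Pi_{\mathcal H})\mathsf g^{-1}F-(\mathrm D_\xi\mathsf g)\mathsf g^{-1}F+\mathrm K(\xi,\Pi_{\mathcal H}\mathsf g^{-1}F)\big).\end{aligned}$$ -/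

import Mathlib

open Matrix
open scoped ContDiff ComplexOrder

attribute [local instance] Matrix.frobeniusNormedAddCommGroup Matrix.frobeniusNormedSpace

noncomputable section

namespace EmbeddedGeometry

/-! ### Riemannian geometry of a submanifold of a normed space

Vector fields on a submanifold `M` of `E` are `E`-valued functions (only their values on `M` matter),
smooth on `M` and tangent to `M` at every point of `M`. -/

/-- The tangent space of `M` at `x`: the span of the velocities at `x` of the smooth curves in `M`
(for a submanifold these velocities already form a subspace). -/
def tangentSpaceAt {E : Type*} [NormedAddCommGroup E] [NormedSpace ℝ E] (M : Set E) (x : E) :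
    Submodule ℝ E :=
  Submodule.span ℝ
    {v | ∃ γ : ℝ → E, ContDiff ℝ ∞ γ ∧ (∀ t, γ t ∈ M) ∧ γ 0 = x ∧ HasDerivAt γ v 0}

/-- The directional derivative of a function on `M` at `x ∈ M` in a tangent direction `v`. For a function
that is smooth on `M` its value at a tangent vector `v` is the derivative along any curve in `M`
with velocity `v`. -/
def dirDeriv {E F : Type*} [NormedAddCommGroup E] [NormedSpace ℝ E]
    [NormedAddCommGroup F] [NormedSpace ℝ F] (M : Set E) (f : E → F) (x v : E) : F :=
  fderivWithin ℝ f M x v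

/-- Smooth vector fields on `M`. -/
structure IsVectorField {E : Type*} [NormedAddCommGroup E] [NormedSpace ℝ E]
    (M : Set E) (ξ : E → E) : Prop where
  smooth : ContDiffOn ℝ ∞ ξ M
  tangent : ∀ x ∈ M, ξ x ∈ tangentSpaceAt M x

/-- `G x u v` restricts to a smooth Riemannian metric on `M`. -/
structure IsRiemannianMetric {E : Type*} [NormedAddCommGroup E] [NormedSpace ℝ E]
    (M : Set E) (G : E → E → E → ℝ) : Prop where
  symm : ∀ x ∈ M, ∀ u ∈ tangentSpaceAt M x, ∀ v ∈ tangentSpaceAt M x, G x u v = G x v u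
  add_left : ∀ x ∈ M, ∀ u ∈ tangentSpaceAt M x, ∀ v ∈ tangentSpaceAt M x,
    ∀ w ∈ tangentSpaceAt M x, G x (u + v) w = G x u w + G x v w
  smul_left : ∀ x ∈ M, ∀ c : ℝ, ∀ u ∈ tangentSpaceAt M x, ∀ v ∈ tangentSpaceAt M x,
    G x (c • u) v = c * G x u v
  pos : ∀ x ∈ M, ∀ u ∈ tangentSpaceAt M x, u ≠ 0 → 0 < G x u u
  smooth : ∀ ξ η : E → E, IsVectorField M ξ → IsVectorField M η →
    ContDiffOn ℝ ∞ (fun x => G x (ξ x) (η x)) M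

/-- `nabla ξ η` (for `∇_ξ η`) is the Levi-Civita connection of `(M, G)`: a covariant derivative on the
vector fields of `M` that is compatible with the metric and torsion-free. The Lie bracket of
two vector fields on `M ⊆ E` is `D_ξ η - D_η ξ`. -/
structure IsLeviCivita {E : Type*} [NormedAddCommGroup E] [NormedSpace ℝ E]
    (M : Set E) (G : E → E → E → ℝ) (nabla : (E → E) → (E → E) → E → E) : Prop where
  isVectorField : ∀ ξ η, IsVectorField M ξ → IsVectorField M η → IsVectorField M (nabla ξ η)
  congr : ∀ ξ ξ' η η', IsVectorField M ξ → IsVectorField M ξ' → IsVectorField M η →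
    IsVectorField M η' → Set.EqOn ξ ξ' M → Set.EqOn η η' M →
    Set.EqOn (nabla ξ η) (nabla ξ' η') M
  add_left : ∀ ξ ξ' η, IsVectorField M ξ → IsVectorField M ξ' → IsVectorField M η →
    ∀ x ∈ M, nabla (fun y => ξ y + ξ' y) η x = nabla ξ η x + nabla ξ' η x
  smul_left : ∀ (f : E → ℝ) (ξ η : E → E), ContDiffOn ℝ ∞ f M → IsVectorField M ξ →
    IsVectorField M η → ∀ x ∈ M, nabla (fun y => f y • ξ y) η x = f x • nabla ξ η x
  add_right : ∀ ξ η η', IsVectorField M ξ → IsVectorField M η → IsVectorField M η' →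
    ∀ x ∈ M, nabla ξ (fun y => η y + η' y) x = nabla ξ η x + nabla ξ η' x
  leibniz : ∀ (f : E → ℝ) (ξ η : E → E), ContDiffOn ℝ ∞ f M → IsVectorField M ξ →
    IsVectorField M η → ∀ x ∈ M,
      nabla ξ (fun y => f y • η y) x = f x • nabla ξ η x + dirDeriv M f x (ξ x) • η x
  metric_compat : ∀ ξ η φ, IsVectorField M ξ → IsVectorField M η → IsVectorField M φ →
    ∀ x ∈ M, dirDeriv M (fun y => G y (η y) (φ y)) x (ξ x) =
      G x (nabla ξ η x) (φ x) + G x (η x) (nabla ξ φ x)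
  torsion_free : ∀ ξ η, IsVectorField M ξ → IsVectorField M η →
    ∀ x ∈ M, nabla ξ η x - nabla η ξ x = dirDeriv M η x (ξ x) - dirDeriv M ξ x (η x)

end EmbeddedGeometry

namespace FixedRankPSD

open EmbeddedGeometry

/-- The ambient space `𝕜^{n×p} × 𝕜^{p×p}`, as a real vector space. -/
abbrev Amb (𝕜 : Type*) (n p : ℕ) : Type _ :=
  Matrix (Fin n) (Fin p) 𝕜 × Matrix (Fin p) (Fin p) 𝕜

/-- The real part of the trace. -/
def trR {𝕜 : Type*} [RCLike 𝕜] {m : ℕ} (A : Matrix (Fin m) (Fin m) 𝕜) : ℝ := RCLike.re A.trace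

/-- The symmetrizer `(X + Xᴴ) / 2`. -/
def symm {𝕜 : Type*} [RCLike 𝕜] {m : ℕ} (X : Matrix (Fin m) (Fin m) 𝕜) :
    Matrix (Fin m) (Fin m) 𝕜 := (1 / 2 : ℝ) • (X + Xᴴ)

/-- The trace inner product on the ambient space. -/
def ambInner {𝕜 : Type*} [RCLike 𝕜] {n p : ℕ} (w w' : Amb 𝕜 n p) : ℝ :=
  trR (w.1 * w'.1ᴴ) + trR (w.2 * w'.2ᴴ)

/-- The product of the Stiefel manifold and the manifold of positive-definite matrices. -/
def stiefelPD (𝕜 : Type*) [RCLike 𝕜] (n p : ℕ) : Set (Amb 𝕜 n p) :=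
  {S | S.1ᴴ * S.1 = 1 ∧ S.2.PosDef}

/-- Positive-semidefinite `n × n` matrices of rank `p`. -/
def psdRank (𝕜 : Type*) [RCLike 𝕜] (n p : ℕ) : Set (Matrix (Fin n) (Fin n) 𝕜) :=
  {X | X.PosSemidef ∧ X.rank = p}

/-- The map `(Y, P) ↦ Y P Yᴴ`. -/
def proj {𝕜 : Type*} [RCLike 𝕜] {n p : ℕ} (S : Amb 𝕜 n p) : Matrix (Fin n) (Fin n) 𝕜 :=
  S.1 * S.2 * S.1ᴴ

/-- The differential of `(Y, P) ↦ Y P Yᴴ` at `S`. -/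
def dproj {𝕜 : Type*} [RCLike 𝕜] {n p : ℕ} (S η : Amb 𝕜 n p) : Matrix (Fin n) (Fin n) 𝕜 :=
  fderiv ℝ (proj (𝕜 := 𝕜) (n := n) (p := p)) S η

/-- The action `(Y, P) ↦ (Y U, Uᴴ P U)`, a linear map of the ambient space for each `U`. -/
def act {𝕜 : Type*} [RCLike 𝕜] {n p : ℕ} (U : Matrix (Fin p) (Fin p) 𝕜) (S : Amb 𝕜 n p) :
    Amb 𝕜 n p := (S.1 * U, Uᴴ * S.2 * U)

/-- The orbit of `S` under the unitary (orthogonal) group. -/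
def orbit {𝕜 : Type*} [RCLike 𝕜] {n p : ℕ} (S : Amb 𝕜 n p) : Set (Amb 𝕜 n p) :=
  {S' | ∃ U ∈ Matrix.unitaryGroup (Fin p) 𝕜, S' = act U S}

/-- The metric operator `g(S)(w_Y, w_P) = (α₀ w_Y + (α₁ - α₀) Y Yᴴ w_Y, β P⁻¹ w_P P⁻¹)`. -/
def gOp {𝕜 : Type*} [RCLike 𝕜] {n p : ℕ} (α₀ α₁ β : ℝ) (S : Amb 𝕜 n p) :
    Amb 𝕜 n p →ₗ[ℝ] Amb 𝕜 n p where
  toFun w := (α₀ • w.1 + (α₁ - α₀) • (S.1 * S.1ᴴ * w.1), β • (S.2⁻¹ * w.2 * S.2⁻¹))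
  map_add' w w' := by
    ext1 <;> simp only [Prod.fst_add, Prod.snd_add, Matrix.mul_add, Matrix.add_mul, smul_add]
    abel
  map_smul' c w := by
    ext1 <;> simp [smul_comm c]

/-- The inverse of the metric operator. -/
def gInv {𝕜 : Type*} [RCLike 𝕜] {n p : ℕ} (α₀ α₁ β : ℝ) (S : Amb 𝕜 n p) :
    Amb 𝕜 n p →ₗ[ℝ] Amb 𝕜 n p :=
  Ring.inverse (gOp α₀ α₁ β S : Module.End ℝ (Amb 𝕜 n p))

/-- The inner product on the ambient space defined by the metric operator at `S`. -/
def gMet {𝕜 : Type*} [RCLike 𝕜] {n p : ℕ} (α₀ α₁ β : ℝ) (S w w' : Amb 𝕜 n p) : ℝ :=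
  ambInner w (gOp α₀ α₁ β S w')

/-- The horizontal space at `S`: the tangent vectors of the Stiefel × positive-definite manifold that are
orthogonal, in the metric at `S`, to the tangent space of the orbit of `S`. -/
def horizontal {𝕜 : Type*} [RCLike 𝕜] {n p : ℕ} (α₀ α₁ β : ℝ) (S : Amb 𝕜 n p) :
    Set (Amb 𝕜 n p) :=
  {η | η ∈ tangentSpaceAt (stiefelPD 𝕜 n p) S ∧
    ∀ v ∈ tangentSpaceAt (orbit S) S, gMet α₀ α₁ β S η v = 0}

/-- `η` is the projection of `w` to the horizontal space at `S` for the inner product at `S`. -/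
def IsHorizontalProjection {𝕜 : Type*} [RCLike 𝕜] {n p : ℕ} (α₀ α₁ β : ℝ)
    (S w η : Amb 𝕜 n p) : Prop :=
  η ∈ horizontal α₀ α₁ β S ∧
    ∀ ζ ∈ horizontal α₀ α₁ β S, gMet α₀ α₁ β S η ζ = gMet α₀ α₁ β S w ζ

open Classical in
/-- The horizontal projection `Π_H(S) w` (it exists and is unique for `S` in the manifold). -/
def projH {𝕜 : Type*} [RCLike 𝕜] {n p : ℕ} (α₀ α₁ β : ℝ) (S w : Amb 𝕜 n p) : Amb 𝕜 n p :=
  if h : ∃ η, IsHorizontalProjection α₀ α₁ β S w η then h.choose else 0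

/-- The operator `N(S)(B, D) = (β Y (P⁻¹ D - D P⁻¹) + Y_⊥ B, α₁ D)`. -/
def nOp {𝕜 : Type*} [RCLike 𝕜] {n p : ℕ} (α₁ β : ℝ) (S : Amb 𝕜 n p)
    (Yperp : Matrix (Fin n) (Fin (n - p)) 𝕜) :
    (Matrix (Fin (n - p)) (Fin p) 𝕜 × Matrix (Fin p) (Fin p) 𝕜) →ₗ[ℝ] Amb 𝕜 n p where
  toFun x := (β • (S.1 * (S.2⁻¹ * x.2 - x.2 * S.2⁻¹)) + Yperp * x.1, α₁ • x.2)
  map_add' x y := by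
    ext1 <;> simp only [Prod.fst_add, Prod.snd_add, Matrix.mul_add, Matrix.add_mul, smul_add,
      Matrix.mul_sub, smul_sub]
    abel
  map_smul' c x := by
    ext1 <;> simp [smul_comm c, ← smul_sub]

/-- The Lyapunov-type operator `L(P) X = (α₁ - 2 β) X + β (P X P⁻¹ + P⁻¹ X P)`. -/
def lyap {𝕜 : Type*} [RCLike 𝕜] {p : ℕ} (α₁ β : ℝ) (P : Matrix (Fin p) (Fin p) 𝕜) :
    Matrix (Fin p) (Fin p) 𝕜 →ₗ[ℝ] Matrix (Fin p) (Fin p) 𝕜 where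
  toFun X := (α₁ - 2 * β) • X + β • (P * X * P⁻¹ + P⁻¹ * X * P)
  map_add' X Y := by
    simp only [Matrix.mul_add, Matrix.add_mul, smul_add]
    abel
  map_smul' c X := by
    simp only [Matrix.mul_smul, Matrix.smul_mul, smul_add, smul_comm c, RingHom.id_apply]

/-- The inverse of `L(P)`. -/
def lyapInv {𝕜 : Type*} [RCLike 𝕜] {p : ℕ} (α₁ β : ℝ) (P : Matrix (Fin p) (Fin p) 𝕜) :
    Matrix (Fin p) (Fin p) 𝕜 →ₗ[ℝ] Matrix (Fin p) (Fin p) 𝕜 :=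
  Ring.inverse (lyap α₁ β P : Module.End ℝ (Matrix (Fin p) (Fin p) 𝕜))

/-- `𝒟(S) w = L(P)⁻¹ sym(w_P + Yᴴ w_Y P - P Yᴴ w_Y)`. -/
def calD {𝕜 : Type*} [RCLike 𝕜] {n p : ℕ} (α₁ β : ℝ) (S w : Amb 𝕜 n p) :
    Matrix (Fin p) (Fin p) 𝕜 :=
  lyapInv α₁ β S.2 (symm (w.2 + S.1ᴴ * w.1 * S.2 - S.2 * S.1ᴴ * w.1))

/-- The expression for the derivative of `𝒟` at `S` in direction `ξ`, applied to `w`. -/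
def calDdot {𝕜 : Type*} [RCLike 𝕜] {n p : ℕ} (α₁ β : ℝ) (S ξ w : Amb 𝕜 n p) :
    Matrix (Fin p) (Fin p) 𝕜 :=
  lyapInv α₁ β S.2
    (symm (ξ.1ᴴ * w.1 * S.2 - S.2 * ξ.1ᴴ * w.1 + S.1ᴴ * w.1 * ξ.2 - ξ.2 * S.1ᴴ * w.1)
      - β • (ξ.2 * calD α₁ β S w * S.2⁻¹ + S.2⁻¹ * calD α₁ β S w * ξ.2
          - S.2 * calD α₁ β S w * S.2⁻¹ * ξ.2 * S.2⁻¹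
          - S.2⁻¹ * ξ.2 * S.2⁻¹ * calD α₁ β S w * S.2))

/-- The explicit expression for the horizontal projection. -/
def projFormula {𝕜 : Type*} [RCLike 𝕜] {n p : ℕ} (α₁ β : ℝ) (S w : Amb 𝕜 n p) : Amb 𝕜 n p :=
  (β • (S.1 * (S.2⁻¹ * calD α₁ β S w - calD α₁ β S w * S.2⁻¹)) + w.1 - S.1 * S.1ᴴ * w.1,
    α₁ • calD α₁ β S w)

/-- The explicit expression for `(D_ξ Π_H) w`. -/
def dprojFormula {𝕜 : Type*} [RCLike 𝕜] {n p : ℕ} (α₁ β : ℝ) (S ξ w : Amb 𝕜 n p) :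
    Amb 𝕜 n p :=
  (β • (ξ.1 * (S.2⁻¹ * calD α₁ β S w - calD α₁ β S w * S.2⁻¹))
    + β • (S.1 * (S.2⁻¹ * calDdot α₁ β S ξ w - calDdot α₁ β S ξ w * S.2⁻¹
        + calD α₁ β S w * S.2⁻¹ * ξ.2 * S.2⁻¹ - S.2⁻¹ * ξ.2 * S.2⁻¹ * calD α₁ β S w))
    - (ξ.1 * S.1ᴴ + S.1 * ξ.1ᴴ) * w.1,
    α₁ • calDdot α₁ β S ξ w)

/-- `(D_φ g)(S) w`, the derivative at `S` in the direction `φ` of the metric operator, with `w` constant.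
The expression for `g` makes sense, and is smooth, wherever `P` is invertible, so every
ambient direction `φ` is allowed. -/
def dg {𝕜 : Type*} [RCLike 𝕜] {n p : ℕ} (α₀ α₁ β : ℝ) (S φ w : Amb 𝕜 n p) : Amb 𝕜 n p :=
  fderiv ℝ (fun S' => gOp α₀ α₁ β S' w) S φ

/-- `κ` is the Christoffel metric term `((D_ξ g) η + (D_η g) ξ - 𝒳(ξ, η)) / 2`, where the index-raising
term `𝒳(ξ, η)` is the vector with `⟨𝒳(ξ, η), φ⟩ = ⟨ξ, (D_φ g) η⟩` for all `φ`. -/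
def IsChristoffelTerm {𝕜 : Type*} [RCLike 𝕜] {n p : ℕ} (α₀ α₁ β : ℝ)
    (S ξ η κ : Amb 𝕜 n p) : Prop :=
  ∃ X : Amb 𝕜 n p, (∀ φ, ambInner X φ = ambInner ξ (dg α₀ α₁ β S φ η)) ∧
    κ = (1 / 2 : ℝ) • (dg α₀ α₁ β S ξ η + dg α₀ α₁ β S η ξ - X)

/-- The explicit expression for the Christoffel metric term `K(ξ, η)`. -/
def kFormula {𝕜 : Type*} [RCLike 𝕜] {n p : ℕ} (α₀ α₁ β : ℝ) (S ξ η : Amb 𝕜 n p) : Amb 𝕜 n p :=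
  (((α₁ - α₀) / 2) • (S.1 * (η.1ᴴ * ξ.1 + ξ.1ᴴ * η.1)
      - (2 : ℝ) • ((η.1 * ξ.1ᴴ + ξ.1 * η.1ᴴ) * S.1)),
    -(β / 2) • (S.2⁻¹ * η.2 * S.2⁻¹ * ξ.2 * S.2⁻¹ + S.2⁻¹ * ξ.2 * S.2⁻¹ * η.2 * S.2⁻¹))

/-- `(D_ξ η) - (D_ξ Π_H) η + Π_H g⁻¹ K(ξ, η)` at the point `S`. -/
def connFormula {𝕜 : Type*} [RCLike 𝕜] {n p : ℕ} (α₀ α₁ β : ℝ) (ξ η : Amb 𝕜 n p → Amb 𝕜 n p)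
    (S : Amb 𝕜 n p) : Amb 𝕜 n p :=
  dirDeriv (stiefelPD 𝕜 n p) η S (ξ S)
    - dirDeriv (stiefelPD 𝕜 n p) (fun S' => projH α₀ α₁ β S' (η S)) S (ξ S)
    + projH α₀ α₁ β S (gInv α₀ α₁ β S (kFormula α₀ α₁ β S (ξ S) (η S)))

/-- The vector field `ξ` on the Stiefel × positive-definite manifold is horizontal. -/
def IsHorizontalField {𝕜 : Type*} [RCLike 𝕜] {n p : ℕ} (α₀ α₁ β : ℝ)
    (ξ : Amb 𝕜 n p → Amb 𝕜 n p) : Prop :=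
  IsVectorField (stiefelPD 𝕜 n p) ξ ∧ ∀ S ∈ stiefelPD 𝕜 n p, ξ S ∈ horizontal α₀ α₁ β S

/-- `ξ` is the horizontal lift of the vector field `u` on the positive-semidefinite matrices of
rank `p`. -/
def IsHorizontalLift {𝕜 : Type*} [RCLike 𝕜] {n p : ℕ} (α₀ α₁ β : ℝ)
    (u : Matrix (Fin n) (Fin n) 𝕜 → Matrix (Fin n) (Fin n) 𝕜)
    (ξ : Amb 𝕜 n p → Amb 𝕜 n p) : Prop :=
  ∀ S ∈ stiefelPD 𝕜 n p, ξ S ∈ horizontal α₀ α₁ β S ∧ dproj S (ξ S) = u (proj S)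

/-- `F` is a smooth ambient gradient of the function `f` on the Stiefel × positive-definite manifold. -/
def IsAmbientGradient {𝕜 : Type*} [RCLike 𝕜] {n p : ℕ} (f : Amb 𝕜 n p → ℝ)
    (F : Amb 𝕜 n p → Amb 𝕜 n p) : Prop :=
  ContDiffOn ℝ ∞ F (stiefelPD 𝕜 n p) ∧
    ∀ S ∈ stiefelPD 𝕜 n p, ∀ η ∈ tangentSpaceAt (stiefelPD 𝕜 n p) S,
      ambInner η (F S) = dirDeriv (stiefelPD 𝕜 n p) f S η

/-- The Hessian expression
`Π_H g⁻¹ (D_ξ F + g (D_ξ (Π_H g⁻¹)) F + K(ξ, Π_H g⁻¹ F))` at `S`, for an ambient gradient `F`. -/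
def hessFormula₁ {𝕜 : Type*} [RCLike 𝕜] {n p : ℕ} (α₀ α₁ β : ℝ) (F : Amb 𝕜 n p → Amb 𝕜 n p)
    (S ξ : Amb 𝕜 n p) : Amb 𝕜 n p :=
  projH α₀ α₁ β S (gInv α₀ α₁ β S
    (dirDeriv (stiefelPD 𝕜 n p) F S ξ
      + gOp α₀ α₁ β S (dirDeriv (stiefelPD 𝕜 n p)
          (fun S' => projH α₀ α₁ β S' (gInv α₀ α₁ β S' (F S))) S ξ)
      + kFormula α₀ α₁ β S ξ (projH α₀ α₁ β S (gInv α₀ α₁ β S (F S)))))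

/-- The Hessian expression
`Π_H g⁻¹ (D_ξ F + g (D_ξ Π_H) g⁻¹ F - (D_ξ g) g⁻¹ F + K(ξ, Π_H g⁻¹ F))` at `S`. -/
def hessFormula₂ {𝕜 : Type*} [RCLike 𝕜] {n p : ℕ} (α₀ α₁ β : ℝ) (F : Amb 𝕜 n p → Amb 𝕜 n p)
    (S ξ : Amb 𝕜 n p) : Amb 𝕜 n p :=
  projH α₀ α₁ β S (gInv α₀ α₁ β S
    (dirDeriv (stiefelPD 𝕜 n p) F S ξ
      + gOp α₀ α₁ β S (dirDeriv (stiefelPD 𝕜 n p)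
          (fun S' => projH α₀ α₁ β S' (gInv α₀ α₁ β S (F S))) S ξ)
      - dg α₀ α₁ β S ξ (gInv α₀ α₁ β S (F S))
      + kFormula α₀ α₁ β S ξ (projH α₀ α₁ β S (gInv α₀ α₁ β S (F S)))))

end FixedRankPSD

end

open EmbeddedGeometry FixedRankPSD

/-! The map `proj` is a Riemannian submersion, so the geometry of the quotient can be computed
upstairs in the ambient vector space. Derivatives within a subset are in general not unique, but
their values on velocities of curves in the subset are, and only those values are ever compared.

Two analytic constructions supply the manifold structure. Near each of its points the total space
has a retraction, the polar factor of `Y` together with the Hermitian part of `P`; it identifies the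
tangent spaces and makes derivatives of smooth functions along smooth fields smooth. The map `proj`
has local sections (`exists_section_proj`): `Y` is the polar factor of `X Y₀ P₀⁻¹` and `P = Yᴴ X Y`.
Hence smoothness descends to the quotient and `dproj` is onto.

The algebra rests on `L(P)`. The vertical vectors are `(Y W, P W - W P)` with `W` skew, and pairing
a tangent `η` with one of them gives the trace of `Wᴴ` against the skew matrix `α₁ Yᴴ η_Y + β η_P
P⁻¹ - β P⁻¹ η_P`; horizontality is therefore the vanishing of that matrix. Put into the kernel of
`dproj`, or into the orthogonality condition for the projection, this equation produces `L(P)`. In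
an eigenbasis of `P` it multiplies the entries by `α₁ + β (Λ_i - Λ_j)² / (Λ_i Λ_j) > 0`, so it is
bijective (`bijective_lyap`). This gives the injectivity of `dproj` on horizontal vectors and the
projection formula (`gMet_projFormula`). The derivative formulas come from differentiating implicit
identities: `L(P) 𝒟 = sym(...)`, `g g⁻¹ = 1` and `Π_H η = η`.

The tangential projection of `D_ξ η + g⁻¹ K(ξ, η)` is a Levi-Civita connection upstairs
(`isLeviCivita_leviCivita`), and the Koszul formula makes it unique. For lifts of fields of the base
every Koszul term equals its counterpart below (`koszul_lift`), so the image under `dproj` of the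
connection on lifts depends only on the base point and is the Levi-Civita connection of the quotient
metric. Differentiating `Π_H η = η` gives the connection formula (`connFormula_eq`); the Hessian is
this formula for the lift `Π_H g⁻¹ F` of the gradient, expanded by the product rule. -/

open Filter Topology

/-! ### Differential calculus on subsets of a normed space. -/

namespace EmbeddedGeometry

section General

variable {E F G H : Type*} [NormedAddCommGroup E] [NormedSpace ℝ E]
  [NormedAddCommGroup F] [NormedSpace ℝ F] [NormedAddCommGroup G] [NormedSpace ℝ G]
  [NormedAddCommGroup H] [NormedSpace ℝ H]

/-! ### Directional derivatives within a set -/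

/-- Some derivative of `f` within `s` at `x` takes the value `d` at `v`. -/
def HasDirDeriv (s : Set E) (f : E → F) (x v : E) (d : F) : Prop :=
  ∃ f' : E →L[ℝ] F, HasFDerivWithinAt f f' s x ∧ f' v = d

namespace HasDirDeriv

variable {s : Set E} {x v : E}

theorem const (c : F) : HasDirDeriv s (fun _ => c) x v 0 :=
  ⟨0, hasFDerivWithinAt_const c x s, rfl⟩

theorem id : HasDirDeriv s (fun y => y) x v v :=
  ⟨ContinuousLinearMap.id ℝ E, hasFDerivWithinAt_id x s, rfl⟩

theorem add {f g : E → F} {a b : F} (hf : HasDirDeriv s f x v a) (hg : HasDirDeriv s g x v b) :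
    HasDirDeriv s (fun y => f y + g y) x v (a + b) := by
  obtain ⟨f', hf, rfl⟩ := hf
  obtain ⟨g', hg, rfl⟩ := hg
  exact ⟨f' + g', hf.add hg, rfl⟩

theorem sub {f g : E → F} {a b : F} (hf : HasDirDeriv s f x v a) (hg : HasDirDeriv s g x v b) :
    HasDirDeriv s (fun y => f y - g y) x v (a - b) := by
  obtain ⟨f', hf, rfl⟩ := hf
  obtain ⟨g', hg, rfl⟩ := hg
  exact ⟨f' - g', hf.sub hg, rfl⟩

theorem const_smul {f : E → F} {a : F} (c : ℝ) (hf : HasDirDeriv s f x v a) :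
    HasDirDeriv s (fun y => c • f y) x v (c • a) := by
  obtain ⟨f', hf, rfl⟩ := hf
  exact ⟨c • f', hf.const_smul c, rfl⟩

theorem smul {c : E → ℝ} {f : E → F} {b : ℝ} {a : F} (hc : HasDirDeriv s c x v b)
    (hf : HasDirDeriv s f x v a) :
    HasDirDeriv s (fun y => c y • f y) x v (c x • a + b • f x) := by
  obtain ⟨f', hf, rfl⟩ := hf
  obtain ⟨c', hc, rfl⟩ := hc
  exact ⟨_, hc.smul hf, by simp⟩

theorem prodMk {f : E → F} {g : E → G} {a : F} {b : G} (hf : HasDirDeriv s f x v a)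
    (hg : HasDirDeriv s g x v b) : HasDirDeriv s (fun y => (f y, g y)) x v (a, b) := by
  obtain ⟨f', hf, rfl⟩ := hf
  obtain ⟨g', hg, rfl⟩ := hg
  exact ⟨_, hf.prodMk hg, rfl⟩

theorem clm (L : F →L[ℝ] G) {f : E → F} {a : F} (hf : HasDirDeriv s f x v a) :
    HasDirDeriv s (fun y => L (f y)) x v (L a) := by
  obtain ⟨f', hf, rfl⟩ := hf
  exact ⟨L.comp f', L.hasFDerivAt.comp_hasFDerivWithinAt x hf, rfl⟩

theorem fst {f : E → F × G} {a : F × G} (hf : HasDirDeriv s f x v a) :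
    HasDirDeriv s (fun y => (f y).1) x v a.1 := hf.clm (ContinuousLinearMap.fst ℝ F G)

theorem snd {f : E → F × G} {a : F × G} (hf : HasDirDeriv s f x v a) :
    HasDirDeriv s (fun y => (f y).2) x v a.2 := hf.clm (ContinuousLinearMap.snd ℝ F G)

theorem bilin (B : F →L[ℝ] G →L[ℝ] H) {f : E → F} {g : E → G} {a : F} {b : G}
    (hf : HasDirDeriv s f x v a) (hg : HasDirDeriv s g x v b) :
    HasDirDeriv s (fun y => B (f y) (g y)) x v (B a (g x) + B (f x) b) := by
  obtain ⟨f', hf, rfl⟩ := hf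
  obtain ⟨g', hg, rfl⟩ := hg
  exact ⟨_, B.hasFDerivWithinAt_of_bilinear hf hg, by simp [add_comm]⟩

theorem congr {f g : E → F} {a : F} (hf : HasDirDeriv s f x v a) (h : Set.EqOn g f s)
    (hx : x ∈ s) : HasDirDeriv s g x v a := by
  obtain ⟨f', hf, rfl⟩ := hf
  exact ⟨f', hf.congr h (h hx), rfl⟩

theorem comp {t : Set F} {f : E → F} {g : F → G} {a : F} {b : G} (hg : HasDirDeriv t g (f x) a b)
    (hf : HasDirDeriv s f x v a) (h : Set.MapsTo f s t) :
    HasDirDeriv s (fun y => g (f y)) x v b := by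
  obtain ⟨f', hf, rfl⟩ := hf
  obtain ⟨g', hg, rfl⟩ := hg
  exact ⟨_, hg.comp x hf h, rfl⟩

end HasDirDeriv

theorem hasDirDeriv_dirDeriv {s : Set E} {f : E → F} {x : E} (h : DifferentiableWithinAt ℝ f s x)
    (v : E) : HasDirDeriv s f x v (dirDeriv s f x v) :=
  ⟨_, h.hasFDerivWithinAt, rfl⟩

theorem ContDiffOn.hasDirDeriv {s : Set E} {f : E → F} {x : E} (h : ContDiffOn ℝ ∞ f s)
    (hx : x ∈ s) (v : E) : HasDirDeriv s f x v (dirDeriv s f x v) :=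
  hasDirDeriv_dirDeriv ((h x hx).differentiableWithinAt (by simp)) v

theorem HasFDerivAt.hasDirDeriv {f : E → F} {x : E} {f' : E →L[ℝ] F} (h : HasFDerivAt f f' x)
    (s : Set E) (v : E) : HasDirDeriv s f x v (f' v) :=
  ⟨f', h.hasFDerivWithinAt, rfl⟩

theorem dirDeriv_add_right (s : Set E) (f : E → F) (x v w : E) :
    dirDeriv s f x (v + w) = dirDeriv s f x v + dirDeriv s f x w := map_add _ _ _

theorem dirDeriv_smul_right (s : Set E) (f : E → F) (x : E) (c : ℝ) (v : E) :
    dirDeriv s f x (c • v) = c • dirDeriv s f x v := map_smul _ _ _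

theorem dirDeriv_congr {s : Set E} {f g : E → F} (h : Set.EqOn f g s) {x : E} (hx : x ∈ s)
    (v : E) : dirDeriv s f x v = dirDeriv s g x v := by
  rw [dirDeriv, dirDeriv, fderivWithin_congr h (h hx)]

/-! ### Tangent vectors -/

theorem hasDerivAt_comp_curve {s : Set E} {f : E → F} {x : E} {f' : E →L[ℝ] F}
    (h : HasFDerivWithinAt f f' s x) {γ : ℝ → E} (hγ : ∀ t, γ t ∈ s) (h0 : γ 0 = x) {v : E}
    (hv : HasDerivAt γ v 0) : HasDerivAt (fun t => f (γ t)) (f' v) 0 := by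
  subst h0
  rw [← hasDerivWithinAt_univ] at hv ⊢
  exact h.comp_hasDerivWithinAt 0 hv (fun t _ => hγ t)

/-- By the chain rule, any derivative within `s` evaluated at the velocity of a curve in `s` is the
derivative of `f` along that curve; linearity extends this to the span. Unique differentiability of
`s` is not needed. -/
theorem HasFDerivWithinAt.apply_eq_of_mem_tangentSpaceAt {s : Set E} {f : E → F} {x : E}
    {f₁ f₂ : E →L[ℝ] F} (h₁ : HasFDerivWithinAt f f₁ s x) (h₂ : HasFDerivWithinAt f f₂ s x)
    {v : E} (hv : v ∈ tangentSpaceAt s x) : f₁ v = f₂ v := by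
  induction hv using Submodule.span_induction with
  | mem v hv =>
    obtain ⟨γ, -, hγ, h0, hv⟩ := hv
    exact (hasDerivAt_comp_curve h₁ hγ h0 hv).unique (hasDerivAt_comp_curve h₂ hγ h0 hv)
  | zero => simp
  | add a b _ _ ha hb => simp [ha, hb]
  | smul c a _ ha => simp [ha]

theorem HasDirDeriv.unique {s : Set E} {f : E → F} {x v : E} {a b : F}
    (ha : HasDirDeriv s f x v a) (hb : HasDirDeriv s f x v b) (hv : v ∈ tangentSpaceAt s x) :
    a = b := by
  obtain ⟨f', hf, rfl⟩ := ha
  obtain ⟨g', hg, rfl⟩ := hb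
  exact HasFDerivWithinAt.apply_eq_of_mem_tangentSpaceAt hf hg hv

theorem HasDirDeriv.dirDeriv_eq {s : Set E} {f : E → F} {x v : E} {a : F}
    (ha : HasDirDeriv s f x v a) (hv : v ∈ tangentSpaceAt s x) : dirDeriv s f x v = a := by
  obtain ⟨f', hf, rfl⟩ := ha
  exact HasFDerivWithinAt.apply_eq_of_mem_tangentSpaceAt
    hf.differentiableWithinAt.hasFDerivWithinAt hf hv

/-- A smooth curve that stays in `M` for a short time has its velocity in the tangent space. -/
theorem mem_tangentSpaceAt_of_curve {M : Set E} {x v : E} {c : ℝ → E}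
    (hc : ∀ᶠ t in 𝓝 (0 : ℝ), ContDiffAt ℝ ∞ c t) (hM : ∀ᶠ t in 𝓝 (0 : ℝ), c t ∈ M)
    (h0 : c 0 = x) (hv : HasDerivAt c v 0) : v ∈ tangentSpaceAt M x := by
  obtain ⟨ε, hε, h⟩ := Metric.eventually_nhds_iff.1 (hc.and hM)
  -- The tangent space is defined with curves that stay in `M` for all times. This reparametrization
  -- has values in `(-ε, ε)`, fixes `0` and has derivative `1` there, so it makes a short curve
  -- global without changing its velocity.
  set φ : ℝ → ℝ := fun t => (ε / 2) * Real.sin ((2 / ε) * t)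
  have hφ : ∀ t, dist (φ t) 0 < ε := by
    intro t
    have := Real.abs_sin_le_one ((2 / ε) * t)
    rw [Real.dist_eq, sub_zero, abs_mul, abs_of_pos (by positivity : 0 < ε / 2)]
    nlinarith
  have hφ0 : φ 0 = 0 := by simp [φ]
  refine Submodule.subset_span ⟨fun t => c (φ t), ?_, fun t => (h (hφ t)).2, by simp [hφ0, h0], ?_⟩
  · rw [contDiff_iff_contDiffAt]
    intro t
    exact (h (hφ t)).1.comp t (by fun_prop)
  · have h1 : HasDerivAt φ 1 0 := by
      have := ((Real.hasDerivAt_sin ((2 / ε) * 0)).comp (0 : ℝ)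
        ((hasDerivAt_id (0 : ℝ)).const_mul (2 / ε))).const_mul (ε / 2)
      have h3 : ε / 2 * (Real.cos (2 / ε * 0) * (2 / ε * 1)) = 1 := by
        rw [mul_zero, Real.cos_zero]
        field_simp
      rwa [h3] at this
    have h2 : HasDerivAt c v (φ 0) := by rwa [hφ0]
    have h4 := h2.scomp (0 : ℝ) h1
    rwa [one_smul] at h4

/-- A map that is smooth on `M` near `x` and takes values in `N` there sends tangent vectors to
tangent vectors. -/
theorem HasDirDeriv.mem_tangentSpaceAt {M : Set E} {N : Set F} {f : E → F} {x v : E} {d : F}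
    (hd : HasDirDeriv M f x v d) (hv : v ∈ tangentSpaceAt M x)
    (hf : ∀ᶠ y in 𝓝[M] x, ContDiffWithinAt ℝ ∞ f M y) (hN : ∀ᶠ y in 𝓝[M] x, f y ∈ N) :
    d ∈ tangentSpaceAt N (f x) := by
  obtain ⟨f', h, rfl⟩ := hd
  induction hv using Submodule.span_induction with
  | mem v hv =>
    obtain ⟨γ, hγ, hM, h0, hv⟩ := hv
    have ht : Tendsto γ (𝓝 0) (𝓝[M] x) := by
      rw [← h0]
      exact tendsto_nhdsWithin_of_tendsto_nhds_of_eventually_within _ hγ.continuous.continuousAt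
        (Eventually.of_forall hM)
    refine mem_tangentSpaceAt_of_curve (c := fun t => f (γ t)) ?_ (ht.eventually hN)
      (by simp [h0]) (hasDerivAt_comp_curve h hM h0 hv)
    filter_upwards [ht.eventually hf] with t h
    have := h.comp (s := Set.univ) t (hγ.contDiffAt (x := t)).contDiffWithinAt (fun s _ => hM s)
    rwa [contDiffWithinAt_univ] at this
  | zero => simp
  | add a b _ _ ha hb => simpa using add_mem ha hb
  | smul c a _ ha => simpa using Submodule.smul_mem _ c ha

theorem HasDirDeriv.mem_tangentSpaceAt_of_contDiffOn {M : Set E} {N : Set F} {f : E → F}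
    {x v : E} {d : F} (hd : HasDirDeriv M f x v d) (hv : v ∈ tangentSpaceAt M x)
    (hf : ContDiffOn ℝ ∞ f M) (hN : Set.MapsTo f M N) : d ∈ tangentSpaceAt N (f x) :=
  hd.mem_tangentSpaceAt hv (eventually_mem_nhdsWithin.mono hf)
    (eventually_mem_nhdsWithin.mono hN)

/-! ### Local retractions -/

/-- `r` is an analytic retraction of a neighbourhood of `x` to `M`. -/
structure IsLocalRetraction (M : Set E) (x : E) (r : E → E) : Prop where
  contDiffAt : ContDiffAt ℝ ω r x
  mem : ∀ᶠ y in 𝓝 x, r y ∈ M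
  eq_self : ∀ᶠ y in 𝓝[M] x, r y = y

/-- Every point of `M` has a neighbourhood with an analytic retraction to `M`. -/
def HasLocalRetractions (M : Set E) : Prop := ∀ x ∈ M, ∃ r, IsLocalRetraction M x r

/-- Smoothness of order `∞` at a point does not by itself spread to a neighbourhood, whereas
analyticity does. For this reason retractions and sections are required to be of class `ω`. -/
theorem eventually_contDiffAt {f : E → F} {x : E} (h : ContDiffAt ℝ ω f x) :
    ∀ᶠ y in 𝓝 x, ContDiffAt ℝ ∞ f y :=
  (h.eventually (by simp)).mono fun _ hy => hy.of_le le_top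

/-- The curve `t ↦ r (x + t v)` lies in `M` for short times, passes through `r x = x` and has
velocity `d`. -/
theorem IsLocalRetraction.fderiv_mem {M : Set E} {x : E} {r : E → E}
    (h : IsLocalRetraction M x r) (hx : x ∈ M) {v d : E} (hd : HasDirDeriv Set.univ r x v d) :
    d ∈ tangentSpaceAt M x := by
  obtain ⟨f', hf, rfl⟩ := hd
  have hline : HasDerivAt (fun t : ℝ => x + t • v) v 0 := by
    simpa using ((hasDerivAt_id (0 : ℝ)).smul_const v).const_add x
  have ht : Tendsto (fun t : ℝ => x + t • v) (𝓝 0) (𝓝 x) := by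
    have := hline.continuousAt.tendsto
    simpa using this
  have hrx : r x = x := h.eq_self.self_of_nhdsWithin hx
  refine mem_tangentSpaceAt_of_curve (c := fun t : ℝ => r (x + t • v)) ?_
    (ht.eventually h.mem) (by simpa using hrx) ?_
  · filter_upwards [ht.eventually (eventually_contDiffAt h.contDiffAt)] with t h
    exact h.comp t (by fun_prop)
  · rw [hasFDerivWithinAt_univ] at hf
    have hf' : HasFDerivAt r f' (x + (0 : ℝ) • v) := by simpa using hf
    exact hf'.comp_hasDerivAt (0 : ℝ) hline

theorem IsLocalRetraction.eventually_contDiffAt_comp {M : Set E} {x : E} {r : E → E}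
    (h : IsLocalRetraction M x r) {f : E → F} (hf : ContDiffOn ℝ ∞ f M) :
    ∀ᶠ y in 𝓝 x, ContDiffAt ℝ ∞ (fun z => f (r z)) y := by
  filter_upwards [eventually_contDiffAt h.contDiffAt, h.mem.eventually_nhds, h.mem] with y h1 h2 h3
  have h4 := (hf (r y) h3).comp_of_preimage_mem_nhdsWithin (s := Set.univ) y
    h1.contDiffWithinAt (by rw [nhdsWithin_univ]; exact h2)
  rwa [contDiffWithinAt_univ] at h4

/-- Near `x`, the function `f ∘ r` is a smooth extension of `f` to an open set. Its derivative is
smooth, and it is also a derivative of `f` within `M`, so it has the required values on tangent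
vectors. -/
theorem contDiffOn_dirDeriv {M : Set E} (hM : HasLocalRetractions M) {f : E → F} {ξ : E → E}
    (hf : ContDiffOn ℝ ∞ f M) (hξ : IsVectorField M ξ) :
    ContDiffOn ℝ ∞ (fun x => dirDeriv M f x (ξ x)) M := by
  intro x hx
  obtain ⟨r, hr⟩ := hM x hx
  have hg := hr.eventually_contDiffAt_comp hf
  obtain ⟨U, hU, hUo, hxU⟩ := eventually_nhds_iff.1 hg
  have hgU : ContDiffOn ℝ ∞ (fun z => f (r z)) U := fun y hy => (hU y hy).contDiffWithinAt
  have hd : ContDiffAt ℝ ∞ (fderiv ℝ (fun z => f (r z))) x :=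
    (hgU.fderiv_of_isOpen hUo (m := ∞) (by simp)).contDiffAt (hUo.mem_nhds hxU)
  have h1 : ContDiffWithinAt ℝ ∞ (fun y => fderiv ℝ (fun z => f (r z)) y (ξ y)) M x :=
    hd.contDiffWithinAt.clm_apply (hξ.smooth x hx)
  have key : ∀ᶠ y in 𝓝[M] x,
      dirDeriv M f y (ξ y) = fderiv ℝ (fun z => f (r z)) y (ξ y) := by
    -- At points `y` of `M` near `x`, the identity `r z = z` must hold for all `z` in `M` near `y`,
    -- not only at `y`, for the two derivatives at `y` to be compared.
    have h2 := eventually_eventually_nhdsWithin.2 hr.eq_self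
    filter_upwards [h2, hr.eq_self, eventually_mem_nhdsWithin,
      nhdsWithin_le_nhds hg] with y h3 h3' h4 h5
    have h6 : HasFDerivWithinAt f (fderiv ℝ (fun z => f (r z)) y) M y := by
      refine ((h5.differentiableAt (by simp)).hasFDerivAt.hasFDerivWithinAt).congr_of_eventuallyEq
        ?_ (by rw [h3'])
      filter_upwards [h3] with z hz
      rw [hz]
    exact HasDirDeriv.dirDeriv_eq ⟨_, h6, rfl⟩ (hξ.tangent y h4)
  exact h1.congr_of_eventuallyEq key (key.self_of_nhdsWithin hx)

end General

end EmbeddedGeometry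

/-! ### Levi-Civita connections and Riemannian submersions. -/

namespace EmbeddedGeometry

noncomputable section LeviCivita

variable {E F : Type*} [NormedAddCommGroup E] [NormedSpace ℝ E]
  [NormedAddCommGroup F] [NormedSpace ℝ F]

namespace IsVectorField

variable {M : Set E} {ξ η : E → E}

theorem add (hξ : IsVectorField M ξ) (hη : IsVectorField M η) :
    IsVectorField M (fun x => ξ x + η x) :=
  ⟨hξ.smooth.add hη.smooth, fun x hx => add_mem (hξ.tangent x hx) (hη.tangent x hx)⟩

theorem smul {f : E → ℝ} (hf : ContDiffOn ℝ ∞ f M) (hη : IsVectorField M η) :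
    IsVectorField M (fun x => f x • η x) :=
  ⟨hf.smul hη.smooth, fun x hx => Submodule.smul_mem _ _ (hη.tangent x hx)⟩

theorem hasDirDeriv (hξ : IsVectorField M ξ) {x : E} (hx : x ∈ M) (v : E) :
    HasDirDeriv M ξ x v (dirDeriv M ξ x v) :=
  ContDiffOn.hasDirDeriv hξ.smooth hx v

end IsVectorField

namespace IsRiemannianMetric

variable {M : Set E} {g : E → E → E → ℝ} (hg : IsRiemannianMetric M g) {x : E} (hx : x ∈ M)
  {u v w : E} (hu : u ∈ tangentSpaceAt M x) (hv : v ∈ tangentSpaceAt M x)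
  (hw : w ∈ tangentSpaceAt M x)

include hg hx hu hv hw in
theorem sub_left : g x (u - v) w = g x u w - g x v w := by
  have h : u - v = u + (-1 : ℝ) • v := by simp [sub_eq_add_neg]
  rw [h, hg.add_left x hx u hu _ (Submodule.smul_mem _ _ hv) w hw,
    hg.smul_left x hx _ v hv w hw]
  ring

include hg hx hu hv in
-- Definiteness, tested on the tangent vector `u - v` itself.
theorem eq_of_forall (h : ∀ w ∈ tangentSpaceAt M x, g x u w = g x v w) : u = v := by
  by_contra hne
  have h1 := hg.pos x hx (u - v) (sub_mem hu hv) (sub_ne_zero.2 hne)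
  rw [hg.sub_left hx hu hv (sub_mem hu hv), h _ (sub_mem hu hv), sub_self] at h1
  exact lt_irrefl _ h1

end IsRiemannianMetric

/-- The Lie bracket of two vector fields on `M`. -/
def bracket (M : Set E) (ξ η : E → E) (x : E) : E :=
  dirDeriv M η x (ξ x) - dirDeriv M ξ x (η x)

/-- The right-hand side of the Koszul formula for `2 ⟨∇_ξ η, φ⟩`. -/
def koszul (M : Set E) (g : E → E → E → ℝ) (ξ η φ : E → E) (x : E) : ℝ :=
  dirDeriv M (fun y => g y (η y) (φ y)) x (ξ x) + dirDeriv M (fun y => g y (φ y) (ξ y)) x (η x)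
    - dirDeriv M (fun y => g y (ξ y) (η y)) x (φ x)
    + g x (bracket M ξ η x) (φ x) - g x (bracket M η φ x) (ξ x) + g x (bracket M φ ξ x) (η x)

namespace IsLeviCivita

variable {M : Set E} {g : E → E → E → ℝ} {nabla nabla' : (E → E) → (E → E) → E → E}
  {ξ η φ : E → E} {x : E}

theorem bracket_mem (h : IsLeviCivita M g nabla) (hξ : IsVectorField M ξ)
    (hη : IsVectorField M η) (hx : x ∈ M) : bracket M ξ η x ∈ tangentSpaceAt M x := by
  rw [bracket, ← h.torsion_free ξ η hξ hη x hx]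
  exact sub_mem ((h.isVectorField ξ η hξ hη).tangent x hx)
    ((h.isVectorField η ξ hη hξ).tangent x hx)

/-- Compatibility expands the three derivatives and vanishing torsion the three brackets; all terms
except two copies of `⟨∇_ξ η, φ⟩` cancel. -/
theorem koszul_eq (h : IsLeviCivita M g nabla) (hg : IsRiemannianMetric M g)
    (hξ : IsVectorField M ξ) (hη : IsVectorField M η) (hφ : IsVectorField M φ) (hx : x ∈ M) :
    koszul M g ξ η φ x = 2 * g x (nabla ξ η x) (φ x) := by
  have t : ∀ {a b : E → E}, IsVectorField M a → IsVectorField M b →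
      nabla a b x ∈ tangentSpaceAt M x := fun ha hb => (h.isVectorField _ _ ha hb).tangent x hx
  have e : ∀ {a b c : E → E}, IsVectorField M a → IsVectorField M b → IsVectorField M c →
      g x (bracket M a b x) (c x) = g x (nabla a b x) (c x) - g x (nabla b a x) (c x) := by
    intro a b c ha hb hc
    rw [bracket, ← h.torsion_free a b ha hb x hx,
      hg.sub_left hx (t ha hb) (t hb ha) (hc.tangent x hx)]
  rw [koszul, e hξ hη hφ, e hη hφ hξ, e hφ hξ hη, h.metric_compat ξ η φ hξ hη hφ x hx,
    h.metric_compat η φ ξ hη hφ hξ x hx, h.metric_compat φ ξ η hφ hξ hη x hx,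
    hg.symm x hx (η x) (hη.tangent x hx) _ (t hξ hφ),
    hg.symm x hx (φ x) (hφ.tangent x hx) _ (t hη hξ),
    hg.symm x hx (ξ x) (hξ.tangent x hx) _ (t hφ hη)]
  ring

/-- The Koszul expression does not involve the connection, so both connections have the same pairing
with every vector field. Extending each tangent vector at `x` to a field turns this into equality at
`x`. -/
theorem eq_of_extends (h : IsLeviCivita M g nabla) (h' : IsLeviCivita M g nabla')
    (hg : IsRiemannianMetric M g)
    (hext : ∀ v ∈ tangentSpaceAt M x, ∃ φ, IsVectorField M φ ∧ φ x = v)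
    (hξ : IsVectorField M ξ) (hη : IsVectorField M η) (hx : x ∈ M) :
    nabla ξ η x = nabla' ξ η x := by
  refine hg.eq_of_forall hx ((h.isVectorField ξ η hξ hη).tangent x hx)
    ((h'.isVectorField ξ η hξ hη).tangent x hx) fun w hw => ?_
  obtain ⟨φ, hφ, rfl⟩ := hext w hw
  have h1 := h.koszul_eq hg hξ hη hφ hx
  have h2 := h'.koszul_eq hg hξ hη hφ hx
  linarith

end IsLeviCivita

/-! ### Riemannian submersions -/

/-- `π` restricts to a Riemannian submersion of `(M, g)` to `(B, gB)` with horizontal spaces `H`,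
horizontal projections `P` and horizontal lifts `lift`. -/
structure IsRiemannianSubmersion (M : Set E) (B : Set F) (g : E → E → E → ℝ)
    (gB : F → F → F → ℝ) (π : E → F) (H : E → Set E) (P : E → E → E)
    (lift : E → F →ₗ[ℝ] E) : Prop where
  contDiff : ContDiff ℝ ∞ π
  mapsTo : Set.MapsTo π M B
  exists_section : ∀ X ∈ B, ∃ σ : F → E, ContDiffAt ℝ ω σ X ∧ (∀ᶠ Z in 𝓝 X, σ Z ∈ M) ∧
    ∀ᶠ Z in 𝓝[B] X, π (σ Z) = Z
  metric : IsRiemannianMetric M g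
  metric_base : IsRiemannianMetric B gB
  tangent : ∀ S ∈ M, ∀ η ∈ H S, η ∈ tangentSpaceAt M S
  proj_mem : ∀ S ∈ M, ∀ w, P S w ∈ H S
  proj_orth : ∀ S ∈ M, ∀ w ∈ tangentSpaceAt M S, ∀ ζ ∈ H S, g S (P S w) ζ = g S w ζ
  fderiv_proj : ∀ S ∈ M, ∀ w ∈ tangentSpaceAt M S, fderiv ℝ π S (P S w) = fderiv ℝ π S w
  lift_mem : ∀ S ∈ M, ∀ v ∈ tangentSpaceAt B (π S), lift S v ∈ H S
  fderiv_lift : ∀ S ∈ M, ∀ v ∈ tangentSpaceAt B (π S), fderiv ℝ π S (lift S v) = v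
  lift_smooth : ∀ u : F → F, IsVectorField B u →
    ContDiffOn ℝ ∞ (fun S => lift S (u (π S))) M
  isometry : ∀ S ∈ M, ∀ η ∈ H S, ∀ ζ ∈ H S,
    gB (π S) (fderiv ℝ π S η) (fderiv ℝ π S ζ) = g S η ζ
  extends_base : ∀ X ∈ B, ∀ v ∈ tangentSpaceAt B X, ∃ u, IsVectorField B u ∧ u X = v

/-- Smoothness on the base of a map with local sections can be checked on the total space. -/
theorem contDiffOn_of_section {G : Type*} [NormedAddCommGroup G] [NormedSpace ℝ G] {M : Set E}
    {B : Set F} {π : E → F}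
    (h : ∀ X ∈ B, ∃ σ : F → E, ContDiffAt ℝ ω σ X ∧ (∀ᶠ Z in 𝓝 X, σ Z ∈ M) ∧
      ∀ᶠ Z in 𝓝[B] X, π (σ Z) = Z)
    {f : F → G} (hf : ContDiffOn ℝ ∞ (fun S => f (π S)) M) : ContDiffOn ℝ ∞ f B := by
  intro X hX
  obtain ⟨σ, h0, h1, h2⟩ := h X hX
  have h3 : ContDiffWithinAt ℝ ∞ (fun Z => f (π (σ Z))) Set.univ X :=
    (hf (σ X) h1.self_of_nhds).comp_of_preimage_mem_nhdsWithin X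
      (h0.of_le le_top).contDiffWithinAt (by rw [nhdsWithin_univ]; exact h1)
  refine (h3.mono (Set.subset_univ B)).congr_of_eventuallyEq ?_
    (by rw [h2.self_of_nhdsWithin hX])
  filter_upwards [h2] with Z hZ
  rw [hZ]

namespace IsRiemannianSubmersion

variable {M : Set E} {B : Set F} {g : E → E → E → ℝ} {gB : F → F → F → ℝ} {π : E → F}
  {H : E → Set E} {P : E → E → E} {lift : E → F →ₗ[ℝ] E}
  (h : IsRiemannianSubmersion M B g gB π H P lift)

include h

theorem exists_eq {X : F} (hX : X ∈ B) : ∃ S ∈ M, π S = X := by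
  obtain ⟨σ, -, h1, h2⟩ := h.exists_section X hX
  exact ⟨σ X, h1.self_of_nhds, h2.self_of_nhdsWithin hX⟩

theorem hasDirDeriv (S v : E) : HasDirDeriv M π S v (fderiv ℝ π S v) :=
  HasFDerivAt.hasDirDeriv (h.contDiff.differentiable (by simp) S).hasFDerivAt M v

theorem fderiv_mem {S : E} {v : E} (hv : v ∈ tangentSpaceAt M S) :
    fderiv ℝ π S v ∈ tangentSpaceAt B (π S) :=
  (h.hasDirDeriv S v).mem_tangentSpaceAt_of_contDiffOn hv h.contDiff.contDiffOn h.mapsTo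

theorem lift_isVectorField {u : F → F} (hu : IsVectorField B u) :
    IsVectorField M (fun S => lift S (u (π S))) :=
  ⟨h.lift_smooth u hu, fun S hS => h.tangent S hS _
    (h.lift_mem S hS _ (hu.tangent _ (h.mapsTo hS)))⟩

/-- A function on `M` that is constant on the fibers and smooth descends to a smooth function. -/
theorem contDiffOn_of_eq {G : Type*} [NormedAddCommGroup G] [NormedSpace ℝ G] {f : F → G}
    {f' : E → G} (hf : ContDiffOn ℝ ∞ f' M) (he : ∀ S ∈ M, f (π S) = f' S) :
    ContDiffOn ℝ ∞ f B :=
  contDiffOn_of_section h.exists_section (hf.congr he)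

theorem dirDeriv_comp {G : Type*} [NormedAddCommGroup G] [NormedSpace ℝ G] {f : F → G}
    (hf : ContDiffOn ℝ ∞ f B) {S : E} (hS : S ∈ M) {v : E} (hv : v ∈ tangentSpaceAt M S) :
    dirDeriv M (fun S => f (π S)) S v = dirDeriv B f (π S) (fderiv ℝ π S v) :=
  ((ContDiffOn.hasDirDeriv hf (h.mapsTo hS) _).comp (h.hasDirDeriv S v) h.mapsTo).dirDeriv_eq hv

variable {nabla : (E → E) → (E → E) → E → E} (hn : IsLeviCivita M g nabla)
  {u v w : F → F} (hu : IsVectorField B u) (hv : IsVectorField B v) (hw : IsVectorField B w)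
  {S : E} (hS : S ∈ M)

include hu hS in
theorem fderiv_lift_field : fderiv ℝ π S (lift S (u (π S))) = u (π S) :=
  h.fderiv_lift S hS _ (hu.tangent _ (h.mapsTo hS))

include hv hS in
theorem metric_lift {η : E} (hη : η ∈ H S) :
    g S η (lift S (v (π S))) = gB (π S) (fderiv ℝ π S η) (v (π S)) := by
  rw [← h.isometry S hS _ hη _ (h.lift_mem S hS _ (hv.tangent _ (h.mapsTo hS))),
    h.fderiv_lift_field hv hS]

include hv hS in
-- The lift is horizontal, so only the horizontal part of `η` contributes, and passing to that part
-- does not change its image under the differential of `π`.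
theorem metric_lift_tangent {η : E} (hη : η ∈ tangentSpaceAt M S) :
    g S η (lift S (v (π S))) = gB (π S) (fderiv ℝ π S η) (v (π S)) := by
  rw [← h.proj_orth S hS η hη _ (h.lift_mem S hS _ (hv.tangent _ (h.mapsTo hS))),
    h.metric_lift hv hS (h.proj_mem S hS η), h.fderiv_proj S hS η hη]

include hu hv hw hS in
theorem dirDeriv_metric :
    dirDeriv M (fun S => g S (lift S (v (π S))) (lift S (w (π S)))) S (lift S (u (π S))) =
      dirDeriv B (fun X => gB X (v X) (w X)) (π S) (u (π S)) := by
  rw [dirDeriv_congr (g := fun S => (fun X => gB X (v X) (w X)) (π S)) ?_ hS,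
    h.dirDeriv_comp (h.metric_base.smooth v w hv hw) hS
      ((h.lift_isVectorField hu).tangent S hS), h.fderiv_lift_field hu hS]
  intro S hS
  simp only
  rw [h.metric_lift hw hS (h.lift_mem S hS _ (hv.tangent _ (h.mapsTo hS))),
    h.fderiv_lift_field hv hS]

include hu hv hS in
-- Related fields have related brackets. Differentiating `dπ (lift b) = b ∘ π` along the lift of `a`
-- produces a second derivative of `π` and the derivative of the lift; the second derivative is
-- symmetric and drops out of the difference.
theorem fderiv_bracket :
    fderiv ℝ π S (bracket M (fun S => lift S (u (π S))) (fun S => lift S (v (π S))) S) =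
      bracket B u v (π S) := by
  have h2 : ∀ x, HasFDerivAt (fderiv ℝ π) (fderiv ℝ (fderiv ℝ π) x) x := fun x =>
    ((h.contDiff.fderiv_right (m := 1) (by norm_cast)).differentiable (by simp) x).hasFDerivAt
  have key : ∀ {a b : F → F}, IsVectorField B a → IsVectorField B b →
      fderiv ℝ (fderiv ℝ π) S (lift S (a (π S))) (lift S (b (π S))) +
        fderiv ℝ π S (dirDeriv M (fun S => lift S (b (π S))) S (lift S (a (π S)))) =
      dirDeriv B b (π S) (a (π S)) := by
    intro a b ha hb
    have ht := (h.lift_isVectorField ha).tangent S hS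
    have h1 := (h.lift_isVectorField hb).hasDirDeriv hS (lift S (a (π S)))
    have h3 := HasDirDeriv.bilin (ContinuousLinearMap.id ℝ (E →L[ℝ] F))
      (HasFDerivAt.hasDirDeriv (h2 S) M (lift S (a (π S)))) h1
    have h4 := (ContDiffOn.hasDirDeriv hb.smooth (h.mapsTo hS)
      (fderiv ℝ π S (lift S (a (π S))))).comp (h.hasDirDeriv S _) h.mapsTo
    rw [h.fderiv_lift_field ha hS] at h4
    refine h3.unique (h4.congr (fun T hT => ?_) hS) ht
    exact h.fderiv_lift_field hb hT
  have hs : IsSymmSndFDerivAt ℝ π S :=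
    h.contDiff.contDiffAt.isSymmSndFDerivAt (by simp; norm_cast)
  rw [bracket, bracket, map_sub, ← key hu hv, ← key hv hu, hs.eq]
  abel

include hn hu hv hw hS in
-- The derivative terms agree because the metric of two lifts is a function pulled back from the
-- base. The bracket terms agree although the brackets upstairs need not be horizontal, since
-- pairing with a lift sees only their images.
theorem koszul_lift :
    koszul M g (fun S => lift S (u (π S))) (fun S => lift S (v (π S)))
      (fun S => lift S (w (π S))) S = koszul B gB u v w (π S) := by
  have e : ∀ {a b c : F → F}, IsVectorField B a → IsVectorField B b → IsVectorField B c →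
      g S (bracket M (fun S => lift S (a (π S))) (fun S => lift S (b (π S))) S)
        (lift S (c (π S))) = gB (π S) (bracket B a b (π S)) (c (π S)) := by
    intro a b c ha hb hc
    rw [h.metric_lift_tangent hc hS
      (hn.bracket_mem (h.lift_isVectorField ha) (h.lift_isVectorField hb) hS),
      h.fderiv_bracket ha hb hS]
  rw [koszul, koszul, h.dirDeriv_metric hu hv hw hS, h.dirDeriv_metric hv hw hu hS,
    h.dirDeriv_metric hw hu hv hS, e hu hv hw, e hv hw hu, e hw hu hv]

include hn hu hv hw hS in
-- This characterizes the projected connection on lifts purely in terms of the base, without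
-- presupposing a connection there. It serves for its identification as well as for existence.
theorem two_mul_metric_base :
    2 * gB (π S) (fderiv ℝ π S
      (P S (nabla (fun S => lift S (u (π S))) (fun S => lift S (v (π S))) S))) (w (π S)) =
      koszul B gB u v w (π S) := by
  have ht := (hn.isVectorField _ _ (h.lift_isVectorField hu) (h.lift_isVectorField hv)).tangent S hS
  rw [h.fderiv_proj S hS _ ht, ← h.metric_lift_tangent hw hS ht,
    ← h.koszul_lift hn hu hv hw hS, hn.koszul_eq h.metric (h.lift_isVectorField hu)
      (h.lift_isVectorField hv) (h.lift_isVectorField hw) hS]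

include hS in
theorem proj_nabla_mem :
    fderiv ℝ π S (P S (nabla (fun S => lift S (u (π S))) (fun S => lift S (v (π S))) S)) ∈
      tangentSpaceAt B (π S) :=
  h.fderiv_mem (h.tangent S hS _ (h.proj_mem S hS _))

include hn hu hv hS in
/-- The horizontal part of the connection of the total space is the lift of that of the base. -/
theorem fderiv_proj_nabla {nablaB : (F → F) → (F → F) → F → F} (hB : IsLeviCivita B gB nablaB) :
    fderiv ℝ π S (P S (nabla (fun S => lift S (u (π S))) (fun S => lift S (v (π S))) S)) =
      nablaB u v (π S) := by
  refine h.metric_base.eq_of_forall (h.mapsTo hS) (h.proj_nabla_mem hS)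
    ((hB.isVectorField u v hu hv).tangent _ (h.mapsTo hS)) fun z hz => ?_
  obtain ⟨w, hw, rfl⟩ := h.extends_base _ (h.mapsTo hS) z hz
  have h1 := h.two_mul_metric_base hn hu hv hw hS
  have h2 := hB.koszul_eq h.metric_base hu hv hw (h.mapsTo hS)
  linarith

include hn hu hv hS in
-- At both points the pairing with any field of the base is half the Koszul expression at the common
-- image, and the metric of the base is nondegenerate.
theorem proj_nabla_eq_of_fiber {S' : E} (hS' : S' ∈ M) (he : π S = π S') :
    fderiv ℝ π S (P S (nabla (fun S => lift S (u (π S))) (fun S => lift S (v (π S))) S)) =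
    fderiv ℝ π S'
      (P S' (nabla (fun S => lift S (u (π S))) (fun S => lift S (v (π S))) S')) := by
  have hm := h.proj_nabla_mem (nabla := nabla) (u := u) (v := v) hS'
  rw [← he] at hm
  refine h.metric_base.eq_of_forall (h.mapsTo hS) (h.proj_nabla_mem hS) hm
    fun z hz => ?_
  obtain ⟨w, hw, rfl⟩ := h.extends_base _ (h.mapsTo hS) z hz
  have h1 := h.two_mul_metric_base hn hu hv hw hS
  have h2 := h.two_mul_metric_base hn hu hv hw hS'
  rw [← he] at h2
  linarith

include hn in
/-- The base of a Riemannian submersion has a Levi-Civita connection if the total space has one. -/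
theorem exists_isLeviCivita : ∃ nablaB, IsLeviCivita B gB nablaB := by
  -- A choice of a point in each fiber; no smoothness is asked of it, and outside `B` the chosen
  -- point is irrelevant.
  have hs : ∀ X : F, ∃ S, X ∈ B → S ∈ M ∧ π S = X := by
    intro X
    by_cases hX : X ∈ B
    · obtain ⟨S, hS, e⟩ := h.exists_eq hX
      exact ⟨S, fun _ => ⟨hS, e⟩⟩
    · obtain ⟨S⟩ : Nonempty E := ⟨0⟩
      exact ⟨S, fun h => absurd h hX⟩
  choose s hs using hs
  set L : (F → F) → E → E := fun u S => lift S (u (π S)) with hL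
  set nB : (F → F) → (F → F) → F → F := fun u v X =>
    fderiv ℝ π (s X) (P (s X) (nabla (L u) (L v) (s X))) with hnB
  have hLv : ∀ {u}, IsVectorField B u → IsVectorField M (L u) := fun hu => h.lift_isVectorField hu
  have hnt : ∀ {u v}, IsVectorField B u → IsVectorField B v → ∀ S ∈ M,
      nabla (L u) (L v) S ∈ tangentSpaceAt M S := fun hu hv S hS =>
    (hn.isVectorField _ _ (hLv hu) (hLv hv)).tangent S hS
  -- By independence of the point in the fiber, the chosen point over `π S` may be replaced by `S`.
  -- All axioms for `nB` are then checked upstairs at an arbitrary `S`.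
  have key' : ∀ {u v}, IsVectorField B u → IsVectorField B v → ∀ S ∈ M,
      nB u v (π S) = fderiv ℝ π S (P S (nabla (L u) (L v) S)) := by
    intro u v hu hv S hS
    have h1 := hs (π S) (h.mapsTo hS)
    exact h.proj_nabla_eq_of_fiber hn hu hv h1.1 hS h1.2
  -- The horizontal projection disappears under `dπ`, so the smoothness of `nB` needs no smoothness
  -- of `P`.
  have key : ∀ {u v}, IsVectorField B u → IsVectorField B v → ∀ S ∈ M,
      nB u v (π S) = fderiv ℝ π S (nabla (L u) (L v) S) := by
    intro u v hu hv S hS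
    rw [key' hu hv S hS, h.fderiv_proj S hS _ (hnt hu hv S hS)]
  have hbase : ∀ {X}, X ∈ B → ∀ {p : F → Prop}, (∀ S ∈ M, p (π S)) → p X := by
    intro X hX p hp
    obtain ⟨S, hS, rfl⟩ := h.exists_eq hX
    exact hp S hS
  have hLeq : ∀ {u u' : F → F}, Set.EqOn u u' B → Set.EqOn (L u) (L u') M := by
    intro u u' he S hS
    simp only [hL]
    rw [he (h.mapsTo hS)]
  have hfd : ContDiff ℝ ∞ (fderiv ℝ π) := h.contDiff.fderiv_right (by simp)
  refine ⟨nB, ⟨fun u v hu hv => ⟨?_, ?_⟩, ?_, ?_, ?_, ?_, ?_, ?_, ?_⟩⟩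
  · exact h.contDiffOn_of_eq (hfd.contDiffOn.clm_apply
      (hn.isVectorField _ _ (hLv hu) (hLv hv)).smooth) (key hu hv)
  · intro X hX
    refine hbase hX (p := fun X => nB u v X ∈ tangentSpaceAt B X) fun S hS => ?_
    rw [key hu hv S hS]
    exact h.fderiv_mem (hnt hu hv S hS)
  · intro u u' v v' hu hu' hv hv' e e' X hX
    refine hbase hX (p := fun X => nB u v X = nB u' v' X) fun S hS => ?_
    rw [key hu hv S hS, key hu' hv' S hS,
      hn.congr _ _ _ _ (hLv hu) (hLv hu') (hLv hv) (hLv hv') (hLeq e) (hLeq e') hS]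
  · intro u u' v hu hu' hv X hX
    refine hbase hX (p := fun X => nB (fun y => u y + u' y) v X = nB u v X + nB u' v X) fun S hS => ?_
    rw [key (hu.add hu') hv S hS, key hu hv S hS, key hu' hv S hS, ← map_add,
      ← hn.add_left _ _ _ (hLv hu) (hLv hu') (hLv hv) S hS]
    simp only [hL, map_add]
  · intro f u v hf hu hv X hX
    refine hbase hX (p := fun X => nB (fun y => f y • u y) v X = f X • nB u v X) fun S hS => ?_
    have hf' : ContDiffOn ℝ ∞ (fun S => f (π S)) M := hf.comp h.contDiff.contDiffOn h.mapsTo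
    rw [key (hu.smul hf) hv S hS, key hu hv S hS, ← map_smul,
      ← hn.smul_left _ _ _ hf' (hLv hu) (hLv hv) S hS]
    simp only [hL, map_smul]
  · intro u v v' hu hv hv' X hX
    refine hbase hX (p := fun X => nB u (fun y => v y + v' y) X = nB u v X + nB u v' X) fun S hS => ?_
    rw [key hu (hv.add hv') S hS, key hu hv S hS, key hu hv' S hS, ← map_add,
      ← hn.add_right _ _ _ (hLv hu) (hLv hv) (hLv hv') S hS]
    simp only [hL, map_add]
  · intro f u v hf hu hv X hX
    refine hbase hX (p := fun X => nB u (fun y => f y • v y) X = f X • nB u v X + dirDeriv B f X (u X) • v X)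
      fun S hS => ?_
    have hf' : ContDiffOn ℝ ∞ (fun S => f (π S)) M := hf.comp h.contDiff.contDiffOn h.mapsTo
    -- Lifting is linear on each fiber, so a function on the base pulls out as its pullback, and the
    -- Leibniz rule upstairs applies.
    have h1 : L (fun y => f y • v y) = fun y => f (π y) • L v y := by
      funext S
      simp only [hL, map_smul]
    rw [key hu (hv.smul hf) S hS, key hu hv S hS, h1,
      hn.leibniz _ _ _ hf' (hLv hu) (hLv hv) S hS, map_add, map_smul, map_smul,
      h.dirDeriv_comp hf hS ((hLv hu).tangent S hS), h.fderiv_lift_field hu hS,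
      h.fderiv_lift_field hv hS]
  · intro u v w hu hv hw X hX
    refine hbase hX (p := fun X => dirDeriv B (fun y => gB y (v y) (w y)) X (u X) =
      gB X (nB u v X) (w X) + gB X (v X) (nB u w X)) fun S hS => ?_
    have hB : ∀ {a b}, IsVectorField B a → IsVectorField B b →
        nB a b (π S) ∈ tangentSpaceAt B (π S) := fun ha hb => by
      rw [key ha hb S hS]
      exact h.fderiv_mem (hnt ha hb S hS)
    have hSB := h.mapsTo hS
    rw [h.metric_base.symm _ hSB _ (hv.tangent _ hSB) _ (hB hu hw), key hu hv S hS,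
      key hu hw S hS, ← h.metric_lift_tangent hw hS (hnt hu hv S hS),
      ← h.metric_lift_tangent hv hS (hnt hu hw S hS), ← h.dirDeriv_metric hu hv hw hS,
      hn.metric_compat _ _ _ (hLv hu) (hLv hv) (hLv hw) S hS,
      h.metric.symm S hS _ ((hLv hv).tangent S hS) _ (hnt hu hw S hS)]
  · intro u v hu hv X hX
    refine hbase hX (p := fun X => nB u v X - nB v u X = dirDeriv B v X (u X) -
      dirDeriv B u X (v X)) fun S hS => ?_
    rw [key hu hv S hS, key hv hu S hS, ← map_sub,
      hn.torsion_free _ _ (hLv hu) (hLv hv) S hS]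
    exact h.fderiv_bracket hu hv hS

end IsRiemannianSubmersion

end LeviCivita

end EmbeddedGeometry

/-! ### Calculus of matrix functions, inversion and square roots. -/

namespace EmbeddedGeometry

noncomputable section MatrixCalculus

variable {𝕜 : Type*} [RCLike 𝕜]

/-! ### Calculus of matrix-valued functions -/

/-- Matrix multiplication as a continuous bilinear map. -/
def mulBilin (𝕜 : Type*) [RCLike 𝕜] (l m k : ℕ) :
    Matrix (Fin l) (Fin m) 𝕜 →L[ℝ] Matrix (Fin m) (Fin k) 𝕜 →L[ℝ] Matrix (Fin l) (Fin k) 𝕜 :=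
  LinearMap.mkContinuous₂ (LinearMap.mk₂ ℝ (fun A B => A * B) Matrix.add_mul
    (fun c A B => Matrix.smul_mul c A B) Matrix.mul_add (fun c A B => Matrix.mul_smul A c B)) 1
    fun A B => by simpa using Matrix.frobenius_norm_mul A B

/-- The conjugate transpose as a real-linear map. -/
def ctLin (𝕜 : Type*) [RCLike 𝕜] (m k : ℕ) :
    Matrix (Fin m) (Fin k) 𝕜 →ₗ[ℝ] Matrix (Fin k) (Fin m) 𝕜 where
  toFun A := Aᴴ
  map_add' := Matrix.conjTranspose_add
  map_smul' c A := by simp [Matrix.conjTranspose_smul]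

variable {E : Type*} [NormedAddCommGroup E] [NormedSpace ℝ E] {l m k : ℕ} {s : Set E} {x v : E}

theorem HasDirDeriv.matMul {f : E → Matrix (Fin l) (Fin m) 𝕜} {g : E → Matrix (Fin m) (Fin k) 𝕜}
    {a b} (hf : HasDirDeriv s f x v a) (hg : HasDirDeriv s g x v b) :
    HasDirDeriv s (fun y => f y * g y) x v (a * g x + f x * b) :=
  HasDirDeriv.bilin (mulBilin 𝕜 l m k) hf hg

theorem HasDirDeriv.conjTranspose {f : E → Matrix (Fin l) (Fin m) 𝕜} {a}
    (hf : HasDirDeriv s f x v a) : HasDirDeriv s (fun y => (f y)ᴴ) x v aᴴ :=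
  hf.clm (LinearMap.toContinuousLinearMap (ctLin 𝕜 l m))

variable {N : WithTop ℕ∞}

theorem ContDiffWithinAt.matMul {f : E → Matrix (Fin l) (Fin m) 𝕜}
    {g : E → Matrix (Fin m) (Fin k) 𝕜} (hf : ContDiffWithinAt ℝ N f s x)
    (hg : ContDiffWithinAt ℝ N g s x) : ContDiffWithinAt ℝ N (fun y => f y * g y) s x :=
  ContDiffAt.comp_contDiffWithinAt (g := fun p : Matrix (Fin l) (Fin m) 𝕜 × Matrix (Fin m) (Fin k) 𝕜
    => mulBilin 𝕜 l m k p.1 p.2) x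
    (mulBilin 𝕜 l m k).isBoundedBilinearMap.contDiff.contDiffAt (hf.prodMk hg)

theorem ContDiffWithinAt.conjTranspose {f : E → Matrix (Fin l) (Fin m) 𝕜}
    (hf : ContDiffWithinAt ℝ N f s x) : ContDiffWithinAt ℝ N (fun y => (f y)ᴴ) s x :=
  ((LinearMap.toContinuousLinearMap (ctLin 𝕜 l m)).contDiff.contDiffAt
    ).comp_contDiffWithinAt x hf

/-- The Frobenius norm makes the matrices a complete normed algebra, and inversion in such an
algebra is analytic at every unit. -/
theorem contDiffAt_matrix_inv {A : Matrix (Fin m) (Fin m) 𝕜} (hA : IsUnit A) :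
    ContDiffAt ℝ N (fun B : Matrix (Fin m) (Fin m) 𝕜 => B⁻¹) A := by
  let _ : NormedRing (Matrix (Fin m) (Fin m) 𝕜) := Matrix.frobeniusNormedRing
  let _ : NormedAlgebra ℝ (Matrix (Fin m) (Fin m) 𝕜) := Matrix.frobeniusNormedAlgebra
  have _ : CompleteSpace (Matrix (Fin m) (Fin m) 𝕜) := FiniteDimensional.complete ℝ _
  obtain ⟨u, rfl⟩ := hA
  have h := contDiffAt_ringInverse ℝ (n := N) u
  have e : (fun B : Matrix (Fin m) (Fin m) 𝕜 => B⁻¹) = Ring.inverse := by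
    funext B
    exact Matrix.nonsing_inv_eq_ringInverse B
  rw [e]
  exact h

theorem ContDiffWithinAt.matrix_inv {f : E → Matrix (Fin m) (Fin m) 𝕜}
    (hf : ContDiffWithinAt ℝ N f s x) (hu : IsUnit (f x)) :
    ContDiffWithinAt ℝ N (fun y => (f y)⁻¹) s x :=
  (contDiffAt_matrix_inv hu).comp_contDiffWithinAt x hf

theorem HasDirDeriv.matrix_inv {f : E → Matrix (Fin m) (Fin m) 𝕜} {a}
    (hf : HasDirDeriv s f x v a) (hu : IsUnit (f x)) :
    HasDirDeriv s (fun y => (f y)⁻¹) x v (-((f x)⁻¹ * a * (f x)⁻¹)) := by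
  let _ : NormedRing (Matrix (Fin m) (Fin m) 𝕜) := Matrix.frobeniusNormedRing
  let _ : NormedAlgebra ℝ (Matrix (Fin m) (Fin m) 𝕜) := Matrix.frobeniusNormedAlgebra
  have _ : CompleteSpace (Matrix (Fin m) (Fin m) 𝕜) := FiniteDimensional.complete ℝ _
  obtain ⟨f', h, rfl⟩ := hf
  obtain ⟨u, hu⟩ := hu
  have h1 := hasFDerivAt_ringInverse (𝕜 := ℝ) u
  have e : (fun B : Matrix (Fin m) (Fin m) 𝕜 => B⁻¹) = Ring.inverse := by
    funext B
    exact Matrix.nonsing_inv_eq_ringInverse B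
  rw [← e, hu] at h1
  have e2 : (↑u⁻¹ : Matrix (Fin m) (Fin m) 𝕜) = (f x)⁻¹ := by
    rw [← hu, Matrix.coe_units_inv]
  rw [e2] at h1
  exact ⟨_, h1.comp_hasFDerivWithinAt x h, rfl⟩

theorem eventually_isUnit {A : Matrix (Fin m) (Fin m) 𝕜} (hA : IsUnit A) :
    ∀ᶠ B in 𝓝 A, IsUnit B := by
  let _ : NormedRing (Matrix (Fin m) (Fin m) 𝕜) := Matrix.frobeniusNormedRing
  have _ : CompleteSpace (Matrix (Fin m) (Fin m) 𝕜) := FiniteDimensional.complete ℝ _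
  obtain ⟨u, rfl⟩ := hA
  exact Units.nhds u

/-! ### The square root near the identity -/

/-- The inverse function theorem for `X ↦ X²`, whose derivative at `1` is multiplication by `2`. For
Hermitian `A` the matrix `(r A)ᴴ` is another square root of `A` close to `1`, hence equals `r A` by
local uniqueness. -/
theorem exists_sqrt (𝕜 : Type*) [RCLike 𝕜] (m : ℕ) :
    ∃ r : Matrix (Fin m) (Fin m) 𝕜 → Matrix (Fin m) (Fin m) 𝕜, ContDiffAt ℝ ω r 1 ∧ r 1 = 1 ∧
      ∀ᶠ A in 𝓝 (1 : Matrix (Fin m) (Fin m) 𝕜), r A * r A = A ∧ IsUnit (r A) ∧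
        (Aᴴ = A → (r A)ᴴ = r A) := by
  have _ : CompleteSpace (Matrix (Fin m) (Fin m) 𝕜) := FiniteDimensional.complete ℝ _
  set f : Matrix (Fin m) (Fin m) 𝕜 → Matrix (Fin m) (Fin m) 𝕜 := fun X => X * X with hf
  have hfc : ContDiffAt ℝ ω f 1 := by
    have := ContDiffWithinAt.matMul (s := Set.univ) (x := (1 : Matrix (Fin m) (Fin m) 𝕜))
      (N := ω) contDiffWithinAt_id contDiffWithinAt_id
    exact this
  let e : Matrix (Fin m) (Fin m) 𝕜 ≃L[ℝ] Matrix (Fin m) (Fin m) 𝕜 :=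
    ContinuousLinearEquiv.smulLeft (Units.mk0 (2 : ℝ) two_ne_zero)
  have hfd : HasFDerivAt f (e : Matrix (Fin m) (Fin m) 𝕜 →L[ℝ] Matrix (Fin m) (Fin m) 𝕜) 1 := by
    have h := (mulBilin 𝕜 m m m).hasFDerivAt_of_bilinear
      (hasFDerivAt_id (𝕜 := ℝ) (1 : Matrix (Fin m) (Fin m) 𝕜)) (hasFDerivAt_id (𝕜 := ℝ) _)
    refine h.congr_fderiv ?_
    ext1 X
    change (1 : Matrix (Fin m) (Fin m) 𝕜) * X + X * 1 = (2 : ℝ) • X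
    rw [Matrix.one_mul, Matrix.mul_one, two_smul]
  have hs : HasStrictFDerivAt f (e : Matrix (Fin m) (Fin m) 𝕜 →L[ℝ] Matrix (Fin m) (Fin m) 𝕜) 1 :=
    hfc.hasStrictFDerivAt' hfd (by simp)
  have hf1 : f 1 = 1 := by simp [hf]
  set r := hs.localInverse f e 1 with hr
  have h1 : ContDiffAt ℝ ω r 1 := by
    have := hfc.to_localInverse hfd (by simp)
    rw [hf1] at this
    exact this
  have h2 : r 1 = 1 := by
    have := hs.localInverse_apply_image
    rwa [hf1] at this
  have h3 : ∀ᶠ A in 𝓝 (1 : Matrix (Fin m) (Fin m) 𝕜), f (r A) = A := by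
    have := hs.eventually_right_inverse
    rwa [hf1] at this
  have h4 : ∀ᶠ X in 𝓝 (1 : Matrix (Fin m) (Fin m) 𝕜), r (f X) = X := hs.eventually_left_inverse
  have hrt : Tendsto r (𝓝 1) (𝓝 1) := by
    have := h1.continuousAt.tendsto
    rwa [h2] at this
  have hct : Tendsto (fun A => (r A)ᴴ) (𝓝 1) (𝓝 1) := by
    have := (ContDiffWithinAt.conjTranspose (s := Set.univ) h1).continuousWithinAt.tendsto
    rwa [h2, conjTranspose_one, nhdsWithin_univ] at this
  refine ⟨r, h1, h2, ?_⟩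
  filter_upwards [h3, hrt.eventually (eventually_isUnit isUnit_one), hct.eventually h4]
    with A ha hb hc
  refine ⟨ha, hb, fun hA => ?_⟩
  rw [← hc]
  have : f (r A)ᴴ = A := by
    simp only [hf] at ha ⊢
    rw [← conjTranspose_mul, ha, hA]
  rw [this]

/-- The inverse square root near the identity. -/
theorem exists_invSqrt (𝕜 : Type*) [RCLike 𝕜] (m : ℕ) :
    ∃ T : Matrix (Fin m) (Fin m) 𝕜 → Matrix (Fin m) (Fin m) 𝕜, ContDiffAt ℝ ω T 1 ∧ T 1 = 1 ∧
      ∀ᶠ A in 𝓝 (1 : Matrix (Fin m) (Fin m) 𝕜), Aᴴ = A → (T A)ᴴ * A * T A = 1 ∧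
        A.PosDef := by
  obtain ⟨r, h1, h2, h3⟩ := exists_sqrt 𝕜 m
  refine ⟨fun A => (r A)⁻¹, ContDiffWithinAt.matrix_inv (s := Set.univ) h1 (by simp [h2]),
    by simp [h2], ?_⟩
  filter_upwards [h3] with A ⟨ha, hb, hc⟩ hA
  have hd := (Matrix.isUnit_iff_isUnit_det _).1 hb
  refine ⟨?_, ?_⟩
  · rw [conjTranspose_nonsing_inv, hc hA]
    nth_rw 2 [← ha]
    rw [Matrix.mul_assoc, Matrix.mul_assoc, Matrix.mul_nonsing_inv _ hd, Matrix.mul_one,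
      Matrix.nonsing_inv_mul _ hd]
  -- Here `A = (r A)ᴴ (r A)` with `r A` invertible; this gives positivity of the Hermitian matrices
  -- near `1` without any estimate of eigenvalues.
  · have h4 : ((r A)ᴴ * r A).PosDef :=
      Matrix.PosDef.conjTranspose_mul_self _ (Matrix.mulVec_injective_of_isUnit hb)
    rwa [hc hA, ha] at h4

theorem exists_unitary_diagonal {P : Matrix (Fin m) (Fin m) 𝕜} (hP : P.IsHermitian) :
    ∃ U ∈ Matrix.unitaryGroup (Fin m) 𝕜,
      P = U * Matrix.diagonal (fun i => (hP.eigenvalues i : 𝕜)) * Uᴴ :=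
  ⟨hP.eigenvectorUnitary, hP.eigenvectorUnitary.2, by
    conv_lhs => rw [hP.spectral_theorem]
    rfl⟩

theorem exists_eq_conjTranspose_mul_self {P : Matrix (Fin m) (Fin m) 𝕜} (hP : P.PosDef) :
    ∃ C : Matrix (Fin m) (Fin m) 𝕜, IsUnit C ∧ P = Cᴴ * C := by
  obtain ⟨U, hU, h⟩ := exists_unitary_diagonal hP.1
  set D : Matrix (Fin m) (Fin m) 𝕜 :=
    Matrix.diagonal (fun i => ((Real.sqrt (hP.1.eigenvalues i) : ℝ) : 𝕜)) with hD
  have hDD : D * D = Matrix.diagonal (fun i => (hP.1.eigenvalues i : 𝕜)) := by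
    rw [hD, Matrix.diagonal_mul_diagonal]
    congr 1
    funext i
    rw [← RCLike.ofReal_mul, Real.mul_self_sqrt (hP.eigenvalues_pos i).le]
  have hDh : Dᴴ = D := by
    rw [hD, Matrix.diagonal_conjTranspose]
    congr 1
    funext i
    simp
  have hPe : P = (D * Uᴴ)ᴴ * (D * Uᴴ) := by
    rw [conjTranspose_mul, conjTranspose_conjTranspose, hDh, Matrix.mul_assoc, ← Matrix.mul_assoc D,
      hDD, ← Matrix.mul_assoc]
    exact h
  refine ⟨D * Uᴴ, ?_, hPe⟩
  have hu := hP.isUnit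
  rw [hPe] at hu
  rw [Matrix.isUnit_iff_isUnit_det, Matrix.det_mul, IsUnit.mul_iff] at hu
  exact (Matrix.isUnit_iff_isUnit_det _).2 hu.2

theorem symm_eq_self {A : Matrix (Fin m) (Fin m) 𝕜} (h : Aᴴ = A) : symm A = A := by
  rw [FixedRankPSD.symm, h, ← two_smul ℝ A, smul_smul]
  norm_num

theorem conjTranspose_symm (A : Matrix (Fin m) (Fin m) 𝕜) : (symm A)ᴴ = symm A := by
  rw [FixedRankPSD.symm, Matrix.conjTranspose_smul, Matrix.conjTranspose_add, conjTranspose_conjTranspose,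
    star_trivial, add_comm]

theorem HasDirDeriv.symm {f : E → Matrix (Fin m) (Fin m) 𝕜} {a} (hf : HasDirDeriv s f x v a) :
    HasDirDeriv s (fun y => FixedRankPSD.symm (f y)) x v (FixedRankPSD.symm a) :=
  (hf.add hf.conjTranspose).const_smul (1 / 2)

theorem ContDiffWithinAt.symm {f : E → Matrix (Fin m) (Fin m) 𝕜}
    (hf : ContDiffWithinAt ℝ N f s x) :
    ContDiffWithinAt ℝ N (fun y => FixedRankPSD.symm (f y)) s x :=
  (hf.add (ContDiffWithinAt.conjTranspose hf)).const_smul (1 / 2 : ℝ)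

/-- The Hermitian parts of the matrices near a positive definite matrix are positive definite. -/
theorem eventually_posDef_symm {P : Matrix (Fin m) (Fin m) 𝕜} (hP : P.PosDef) :
    ∀ᶠ Q in 𝓝 P, (FixedRankPSD.symm Q).PosDef := by
  obtain ⟨C, hC, hPC⟩ := exists_eq_conjTranspose_mul_self hP
  obtain ⟨T, -, -, hT⟩ := exists_invSqrt 𝕜 m
  have hd := (Matrix.isUnit_iff_isUnit_det _).1 hC
  have hd' : IsUnit Cᴴ.det := by
    rw [Matrix.det_conjTranspose]
    exact hd.star
  -- Congruence by `C⁻¹`, where `P = Cᴴ C`, moves `P` to the identity, where `exists_invSqrt`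
  -- applies; congruence by `C` then moves the positivity back.
  have ht : Tendsto (fun Q => (Cᴴ)⁻¹ * FixedRankPSD.symm Q * C⁻¹) (𝓝 P) (𝓝 1) := by
    have h : ContDiffWithinAt ℝ 0 (fun Q => (Cᴴ)⁻¹ * FixedRankPSD.symm Q * C⁻¹) Set.univ P :=
      ContDiffWithinAt.matMul (ContDiffWithinAt.matMul contDiffWithinAt_const
        (ContDiffWithinAt.symm contDiffWithinAt_id)) contDiffWithinAt_const
    have := h.continuousWithinAt.tendsto
    rw [nhdsWithin_univ, symm_eq_self hP.1] at this
    have h1 : (Cᴴ)⁻¹ * P * C⁻¹ = 1 := by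
      rw [hPC, ← Matrix.mul_assoc, Matrix.nonsing_inv_mul _ hd', Matrix.one_mul,
        Matrix.mul_nonsing_inv _ hd]
    rwa [h1] at this
  filter_upwards [ht.eventually hT] with Q hQ
  have h1 := (hQ (by
    rw [conjTranspose_mul, conjTranspose_mul, conjTranspose_symm, ← conjTranspose_nonsing_inv,
      conjTranspose_conjTranspose, Matrix.mul_assoc])).2
  have h2 := h1.conjTranspose_mul_mul_same (Matrix.mulVec_injective_of_isUnit hC)
  convert h2 using 1
  rw [Matrix.mul_assoc, Matrix.mul_assoc, Matrix.mul_assoc, Matrix.nonsing_inv_mul _ hd,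
    Matrix.mul_one, ← Matrix.mul_assoc, Matrix.mul_nonsing_inv _ hd', Matrix.one_mul]

end MatrixCalculus

end EmbeddedGeometry

/-! ### The total space, the orbits and the quotient map. -/

namespace FixedRankPSD

section Manifold

variable {𝕜 : Type*} [RCLike 𝕜] {n p : ℕ}

/-! ### The Stiefel manifold and its product with the positive definite matrices -/

/-- The polar projection to the Stiefel manifold, near that manifold. -/
theorem exists_polar (𝕜 : Type*) [RCLike 𝕜] (n p : ℕ) :
    ∃ q : Matrix (Fin n) (Fin p) 𝕜 → Matrix (Fin n) (Fin p) 𝕜,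
      (∀ Y, Yᴴ * Y = 1 → q Y = Y) ∧ (∀ Y, ∃ T : Matrix (Fin p) (Fin p) 𝕜, q Y = Y * T) ∧
      ∀ Y, Yᴴ * Y = 1 → ContDiffAt ℝ ω q Y ∧ (∀ᶠ Z in 𝓝 Y, (q Z)ᴴ * q Z = 1) ∧
        ∀ η, Yᴴ * η + ηᴴ * Y = 0 → HasDirDeriv Set.univ q Y η η := by
  obtain ⟨T, h1, h2, h3⟩ := exists_invSqrt 𝕜 p
  -- The polar factor `Y (Yᴴ Y)^(-1/2)`. That it has the form `Y * T` keeps its columns in the range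
  -- of `Y`, which is what the local section of `proj` needs.
  refine ⟨fun Y => Y * T (Yᴴ * Y), fun Y hY => by simp only [hY, h2, Matrix.mul_one],
    fun Y => ⟨_, rfl⟩, fun Y hY => ?_⟩
  have hA : ContDiffWithinAt ℝ ω (fun Z : Matrix (Fin n) (Fin p) 𝕜 => Zᴴ * Z) Set.univ Y :=
    ContDiffWithinAt.matMul (ContDiffWithinAt.conjTranspose contDiffWithinAt_id)
      contDiffWithinAt_id
  have h1' : ContDiffAt ℝ ω T (Yᴴ * Y) := by rwa [hY]
  refine ⟨ContDiffWithinAt.matMul (s := Set.univ) contDiffWithinAt_id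
    (ContDiffAt.comp_contDiffWithinAt
      (f := fun Z : Matrix (Fin n) (Fin p) 𝕜 => Zᴴ * Z) Y h1' hA), ?_, fun η hη => ?_⟩
  · have ht : Tendsto (fun Z : Matrix (Fin n) (Fin p) 𝕜 => Zᴴ * Z) (𝓝 Y) (𝓝 1) := by
      have := hA.continuousWithinAt.tendsto
      rwa [nhdsWithin_univ, hY] at this
    filter_upwards [ht.eventually h3] with Z hZ
    have := (hZ (by rw [conjTranspose_mul, conjTranspose_conjTranspose])).1
    rw [conjTranspose_mul, Matrix.mul_assoc, ← Matrix.mul_assoc Zᴴ, ← Matrix.mul_assoc]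
    exact this
  -- Along a direction tangent to the Stiefel manifold the derivative of `Zᴴ Z` vanishes, so the
  -- factor `T` does not contribute and the derivative of `q` fixes `η`.
  · have hd : HasDirDeriv Set.univ (fun Z : Matrix (Fin n) (Fin p) 𝕜 => Zᴴ * Z) Y η 0 := by
      have := (HasDirDeriv.id (s := Set.univ) (x := Y) (v := η)).conjTranspose.matMul
        (HasDirDeriv.id (s := Set.univ) (x := Y) (v := η))
      rwa [add_comm, hη] at this
    have hT : HasDirDeriv Set.univ T (Yᴴ * Y) 0 0 :=
      ⟨_, (h1'.differentiableAt (by simp)).hasFDerivAt.hasFDerivWithinAt, map_zero _⟩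
    have := (HasDirDeriv.id (s := Set.univ) (x := Y) (v := η)).matMul
      (HasDirDeriv.comp (f := fun Z : Matrix (Fin n) (Fin p) 𝕜 => Zᴴ * Z) hT hd
        (Set.mapsTo_univ _ _))
    rwa [hY, h2, Matrix.mul_one, Matrix.mul_zero, add_zero] at this

theorem stiefel_isLocalRetraction {q : Matrix (Fin n) (Fin p) 𝕜 → Matrix (Fin n) (Fin p) 𝕜}
    {Y : Matrix (Fin n) (Fin p) 𝕜} (h1 : ∀ Y, Yᴴ * Y = 1 → q Y = Y) (h2 : ContDiffAt ℝ ω q Y)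
    (h3 : ∀ᶠ Z in 𝓝 Y, (q Z)ᴴ * q Z = 1) :
    IsLocalRetraction {Z : Matrix (Fin n) (Fin p) 𝕜 | Zᴴ * Z = 1} Y q :=
  ⟨h2, h3, eventually_mem_nhdsWithin.mono h1⟩

theorem mem_tangentSpaceAt_stiefel {Y η : Matrix (Fin n) (Fin p) 𝕜} (hY : Yᴴ * Y = 1)
    (hη : Yᴴ * η + ηᴴ * Y = 0) :
    η ∈ tangentSpaceAt {Z : Matrix (Fin n) (Fin p) 𝕜 | Zᴴ * Z = 1} Y := by
  obtain ⟨q, h1, -, h3⟩ := exists_polar 𝕜 n p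
  obtain ⟨h4, h5, h6⟩ := h3 Y hY
  exact (stiefel_isLocalRetraction h1 h4 h5).fderiv_mem hY (h6 η hη)

theorem exists_isLocalRetraction_stiefelPD {S : Amb 𝕜 n p} (hS : S ∈ stiefelPD 𝕜 n p) :
    ∃ r, IsLocalRetraction (stiefelPD 𝕜 n p) S r ∧ ∀ η : Amb 𝕜 n p,
      S.1ᴴ * η.1 + η.1ᴴ * S.1 = 0 → η.2ᴴ = η.2 → HasDirDeriv Set.univ r S η η := by
  obtain ⟨q, h1, -, h3⟩ := exists_polar 𝕜 n p
  obtain ⟨h4, h5, h6⟩ := h3 S.1 hS.1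
  refine ⟨fun Z => (q Z.1, FixedRankPSD.symm Z.2), ⟨?_, ?_, ?_⟩, fun η ha hb => ?_⟩
  · exact ContDiffWithinAt.prodMk (s := Set.univ)
      (h4.comp_contDiffWithinAt S contDiffWithinAt_fst)
      (ContDiffWithinAt.symm contDiffWithinAt_snd)
  · filter_upwards [continuous_fst.continuousAt.eventually h5,
      continuous_snd.continuousAt.eventually (eventually_posDef_symm hS.2)] with Z ha hb
    exact ⟨ha, hb⟩
  · filter_upwards [eventually_mem_nhdsWithin] with Z hZ
    exact Prod.ext (h1 _ hZ.1) (symm_eq_self hZ.2.1)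
  · have e1 : HasDirDeriv Set.univ (fun Z : Amb 𝕜 n p => q Z.1) S η η.1 :=
      (h6 η.1 ha).comp HasDirDeriv.id.fst (Set.mapsTo_univ _ _)
    have e2 : HasDirDeriv Set.univ (fun Z : Amb 𝕜 n p => FixedRankPSD.symm Z.2) S η η.2 := by
      have := (HasDirDeriv.id (s := Set.univ) (x := S) (v := η)).snd.symm
      rwa [symm_eq_self hb] at this
    exact e1.prodMk e2

theorem hasLocalRetractions_stiefelPD : HasLocalRetractions (stiefelPD 𝕜 n p) := fun _ hS =>
  let ⟨r, hr, _⟩ := exists_isLocalRetraction_stiefelPD hS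
  ⟨r, hr⟩

/-- Differentiating the constraints within the set gives the equations. Conversely, a solution is
fixed by the derivative of the retraction and is thus tangent. Positivity of `P` is open among
Hermitian matrices and imposes no equation. -/
theorem mem_tangentSpaceAt_stiefelPD {S : Amb 𝕜 n p} (hS : S ∈ stiefelPD 𝕜 n p) {η : Amb 𝕜 n p} :
    η ∈ tangentSpaceAt (stiefelPD 𝕜 n p) S ↔ S.1ᴴ * η.1 + η.1ᴴ * S.1 = 0 ∧ η.2ᴴ = η.2 := by
  refine ⟨fun h => ⟨?_, ?_⟩, fun ⟨h1, h2⟩ => ?_⟩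
  · have hd : HasDirDeriv (stiefelPD 𝕜 n p) (fun Z : Amb 𝕜 n p => Z.1ᴴ * Z.1) S η _ :=
      (HasDirDeriv.id (x := S) (v := η)).fst.conjTranspose.matMul HasDirDeriv.id.fst
    rw [add_comm]
    exact hd.unique ((HasDirDeriv.const 1).congr (fun Z hZ => hZ.1) hS) h
  · have hd : HasDirDeriv (stiefelPD 𝕜 n p) (fun Z : Amb 𝕜 n p => Z.2ᴴ) S η _ :=
      (HasDirDeriv.id (x := S) (v := η)).snd.conjTranspose
    exact hd.unique (HasDirDeriv.id.snd.congr (fun Z hZ => hZ.2.1) hS) h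
  · obtain ⟨r, hr, hd⟩ := exists_isLocalRetraction_stiefelPD hS
    exact hr.fderiv_mem hS (hd η h1 h2)

theorem act_mem {U : Matrix (Fin p) (Fin p) 𝕜} (hU : Uᴴ * U = 1) {S : Amb 𝕜 n p}
    (hS : S ∈ stiefelPD 𝕜 n p) : act U S ∈ stiefelPD 𝕜 n p := by
  refine ⟨?_, ?_⟩
  · change (S.1 * U)ᴴ * (S.1 * U) = 1
    rw [conjTranspose_mul, Matrix.mul_assoc, ← Matrix.mul_assoc S.1ᴴ, hS.1, Matrix.one_mul, hU]
  · have : IsUnit U := IsUnit.of_mul_eq_one_right _ hU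
    exact hS.2.conjTranspose_mul_mul_same (Matrix.mulVec_injective_of_isUnit this)

theorem mem_unitaryGroup_iff_conjTranspose {U : Matrix (Fin p) (Fin p) 𝕜} :
    U ∈ Matrix.unitaryGroup (Fin p) 𝕜 ↔ Uᴴ * U = 1 :=
  Matrix.mem_unitaryGroup_iff'

/-- The tangent vectors of the orbit of `S`. -/
theorem mem_tangentSpaceAt_orbit {S : Amb 𝕜 n p} (hS : S.1ᴴ * S.1 = 1) {v : Amb 𝕜 n p} :
    v ∈ tangentSpaceAt (orbit S) S ↔
      ∃ W : Matrix (Fin p) (Fin p) 𝕜, Wᴴ = -W ∧ v = (S.1 * W, S.2 * W - W * S.2) := by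
  have hSo : S ∈ orbit S := ⟨1, one_mem _, by simp [act]⟩
  constructor
  · intro hv
    -- The group element is a linear function of the point of the orbit: `U = Yᴴ (Y U)`.
    -- Differentiating the unitarity of `U` and the two components of the action, all as functions
    -- on the orbit, gives the form of `v`.
    have hU : HasDirDeriv (orbit S) (fun Z : Amb 𝕜 n p => S.1ᴴ * Z.1) S v (S.1ᴴ * v.1) := by
      have := (HasDirDeriv.const (s := orbit S) (x := S) (v := v) S.1ᴴ).matMul HasDirDeriv.id.fst
      rwa [Matrix.zero_mul, zero_add] at this
    have hoU : ∀ U, S.1ᴴ * (act U S).1 = U := fun U => by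
      rw [act, ← Matrix.mul_assoc, hS, Matrix.one_mul]
    have hskew : (S.1ᴴ * v.1)ᴴ + S.1ᴴ * v.1 = 0 := by
      have h1 := hU.conjTranspose.matMul hU
      rw [hS, Matrix.mul_one, conjTranspose_one, Matrix.one_mul] at h1
      refine h1.unique ((HasDirDeriv.const 1).congr ?_ hSo) hv
      rintro Z ⟨U, hUU, rfl⟩
      simp only
      rw [hoU]
      exact mem_unitaryGroup_iff_conjTranspose.1 hUU
    refine ⟨S.1ᴴ * v.1, eq_neg_of_add_eq_zero_left hskew, Prod.ext ?_ ?_⟩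
    · have h1 : HasDirDeriv (orbit S) (fun Z : Amb 𝕜 n p => S.1 * (S.1ᴴ * Z.1)) S v
          (S.1 * (S.1ᴴ * v.1)) := by
        have := (HasDirDeriv.const (s := orbit S) (x := S) (v := v) S.1).matMul hU
        rwa [Matrix.zero_mul, zero_add] at this
      refine HasDirDeriv.unique HasDirDeriv.id.fst (h1.congr ?_ hSo) hv
      rintro Z ⟨U, hUU, rfl⟩
      simp only
      rw [hoU]
      rfl
    · have h1 := (hU.conjTranspose.matMul (HasDirDeriv.const S.2)).matMul hU
      rw [hS, Matrix.mul_zero, add_zero, Matrix.mul_one, conjTranspose_one, Matrix.one_mul,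
        eq_neg_of_add_eq_zero_left hskew, Matrix.neg_mul, neg_add_eq_sub] at h1
      refine HasDirDeriv.unique HasDirDeriv.id.snd (h1.congr ?_ hSo) hv
      rintro Z ⟨U, hUU, rfl⟩
      simp only
      rw [hoU]
      rfl
  · rintro ⟨W, hW, rfl⟩
    -- The unitary group is the square Stiefel manifold, so the skew `W` is tangent to it at `1`;
    -- the orbit map carries it to the stated vector.
    have ht : W ∈ tangentSpaceAt {Z : Matrix (Fin p) (Fin p) 𝕜 | Zᴴ * Z = 1} 1 :=
      mem_tangentSpaceAt_stiefel (by simp) (by simp [hW])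
    have hd := ((HasDirDeriv.const S.1).matMul HasDirDeriv.id).prodMk
      ((HasDirDeriv.id.conjTranspose.matMul (HasDirDeriv.const S.2)).matMul
        (HasDirDeriv.id (s := {Z : Matrix (Fin p) (Fin p) 𝕜 | Zᴴ * Z = 1}) (x := 1) (v := W)))
    have h1 := hd.mem_tangentSpaceAt_of_contDiffOn (N := orbit S) ht ?_ ?_
    · simpa [hW, neg_add_eq_sub] using h1
    · intro x _
      exact (ContDiffWithinAt.matMul contDiffWithinAt_const contDiffWithinAt_id).prodMk
        (ContDiffWithinAt.matMul (ContDiffWithinAt.matMul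
          (ContDiffWithinAt.conjTranspose contDiffWithinAt_id) contDiffWithinAt_const)
          contDiffWithinAt_id)
    · intro U hU
      exact ⟨U, mem_unitaryGroup_iff_conjTranspose.2 hU, rfl⟩

/-! ### The positive semidefinite matrices of rank `p` -/

theorem proj_mem {S : Amb 𝕜 n p} (hS : S ∈ stiefelPD 𝕜 n p) : proj S ∈ psdRank 𝕜 n p := by
  refine ⟨hS.2.posSemidef.mul_mul_conjTranspose_same S.1, le_antisymm ?_ ?_⟩
  · rw [proj, Matrix.mul_assoc]
    exact (Matrix.rank_mul_le_left _ _).trans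
      ((Matrix.rank_le_card_width _).trans (by simp))
  · have h1 : S.2 = S.1ᴴ * (proj S * S.1) := by
      rw [proj, Matrix.mul_assoc (S.1 * S.2), hS.1, Matrix.mul_one, ← Matrix.mul_assoc, hS.1,
        Matrix.one_mul]
    have h2 : S.2.rank = p := by
      rw [Matrix.rank_of_isUnit _ hS.2.isUnit, Fintype.card_fin]
    calc p = S.2.rank := h2.symm
      _ ≤ (proj S * S.1).rank := by
        rw [h1]
        exact Matrix.rank_mul_le_right _ _
      _ ≤ (proj S).rank := Matrix.rank_mul_le_left _ _

/-- Exactly `p` eigenvalues are nonzero. The corresponding columns of the unitary matrix form `Y`,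
those eigenvalues form `P`, and the omitted terms of the spectral sum vanish. -/
theorem exists_proj_eq {X : Matrix (Fin n) (Fin n) 𝕜} (hX : X ∈ psdRank 𝕜 n p) :
    ∃ S ∈ stiefelPD 𝕜 n p, proj S = X := by
  obtain ⟨hX, hr⟩ := hX
  have hcard : Fintype.card {i // hX.1.eigenvalues i ≠ 0} = Fintype.card (Fin p) := by
    rw [← hX.1.rank_eq_card_non_zero_eigs, hr, Fintype.card_fin]
  let e : Fin p ≃ {i // hX.1.eigenvalues i ≠ 0} := (Fintype.equivOfCardEq hcard).symm
  obtain ⟨U, hU, hXU⟩ := exists_unitary_diagonal hX.1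
  rw [mem_unitaryGroup_iff_conjTranspose] at hU
  refine ⟨(U.submatrix _root_.id fun j => (e j : Fin n),
    Matrix.diagonal fun j => (hX.1.eigenvalues (e j) : 𝕜)), ⟨?_, ?_⟩, ?_⟩
  · ext i j
    have h1 := congrFun (congrFun hU (e i)) (e j)
    rw [Matrix.mul_apply] at h1 ⊢
    simp only [Matrix.conjTranspose_apply, Matrix.submatrix_apply, id_eq] at h1 ⊢
    rw [h1, Matrix.one_apply, Matrix.one_apply]
    simp [Subtype.ext_iff.symm]
  · rw [Matrix.posDef_diagonal_iff]
    intro j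
    have h1 := hX.eigenvalues_nonneg (e j)
    exact_mod_cast lt_of_le_of_ne h1 (Ne.symm (e j).2)
  · conv_rhs => rw [hXU]
    ext a b
    rw [proj, Matrix.mul_apply, Matrix.mul_apply]
    simp only [Matrix.mul_diagonal, Matrix.submatrix_apply, id_eq, Matrix.conjTranspose_apply]
    rw [← e.symm.sum_comp, ← Finset.sum_filter_add_sum_filter_not Finset.univ
      (fun i => hX.1.eigenvalues i ≠ 0) (fun i => U a i * (hX.1.eigenvalues i : 𝕜) * star (U b i)),
      Finset.sum_eq_zero (s := Finset.univ.filter fun i => ¬ hX.1.eigenvalues i ≠ 0), add_zero,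
      ← Finset.sum_subtype_eq_sum_filter]
    · simp
    · intro i hi
      have : hX.1.eigenvalues i = 0 := by simpa using hi
      simp [this]

theorem image_proj : proj '' stiefelPD 𝕜 n p = psdRank 𝕜 n p := by
  ext X
  exact ⟨fun ⟨S, hS, h⟩ => h ▸ proj_mem hS, fun hX => exists_proj_eq hX⟩

theorem conjTranspose_mul_proj_mul {S : Amb 𝕜 n p} (hS : S.1ᴴ * S.1 = 1) :
    S.1ᴴ * proj S * S.1 = S.2 := by
  rw [proj, ← Matrix.mul_assoc, ← Matrix.mul_assoc, hS, Matrix.one_mul, Matrix.mul_assoc, hS,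
    Matrix.mul_one]

theorem proj_act {U : Matrix (Fin p) (Fin p) 𝕜} (hU : Uᴴ * U = 1) (S : Amb 𝕜 n p) :
    proj (act U S) = proj S := by
  have hU' := mul_eq_one_comm.1 hU
  calc proj (act U S) = S.1 * (U * Uᴴ) * S.2 * (U * Uᴴ) * S.1ᴴ := by
        simp only [proj, act, conjTranspose_mul, Matrix.mul_assoc]
    _ = proj S := by rw [hU', Matrix.mul_one, Matrix.mul_one, proj]

/-- Multiplying `Y P Yᴴ = Y' P' Y'ᴴ` by `Y'` shows that the columns of `Y'` lie in the range of `Y`.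
Therefore `U = Yᴴ Y'` satisfies `Y U = Y'` and is unitary, and compression by `Y'` determines `P'`.
-/
theorem proj_eq_iff {S S' : Amb 𝕜 n p} (hS : S ∈ stiefelPD 𝕜 n p) (hS' : S' ∈ stiefelPD 𝕜 n p) :
    proj S = proj S' ↔ ∃ U ∈ Matrix.unitaryGroup (Fin p) 𝕜, S' = act U S := by
  constructor
  · intro h
    have hu := (Matrix.isUnit_iff_isUnit_det _).1 hS'.2.isUnit
    have e1 : S'.1 * S'.2 = S.1 * (S.2 * S.1ᴴ * S'.1) := by
      have h1 : proj S * S'.1 = proj S' * S'.1 := by rw [h]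
      rw [proj, proj, Matrix.mul_assoc (S'.1 * S'.2), hS'.1, Matrix.mul_one] at h1
      rw [← h1]
      simp only [Matrix.mul_assoc]
    have e2 : S.1 * (S.1ᴴ * S'.1) = S'.1 := by
      have h2 : S.1 * (S.1ᴴ * (S'.1 * S'.2)) = S'.1 * S'.2 := by
        rw [e1, ← Matrix.mul_assoc S.1ᴴ, hS.1, Matrix.one_mul]
      have h3 := congrArg (· * S'.2⁻¹) h2
      simp only [Matrix.mul_assoc] at h3
      rwa [Matrix.mul_nonsing_inv _ hu, Matrix.mul_one] at h3
    refine ⟨S.1ᴴ * S'.1, mem_unitaryGroup_iff_conjTranspose.2 ?_, Prod.ext e2.symm ?_⟩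
    · rw [conjTranspose_mul, conjTranspose_conjTranspose, Matrix.mul_assoc, e2, hS'.1]
    · change S'.2 = (S.1ᴴ * S'.1)ᴴ * S.2 * (S.1ᴴ * S'.1)
      rw [← conjTranspose_mul_proj_mul hS'.1, ← h, proj, conjTranspose_mul,
        conjTranspose_conjTranspose]
      simp only [Matrix.mul_assoc]
  · rintro ⟨U, hU, rfl⟩
    rw [proj_act (mem_unitaryGroup_iff_conjTranspose.1 hU)]

/-- A local section of `proj` through `S`. -/
theorem exists_section_proj {S : Amb 𝕜 n p} (hS : S ∈ stiefelPD 𝕜 n p) :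
    ∃ σ : Matrix (Fin n) (Fin n) 𝕜 → Amb 𝕜 n p, ContDiffAt ℝ ω σ (proj S) ∧ σ (proj S) = S ∧
      (∀ᶠ X in 𝓝 (proj S), σ X ∈ stiefelPD 𝕜 n p) ∧
      ∀ X ∈ psdRank 𝕜 n p, σ X ∈ stiefelPD 𝕜 n p → proj (σ X) = X := by
  obtain ⟨q, h1, h2, h3⟩ := exists_polar 𝕜 n p
  obtain ⟨h4, h5, -⟩ := h3 S.1 hS.1
  have hu := (Matrix.isUnit_iff_isUnit_det _).1 hS.2.isUnit
  -- The columns of `X Y P⁻¹` lie in the range of `X`, and at `X = proj S` this matrix is `Y`. Its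
  -- polar factor is thus an orthonormal frame of the range of `X` for `X` of rank `p` nearby.
  set Z : Matrix (Fin n) (Fin n) 𝕜 → Matrix (Fin n) (Fin p) 𝕜 := fun X => X * (S.1 * S.2⁻¹) with hZ
  have hZc : ContDiffWithinAt ℝ ω Z Set.univ (proj S) :=
    ContDiffWithinAt.matMul contDiffWithinAt_id contDiffWithinAt_const
  have hZS : Z (proj S) = S.1 := by
    simp only [hZ, proj]
    rw [Matrix.mul_assoc, ← Matrix.mul_assoc S.1ᴴ, hS.1, Matrix.one_mul, Matrix.mul_assoc,
      Matrix.mul_nonsing_inv _ hu, Matrix.mul_one]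
  have hq : ContDiffWithinAt ℝ ω (fun X => q (Z X)) Set.univ (proj S) := by
    rw [← hZS] at h4
    exact h4.comp_contDiffWithinAt _ hZc
  have hqS : q (Z (proj S)) = S.1 := by rw [hZS, h1 _ hS.1]
  have hR : ContDiffWithinAt ℝ ω (fun X => (q (Z X))ᴴ * X * q (Z X)) Set.univ (proj S) :=
    ContDiffWithinAt.matMul (ContDiffWithinAt.matMul (ContDiffWithinAt.conjTranspose hq)
      contDiffWithinAt_id) hq
  have hRS : (q (Z (proj S)))ᴴ * proj S * q (Z (proj S)) = S.2 := by
    rw [hqS, conjTranspose_mul_proj_mul hS.1]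
  -- The Hermitian part keeps the values in the manifold for every nearby ambient `X`, Hermitian or
  -- not; on `psdRank` it changes nothing.
  refine ⟨fun X => (q (Z X), FixedRankPSD.symm ((q (Z X))ᴴ * X * q (Z X))), ?_, ?_, ?_, ?_⟩
  · exact hq.prodMk (ContDiffWithinAt.symm hR)
  · exact Prod.ext hqS (by simp only [hRS]; exact symm_eq_self hS.2.1)
  · have t1 : Tendsto Z (𝓝 (proj S)) (𝓝 S.1) := by
      have := hZc.continuousWithinAt.tendsto
      rwa [nhdsWithin_univ, hZS] at this
    have t2 : Tendsto (fun X => (q (Z X))ᴴ * X * q (Z X)) (𝓝 (proj S)) (𝓝 S.2) := by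
      have := hR.continuousWithinAt.tendsto
      rwa [nhdsWithin_univ, hRS] at this
    filter_upwards [t1.eventually h5, t2.eventually (eventually_posDef_symm hS.2)] with X ha hb
    exact ⟨ha, hb⟩
  · intro X hX hσ
    obtain ⟨V, hV, rfl⟩ := exists_proj_eq hX
    obtain ⟨T, hT⟩ := h2 (Z (proj V))
    set Y := q (Z (proj V)) with hY
    have hYY : Yᴴ * Y = 1 := hσ.1
    set K : Matrix (Fin p) (Fin p) 𝕜 := V.2 * V.1ᴴ * (S.1 * S.2⁻¹) * T with hK
    have hYK : Y = V.1 * K := by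
      rw [hT, hZ, hK, proj]
      simp only [Matrix.mul_assoc]
    -- `K` is square and an isometry, hence unitary. The frames `Y` and `V.1` therefore have the
    -- same range projector, and that projector fixes `proj V` from both sides.
    have hKK : K * Kᴴ = 1 := by
      rw [hYK, conjTranspose_mul, Matrix.mul_assoc, ← Matrix.mul_assoc V.1ᴴ, hV.1,
        Matrix.one_mul] at hYY
      exact mul_eq_one_comm.1 hYY
    have hsy : FixedRankPSD.symm (Yᴴ * proj V * Y) = Yᴴ * proj V * Y := by
      refine symm_eq_self ?_
      rw [conjTranspose_mul, conjTranspose_mul, conjTranspose_conjTranspose,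
        (proj_mem hV).1.1.eq, Matrix.mul_assoc]
    change Y * FixedRankPSD.symm (Yᴴ * proj V * Y) * Yᴴ = proj V
    have hP : Y * Yᴴ = V.1 * V.1ᴴ := by
      rw [hYK, conjTranspose_mul, Matrix.mul_assoc, ← Matrix.mul_assoc K, hKK, Matrix.one_mul]
    calc Y * FixedRankPSD.symm (Yᴴ * proj V * Y) * Yᴴ = Y * Yᴴ * proj V * (Y * Yᴴ) := by
          rw [hsy]
          simp only [Matrix.mul_assoc]
      _ = V.1 * (V.1ᴴ * V.1) * V.2 * (V.1ᴴ * V.1) * V.1ᴴ := by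
          rw [hP, proj]
          simp only [Matrix.mul_assoc]
      _ = proj V := by rw [hV.1, Matrix.mul_one, Matrix.mul_one, proj]

theorem contDiff_proj : ContDiff ℝ ω (proj (𝕜 := 𝕜) (n := n) (p := p)) := by
  rw [contDiff_iff_contDiffAt]
  intro S
  exact ContDiffWithinAt.matMul (s := Set.univ) (ContDiffWithinAt.matMul contDiffWithinAt_fst
    contDiffWithinAt_snd) (ContDiffWithinAt.conjTranspose contDiffWithinAt_fst)

theorem hasDirDeriv_proj (s : Set (Amb 𝕜 n p)) (S η : Amb 𝕜 n p) : HasDirDeriv s proj S η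
    (η.1 * S.2 * S.1ᴴ + S.1 * η.2 * S.1ᴴ + S.1 * S.2 * η.1ᴴ) := by
  have h1 := (HasDirDeriv.id (s := s) (x := S) (v := η)).fst
  have h := (h1.matMul HasDirDeriv.id.snd).matMul h1.conjTranspose
  rw [Matrix.add_mul] at h
  exact h

theorem dproj_eq (S η : Amb 𝕜 n p) :
    dproj S η = η.1 * S.2 * S.1ᴴ + S.1 * η.2 * S.1ᴴ + S.1 * S.2 * η.1ᴴ := by
  obtain ⟨f', hf, he⟩ := hasDirDeriv_proj Set.univ S η
  rw [hasFDerivWithinAt_univ] at hf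
  rw [← he]
  exact congrArg (fun f => f η) hf.fderiv

theorem hasDirDeriv_proj' (s : Set (Amb 𝕜 n p)) (S η : Amb 𝕜 n p) :
    HasDirDeriv s proj S η (dproj S η) := by
  rw [dproj_eq]
  exact hasDirDeriv_proj s S η

theorem dproj_mem_tangentSpaceAt {S η : Amb 𝕜 n p}
    (hη : η ∈ tangentSpaceAt (stiefelPD 𝕜 n p) S) :
    dproj S η ∈ tangentSpaceAt (psdRank 𝕜 n p) (proj S) :=
  (hasDirDeriv_proj' _ S η).mem_tangentSpaceAt_of_contDiffOn hη
    (contDiff_proj.of_le le_top).contDiffOn fun _ h => proj_mem h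

/-- The derivative of a local section through `S` sends `v` to a tangent vector at `S`;
differentiating `proj (σ X) = X` shows that `dproj` brings it back to `v`. -/
theorem exists_dproj_eq {S : Amb 𝕜 n p} (hS : S ∈ stiefelPD 𝕜 n p) {v : Matrix (Fin n) (Fin n) 𝕜}
    (hv : v ∈ tangentSpaceAt (psdRank 𝕜 n p) (proj S)) :
    ∃ η ∈ tangentSpaceAt (stiefelPD 𝕜 n p) S, dproj S η = v := by
  obtain ⟨σ, h1, h2, h3, h4⟩ := exists_section_proj hS
  have hd := HasFDerivAt.hasDirDeriv (h1.differentiableAt (by simp)).hasFDerivAt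
    (psdRank 𝕜 n p) v
  have ht := hd.mem_tangentSpaceAt hv
    (nhdsWithin_le_nhds ((eventually_contDiffAt h1).mono fun X hX => hX.contDiffWithinAt))
    (nhdsWithin_le_nhds h3)
  rw [h2] at ht
  refine ⟨_, ht, ?_⟩
  have h5 := hasDirDeriv_proj' Set.univ (σ (proj S)) (fderiv ℝ σ (proj S) v)
  obtain ⟨f', hf, he⟩ := h5.comp hd (Set.mapsTo_univ _ _)
  have hid : HasDirDeriv (psdRank 𝕜 n p) (fun X => X) (proj S) v
      (dproj (σ (proj S)) (fderiv ℝ σ (proj S) v)) := by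
    refine ⟨f', hf.congr_of_eventuallyEq ?_ ?_, he⟩
    · filter_upwards [nhdsWithin_le_nhds h3, eventually_mem_nhdsWithin] with X ha hb
      exact (h4 X hb ha).symm
    · exact (congrArg proj h2).symm
  rw [h2] at hid
  exact hid.unique HasDirDeriv.id hv

end Manifold

end FixedRankPSD

/-! ### Algebra of the metric, the horizontal space and `L(P)`. -/

namespace FixedRankPSD

section Algebra

variable {𝕜 : Type*} [RCLike 𝕜] {n p m k : ℕ}

/-! ### The real trace -/

theorem trR_add (A B : Matrix (Fin m) (Fin m) 𝕜) : trR (A + B) = trR A + trR B := by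
  simp [trR]

theorem trR_sub (A B : Matrix (Fin m) (Fin m) 𝕜) : trR (A - B) = trR A - trR B := by
  simp [trR]

theorem trR_smul (c : ℝ) (A : Matrix (Fin m) (Fin m) 𝕜) : trR (c • A) = c * trR A := by
  simp [trR, Matrix.trace_smul, RCLike.smul_re]

theorem trR_mul_comm (A : Matrix (Fin m) (Fin k) 𝕜) (B : Matrix (Fin k) (Fin m) 𝕜) :
    trR (A * B) = trR (B * A) := by
  rw [trR, trR, Matrix.trace_mul_comm]

theorem trR_conjTranspose (A : Matrix (Fin m) (Fin m) 𝕜) : trR Aᴴ = trR A := by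
  simp [trR, Matrix.trace_conjTranspose]

theorem trR_conjTranspose_mul_self_nonneg (A : Matrix (Fin m) (Fin k) 𝕜) : 0 ≤ trR (Aᴴ * A) :=
  (RCLike.nonneg_iff.1 (Matrix.posSemidef_conjTranspose_mul_self A).trace_nonneg).1

theorem trR_conjTranspose_mul_self_eq_zero {A : Matrix (Fin m) (Fin k) 𝕜}
    (h : trR (Aᴴ * A) = 0) : A = 0 := by
  have h1 := RCLike.nonneg_iff.1 (Matrix.posSemidef_conjTranspose_mul_self A).trace_nonneg
  rw [← Matrix.trace_conjTranspose_mul_self_eq_zero_iff]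
  exact RCLike.ext (by simpa [trR] using h) (by simpa using h1.2)

/-- Skew-Hermitian matrices are orthogonal to Hermitian ones. -/
theorem trR_mul_eq_zero {A B : Matrix (Fin m) (Fin m) 𝕜} (hA : Aᴴ = -A) (hB : Bᴴ = B) :
    trR (A * B) = 0 := by
  have h := trR_conjTranspose (A * B)
  rw [conjTranspose_mul, hA, hB, trR_mul_comm, Matrix.neg_mul] at h
  have h2 : trR (-(A * B)) = - trR (A * B) := by simp [trR]
  linarith

theorem ambInner_comm (w w' : Amb 𝕜 n p) : ambInner w w' = ambInner w' w := by
  rw [ambInner, ambInner, ← trR_conjTranspose (w.1 * _), ← trR_conjTranspose (w.2 * _)]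
  simp [conjTranspose_mul]

theorem ambInner_add_left (u v w : Amb 𝕜 n p) :
    ambInner (u + v) w = ambInner u w + ambInner v w := by
  simp only [ambInner, Prod.fst_add, Prod.snd_add, Matrix.add_mul, trR_add]
  ring

theorem ambInner_sub_left (u v w : Amb 𝕜 n p) :
    ambInner (u - v) w = ambInner u w - ambInner v w := by
  simp only [ambInner, Prod.fst_sub, Prod.snd_sub, Matrix.sub_mul, trR_sub]
  ring

theorem ambInner_smul_left (c : ℝ) (u w : Amb 𝕜 n p) :
    ambInner (c • u) w = c * ambInner u w := by
  simp only [ambInner, Prod.smul_fst, Prod.smul_snd, Matrix.smul_mul, trR_smul]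
  ring

theorem ambInner_add_right (u v w : Amb 𝕜 n p) :
    ambInner u (v + w) = ambInner u v + ambInner u w := by
  rw [ambInner_comm, ambInner_add_left, ambInner_comm v, ambInner_comm w]

theorem ambInner_sub_right (u v w : Amb 𝕜 n p) :
    ambInner u (v - w) = ambInner u v - ambInner u w := by
  rw [ambInner_comm, ambInner_sub_left, ambInner_comm v, ambInner_comm w]

theorem ambInner_smul_right (c : ℝ) (u w : Amb 𝕜 n p) :
    ambInner u (c • w) = c * ambInner u w := by
  rw [ambInner_comm, ambInner_smul_left, ambInner_comm]

theorem eq_of_forall_ambInner {u v : Amb 𝕜 n p} (h : ∀ w, ambInner u w = ambInner v w) :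
    u = v := by
  have h1 : ambInner (u - v) (u - v) = 0 := by rw [ambInner_sub_left, h, sub_self]
  rw [ambInner, trR_mul_comm, trR_mul_comm (u - v).2] at h1
  have h2 := trR_conjTranspose_mul_self_nonneg (u - v).1
  have h3 := trR_conjTranspose_mul_self_nonneg (u - v).2
  rw [← sub_eq_zero]
  exact Prod.ext (trR_conjTranspose_mul_self_eq_zero (by linarith))
    (trR_conjTranspose_mul_self_eq_zero (by linarith))

/-! ### Points of the manifold -/

variable {S : Amb 𝕜 n p} (hS : S ∈ stiefelPD 𝕜 n p)

theorem PosDef_mul_inv {P : Matrix (Fin m) (Fin m) 𝕜} (hP : P.PosDef) : P * P⁻¹ = 1 :=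
  Matrix.mul_nonsing_inv _ ((Matrix.isUnit_iff_isUnit_det _).1 hP.isUnit)

theorem PosDef_inv_mul {P : Matrix (Fin m) (Fin m) 𝕜} (hP : P.PosDef) : P⁻¹ * P = 1 :=
  Matrix.nonsing_inv_mul _ ((Matrix.isUnit_iff_isUnit_det _).1 hP.isUnit)

theorem PosDef_mul_inv_cancel {P : Matrix (Fin m) (Fin m) 𝕜} (hP : P.PosDef)
    (X : Matrix (Fin m) (Fin k) 𝕜) : P * (P⁻¹ * X) = X := by
  rw [← Matrix.mul_assoc, PosDef_mul_inv hP, Matrix.one_mul]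

theorem PosDef_inv_mul_cancel {P : Matrix (Fin m) (Fin m) 𝕜} (hP : P.PosDef)
    (X : Matrix (Fin m) (Fin k) 𝕜) : P⁻¹ * (P * X) = X := by
  rw [← Matrix.mul_assoc, PosDef_inv_mul hP, Matrix.one_mul]

theorem stiefel_cancel {Y : Matrix (Fin n) (Fin p) 𝕜} (hY : Yᴴ * Y = 1)
    (X : Matrix (Fin p) (Fin k) 𝕜) : Yᴴ * (Y * X) = X := by
  rw [← Matrix.mul_assoc, hY, Matrix.one_mul]

/-! ### The metric -/

variable (α₀ α₁ β : ℝ)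

theorem gOp_apply (S w : Amb 𝕜 n p) : gOp α₀ α₁ β S w =
    (α₀ • w.1 + (α₁ - α₀) • (S.1 * S.1ᴴ * w.1), β • (S.2⁻¹ * w.2 * S.2⁻¹)) := rfl

variable {P : Matrix (Fin p) (Fin p) 𝕜}

include hS in
theorem ambInner_gOp_left (w w' : Amb 𝕜 n p) :
    ambInner (gOp α₀ α₁ β S w) w' = ambInner w (gOp α₀ α₁ β S w') := by
  have hi : (S.2⁻¹)ᴴ = S.2⁻¹ := hS.2.inv.1
  simp only [ambInner, gOp_apply, conjTranspose_add, Matrix.conjTranspose_smul, star_trivial,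
    conjTranspose_mul, conjTranspose_conjTranspose, hi, Matrix.add_mul, Matrix.mul_add,
    Matrix.smul_mul, Matrix.mul_smul, trR_add, trR_smul]
  rw [Matrix.mul_assoc (S.1 * S.1ᴴ), trR_mul_comm (S.1 * S.1ᴴ), Matrix.mul_assoc S.2⁻¹,
    Matrix.mul_assoc S.2⁻¹, trR_mul_comm S.2⁻¹]
  simp only [Matrix.mul_assoc]

theorem ambInner_eq (w w' : Amb 𝕜 n p) :
    ambInner w w' = trR (w.1ᴴ * w'.1) + trR (w.2ᴴ * w'.2) := by
  rw [ambInner, ← trR_conjTranspose (w.1ᴴ * _), ← trR_conjTranspose (w.2ᴴ * _),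
    conjTranspose_mul, conjTranspose_mul, conjTranspose_conjTranspose,
    conjTranspose_conjTranspose, trR_mul_comm w.1, trR_mul_comm w.2]

theorem gMet_eq (S w w' : Amb 𝕜 n p) : gMet α₀ α₁ β S w w' =
    trR (α₀ • (w.1ᴴ * w'.1) + (α₁ - α₀) • (w.1ᴴ * S.1 * S.1ᴴ * w'.1)
      + β • (w.2ᴴ * S.2⁻¹ * w'.2 * S.2⁻¹)) := by
  simp only [gMet, ambInner_eq, gOp_apply, Matrix.mul_add, Matrix.mul_smul, trR_add, trR_smul,
    Matrix.mul_assoc]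

theorem gMet_add_left (S u v w : Amb 𝕜 n p) :
    gMet α₀ α₁ β S (u + v) w = gMet α₀ α₁ β S u w + gMet α₀ α₁ β S v w :=
  ambInner_add_left _ _ _

theorem gMet_sub_left (S u v w : Amb 𝕜 n p) :
    gMet α₀ α₁ β S (u - v) w = gMet α₀ α₁ β S u w - gMet α₀ α₁ β S v w :=
  ambInner_sub_left _ _ _

theorem gMet_smul_left (S : Amb 𝕜 n p) (c : ℝ) (u w : Amb 𝕜 n p) :
    gMet α₀ α₁ β S (c • u) w = c * gMet α₀ α₁ β S u w :=
  ambInner_smul_left _ _ _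

include hS in
theorem gMet_comm (w w' : Amb 𝕜 n p) : gMet α₀ α₁ β S w w' = gMet α₀ α₁ β S w' w := by
  rw [gMet, ← ambInner_gOp_left hS, ambInner_comm, gMet]

variable {α₀ α₁ β} (hα₀ : 0 < α₀) (hα₁ : 0 < α₁) (hβ : 0 < β)

include hS hα₀ hα₁ hβ in
-- With `a = Yᴴ w_Y`, `b = w_Y - Y a`, `P⁻¹ = Cᴴ C` and `c = C w_P Cᴴ`, the form is `α₀ |b|² + α₁
-- |a|² + β |c|²`. The sign of `α₁ - α₀` plays no role.
theorem gMet_pos {w : Amb 𝕜 n p} (hw : w ≠ 0) : 0 < gMet α₀ α₁ β S w w := by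
  obtain ⟨C, hC, hPC⟩ := exists_eq_conjTranspose_mul_self hS.2.inv
  set a := S.1ᴴ * w.1 with ha
  set b := w.1 - S.1 * a with hb
  set c := C * w.2 * Cᴴ with hc
  have e1 : trR (w.1ᴴ * S.1 * S.1ᴴ * w.1) = trR (aᴴ * a) := by
    rw [ha, conjTranspose_mul, conjTranspose_conjTranspose]
    simp only [Matrix.mul_assoc]
  have e2 : trR (bᴴ * b) = trR (w.1ᴴ * w.1) - trR (aᴴ * a) := by
    rw [← trR_sub]
    congr 1
    rw [hb, conjTranspose_sub, conjTranspose_mul, Matrix.sub_mul, Matrix.mul_sub, Matrix.mul_sub,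
      Matrix.mul_assoc aᴴ, Matrix.mul_assoc aᴴ, stiefel_cancel hS.1, ← Matrix.mul_assoc w.1ᴴ,
      ← ha]
    have : w.1ᴴ * S.1 = aᴴ := by rw [ha, conjTranspose_mul, conjTranspose_conjTranspose]
    rw [this]
    abel
  have e3 : trR (w.2ᴴ * S.2⁻¹ * w.2 * S.2⁻¹) = trR (cᴴ * c) := by
    rw [hPC, hc, conjTranspose_mul, conjTranspose_mul, conjTranspose_conjTranspose,
      Matrix.mul_assoc C, trR_mul_comm C]
    simp only [Matrix.mul_assoc]
  have hg : gMet α₀ α₁ β S w w = α₀ * trR (bᴴ * b) + α₁ * trR (aᴴ * a) + β * trR (cᴴ * c) := by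
    rw [gMet_eq, trR_add, trR_add, trR_smul, trR_smul, trR_smul, e1, e3, e2]
    ring
  have na := trR_conjTranspose_mul_self_nonneg a
  have nb := trR_conjTranspose_mul_self_nonneg b
  have nc := trR_conjTranspose_mul_self_nonneg c
  by_contra hle
  rw [hg] at hle
  have pa := mul_nonneg hα₁.le na
  have pb := mul_nonneg hα₀.le nb
  have pc := mul_nonneg hβ.le nc
  have za : a = 0 := trR_conjTranspose_mul_self_eq_zero
    ((mul_eq_zero.1 (by linarith : α₁ * trR (aᴴ * a) = 0)).resolve_left hα₁.ne')
  have zb : b = 0 := trR_conjTranspose_mul_self_eq_zero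
    ((mul_eq_zero.1 (by linarith : α₀ * trR (bᴴ * b) = 0)).resolve_left hα₀.ne')
  have zc : c = 0 := trR_conjTranspose_mul_self_eq_zero
    ((mul_eq_zero.1 (by linarith : β * trR (cᴴ * c) = 0)).resolve_left hβ.ne')
  refine hw (Prod.ext ?_ ?_)
  · rw [za, Matrix.mul_zero, sub_zero] at hb
    rw [← hb, zb]
    rfl
  · have hC' := (Matrix.isUnit_iff_isUnit_det _).1 hC
    have hC'' : IsUnit Cᴴ.det := by
      rw [Matrix.det_conjTranspose]
      exact hC'.star
    have h1 : w.2 = C⁻¹ * c * (Cᴴ)⁻¹ := by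
      rw [hc, Matrix.mul_assoc C, ← Matrix.mul_assoc C⁻¹, Matrix.nonsing_inv_mul _ hC',
        Matrix.one_mul, Matrix.mul_assoc, Matrix.mul_nonsing_inv _ hC'', Matrix.mul_one]
    rw [h1, zc, Matrix.mul_zero, Matrix.zero_mul]
    rfl

theorem finiteDimensional_amb : FiniteDimensional ℝ (Amb 𝕜 n p) := by
  have h1 : FiniteDimensional ℝ (Matrix (Fin n) (Fin p) 𝕜) := inferInstance
  have h2 : FiniteDimensional ℝ (Matrix (Fin p) (Fin p) 𝕜) := inferInstance
  exact Module.Finite.prod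

include hS hα₀ hα₁ hβ in
theorem bijective_gOp : Function.Bijective (gOp α₀ α₁ β S) := by
  have _ : FiniteDimensional ℝ (Amb 𝕜 n p) := finiteDimensional_amb
  have hinj : Function.Injective (gOp α₀ α₁ β S) := by
    refine (injective_iff_map_eq_zero _).2 fun w hw => ?_
    by_contra hne
    have h1 := gMet_pos hS hα₀ hα₁ hβ hne
    rw [gMet, hw] at h1
    simp [ambInner, trR] at h1
  exact ⟨hinj, LinearMap.injective_iff_surjective.1 hinj⟩

theorem apply_ringInverse {V : Type*} [AddCommGroup V] [Module ℝ V] {A : V →ₗ[ℝ] V}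
    (hA : Function.Bijective A) (w : V) : A ((Ring.inverse A : Module.End ℝ V) w) = w := by
  have h : IsUnit (A : Module.End ℝ V) := (Module.End.isUnit_iff A).2 hA
  exact LinearMap.congr_fun (Ring.mul_inverse_cancel (A : Module.End ℝ V) h) w

theorem ringInverse_apply {V : Type*} [AddCommGroup V] [Module ℝ V] {A : V →ₗ[ℝ] V}
    (hA : Function.Bijective A) (w : V) : (Ring.inverse A : Module.End ℝ V) (A w) = w := by
  have h : IsUnit (A : Module.End ℝ V) := (Module.End.isUnit_iff A).2 hA
  exact LinearMap.congr_fun (Ring.inverse_mul_cancel (A : Module.End ℝ V) h) w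

include hS hα₀ hα₁ hβ in
theorem gOp_gInv (w : Amb 𝕜 n p) : gOp α₀ α₁ β S (gInv α₀ α₁ β S w) = w :=
  apply_ringInverse (bijective_gOp hS hα₀ hα₁ hβ) w

include hS hα₀ hα₁ hβ in
theorem gInv_gOp (w : Amb 𝕜 n p) : gInv α₀ α₁ β S (gOp α₀ α₁ β S w) = w :=
  ringInverse_apply (bijective_gOp hS hα₀ hα₁ hβ) w

include hS hα₀ hα₁ hβ in
theorem gMet_gInv (w ζ : Amb 𝕜 n p) :
    gMet α₀ α₁ β S (gInv α₀ α₁ β S w) ζ = ambInner w ζ := by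
  rw [gMet, ← ambInner_gOp_left hS, gOp_gInv hS hα₀ hα₁ hβ]

theorem inv_unitary_conj {U P : Matrix (Fin p) (Fin p) 𝕜} (hU : Uᴴ * U = 1) (hP : P.PosDef) :
    (Uᴴ * P * U)⁻¹ = Uᴴ * P⁻¹ * U := by
  have hU' : U * Uᴴ = 1 := mul_eq_one_comm.1 hU
  refine Matrix.inv_eq_right_inv ?_
  calc Uᴴ * P * U * (Uᴴ * P⁻¹ * U) = Uᴴ * P * (U * Uᴴ) * P⁻¹ * U := by
        simp only [Matrix.mul_assoc]
    _ = 1 := by rw [hU', Matrix.mul_one, Matrix.mul_assoc Uᴴ, PosDef_mul_inv hP, Matrix.mul_one, hU]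

include hS in
theorem gMet_act {U : Matrix (Fin p) (Fin p) 𝕜} (hU : Uᴴ * U = 1) (w w' : Amb 𝕜 n p) :
    gMet α₀ α₁ β (act U S) (act U w) (act U w') = gMet α₀ α₁ β S w w' := by
  have hU' : U * Uᴴ = 1 := mul_eq_one_comm.1 hU
  have hc : ∀ {k : ℕ} (X : Matrix (Fin p) (Fin k) 𝕜), U * (Uᴴ * X) = X := fun X => by
    rw [← Matrix.mul_assoc, hU', Matrix.one_mul]
  have hi : (act U S).2⁻¹ = Uᴴ * S.2⁻¹ * U := inv_unitary_conj hU hS.2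
  have key : α₀ • ((act U w).1ᴴ * (act U w').1)
      + (α₁ - α₀) • ((act U w).1ᴴ * (act U S).1 * (act U S).1ᴴ * (act U w').1)
      + β • ((act U w).2ᴴ * (act U S).2⁻¹ * (act U w').2 * (act U S).2⁻¹) =
      Uᴴ * (α₀ • (w.1ᴴ * w'.1) + (α₁ - α₀) • (w.1ᴴ * S.1 * S.1ᴴ * w'.1)
        + β • (w.2ᴴ * S.2⁻¹ * w'.2 * S.2⁻¹)) * U := by
    rw [hi]
    simp only [act, conjTranspose_mul, conjTranspose_conjTranspose, Matrix.mul_assoc, hc,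
      Matrix.mul_add, Matrix.add_mul, Matrix.mul_smul, Matrix.smul_mul]
  rw [gMet_eq, gMet_eq, key, Matrix.mul_assoc, trR_mul_comm, Matrix.mul_assoc, hU', Matrix.mul_one]

/-! ### The horizontal space -/

include hS in
/-- The metric against a vertical vector. -/
theorem gMet_vertical (η : Amb 𝕜 n p) (W : Matrix (Fin p) (Fin p) 𝕜) :
    gMet α₀ α₁ β S η (S.1 * W, S.2 * W - W * S.2) =
      trR ((α₁ • (S.1ᴴ * η.1) + β • (η.2 * S.2⁻¹) - β • (S.2⁻¹ * η.2)) * Wᴴ) := by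
  have hi : (S.2⁻¹)ᴴ = S.2⁻¹ := hS.2.inv.1
  have e1 : α₀ • (S.1 * W) + (α₁ - α₀) • (S.1 * S.1ᴴ * (S.1 * W)) = α₁ • (S.1 * W) := by
    rw [Matrix.mul_assoc, stiefel_cancel hS.1]
    module
  have e2 : S.2⁻¹ * (S.2 * W - W * S.2) * S.2⁻¹ = W * S.2⁻¹ - S.2⁻¹ * W := by
    rw [Matrix.mul_sub, Matrix.sub_mul, PosDef_inv_mul_cancel hS.2, Matrix.mul_assoc,
      Matrix.mul_assoc, PosDef_mul_inv hS.2, Matrix.mul_one]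
  rw [gMet, gOp_apply, e1, e2, ambInner]
  simp only [Matrix.conjTranspose_smul, star_trivial, conjTranspose_mul, conjTranspose_sub, hi,
    Matrix.mul_smul, Matrix.add_mul, Matrix.sub_mul, Matrix.smul_mul, Matrix.mul_sub, trR_add,
    trR_sub, trR_smul]
  rw [← Matrix.mul_assoc, trR_mul_comm _ S.1ᴴ, ← Matrix.mul_assoc η.2 Wᴴ, trR_mul_comm _ S.2⁻¹]
  simp only [Matrix.mul_assoc]
  ring

theorem smul_skew_eq (S η : Amb 𝕜 n p)
    (he : α₁ • (S.1ᴴ * η.1) + β • (η.2 * S.2⁻¹) - β • (S.2⁻¹ * η.2) = 0) :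
    α₁ • (S.1ᴴ * η.1) = β • (S.2⁻¹ * η.2 - η.2 * S.2⁻¹) := by
  rw [smul_sub]
  rw [add_sub_assoc] at he
  rw [eq_neg_of_add_eq_zero_left he]
  abel

include hS in
-- For tangent `η` the matrix on the left is itself skew-Hermitian, so it is an admissible `W` in
-- `gMet_vertical`, and orthogonality to that vertical vector says that its norm is zero.
theorem mem_horizontal_of_tangent {η : Amb 𝕜 n p}
    (hη : η ∈ tangentSpaceAt (stiefelPD 𝕜 n p) S) : η ∈ horizontal α₀ α₁ β S ↔
      α₁ • (S.1ᴴ * η.1) + β • (η.2 * S.2⁻¹) - β • (S.2⁻¹ * η.2) = 0 := by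
  obtain ⟨h1, h2⟩ := (mem_tangentSpaceAt_stiefelPD hS).1 hη
  have hi : (S.2⁻¹)ᴴ = S.2⁻¹ := hS.2.inv.1
  constructor
  · intro h
    set Z := α₁ • (S.1ᴴ * η.1) + β • (η.2 * S.2⁻¹) - β • (S.2⁻¹ * η.2) with hZ
    have h3 : η.1ᴴ * S.1 = - (S.1ᴴ * η.1) := eq_neg_of_add_eq_zero_right h1
    have hskew : Zᴴ = -Z := by
      rw [hZ]
      simp only [conjTranspose_add, conjTranspose_sub, Matrix.conjTranspose_smul, star_trivial,
        conjTranspose_mul, conjTranspose_conjTranspose, hi, h2, h3]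
      module
    have h4 := h.2 _ ((mem_tangentSpaceAt_orbit hS.1).2 ⟨Z, hskew, rfl⟩)
    rw [gMet_vertical hS, ← hZ, trR_mul_comm] at h4
    exact trR_conjTranspose_mul_self_eq_zero h4
  · intro h
    refine ⟨hη, fun v hv => ?_⟩
    obtain ⟨W, -, rfl⟩ := (mem_tangentSpaceAt_orbit hS.1).1 hv
    rw [gMet_vertical hS, h, Matrix.zero_mul]
    simp [trR]

include hS hα₁ in
-- Tangency to the Stiefel factor comes for free: if `η_P` is Hermitian, the equation makes `α₁ Yᴴ
-- η_Y` a commutator of Hermitian matrices, which is skew.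
theorem mem_horizontal {η : Amb 𝕜 n p} : η ∈ horizontal α₀ α₁ β S ↔ η.2ᴴ = η.2 ∧
    α₁ • (S.1ᴴ * η.1) + β • (η.2 * S.2⁻¹) - β • (S.2⁻¹ * η.2) = 0 := by
  have hi : (S.2⁻¹)ᴴ = S.2⁻¹ := hS.2.inv.1
  constructor
  · intro h
    exact ⟨((mem_tangentSpaceAt_stiefelPD hS).1 h.1).2, (mem_horizontal_of_tangent hS h.1).1 h⟩
  · rintro ⟨h1, h2⟩
    refine (mem_horizontal_of_tangent hS ((mem_tangentSpaceAt_stiefelPD hS).2 ⟨?_, h1⟩)).2 h2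
    have h3 := smul_skew_eq S η h2
    have h4 := congrArg conjTranspose h3
    simp only [Matrix.conjTranspose_smul, star_trivial, conjTranspose_mul, conjTranspose_sub, hi,
      conjTranspose_conjTranspose, h1] at h4
    have h5 : α₁ • (S.1ᴴ * η.1 + η.1ᴴ * S.1) = 0 := by
      rw [smul_add, h3, h4]
      module
    exact (smul_eq_zero.1 h5).resolve_left hα₁.ne'

include hS hα₁ in
theorem horizontal_sub {η ζ : Amb 𝕜 n p} (hη : η ∈ horizontal α₀ α₁ β S)
    (hζ : ζ ∈ horizontal α₀ α₁ β S) : η - ζ ∈ horizontal α₀ α₁ β S := by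
  rw [mem_horizontal hS hα₁] at hη hζ ⊢
  refine ⟨by rw [Prod.snd_sub, conjTranspose_sub, hη.1, hζ.1], ?_⟩
  rw [← sub_eq_zero_of_eq (hη.2.trans hζ.2.symm), Prod.fst_sub, Prod.snd_sub, Matrix.mul_sub,
    Matrix.mul_sub, Matrix.sub_mul]
  module

/-! ### The operator `L(P)` -/

theorem lyap_apply (P X : Matrix (Fin p) (Fin p) 𝕜) :
    lyap α₁ β P X = (α₁ - 2 * β) • X + β • (P * X * P⁻¹ + P⁻¹ * X * P) := rfl

theorem lyap_conjTranspose {P : Matrix (Fin p) (Fin p) 𝕜} (hP : P.PosDef)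
    (X : Matrix (Fin p) (Fin p) 𝕜) : (lyap α₁ β P X)ᴴ = lyap α₁ β P Xᴴ := by
  have hi : (P⁻¹)ᴴ = P⁻¹ := hP.inv.1
  simp only [lyap_apply, conjTranspose_add, Matrix.conjTranspose_smul, star_trivial,
    conjTranspose_mul, hi, hP.1.eq, Matrix.mul_assoc]
  module

include hα₁ hβ in
-- The bracket equals `(a - b)² / (a b)`. So no relation between `α₁` and `β` is needed, although
-- `α₁ - 2 β` may be negative.
theorem lyap_weight_pos {a b : ℝ} (ha : 0 < a) (hb : 0 < b) :
    0 < α₁ + β * (a⁻¹ * b + a * b⁻¹ - 2) := by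
  have h : a⁻¹ * b + a * b⁻¹ - 2 = (a - b) ^ 2 * (a * b)⁻¹ := by
    field_simp
    ring
  rw [h]
  positivity

include hα₁ hβ in
-- Conjugation by `U` replaces `P` by the diagonal matrix `D`, and `D X D⁻¹` and `D⁻¹ X D` multiply
-- the entry at `(i, j)` by `Λ_i / Λ_j` and `Λ_j / Λ_i`. The operator thus acts entrywise by the
-- weights.
theorem lyap_diagonal {P U : Matrix (Fin p) (Fin p) 𝕜} (hP : P.PosDef) (hU : Uᴴ * U = 1)
    {Λ : Fin p → ℝ} (h : P = U * Matrix.diagonal (fun i => (Λ i : 𝕜)) * Uᴴ)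
    (B : Matrix (Fin p) (Fin p) 𝕜) :
    lyap α₁ β P (U * (Matrix.of fun i j => (Uᴴ * B * U) i j /
      ((α₁ + β * ((Λ i)⁻¹ * Λ j + Λ i * (Λ j)⁻¹ - 2) : ℝ) : 𝕜)) * Uᴴ) = B := by
  have hU' : U * Uᴴ = 1 := mul_eq_one_comm.1 hU
  have hc : ∀ X : Matrix (Fin p) (Fin p) 𝕜, Uᴴ * (U * X) = X := fun X => stiefel_cancel hU X
  have hc' : ∀ X : Matrix (Fin p) (Fin p) 𝕜, U * (Uᴴ * X) = X := fun X => by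
    rw [← Matrix.mul_assoc, hU', Matrix.one_mul]
  set D : Matrix (Fin p) (Fin p) 𝕜 := Matrix.diagonal (fun i => (Λ i : 𝕜)) with hD
  set D' : Matrix (Fin p) (Fin p) 𝕜 := Matrix.diagonal (fun i => ((Λ i)⁻¹ : 𝕜)) with hD'
  have hDP : D = Uᴴ * P * U := by
    rw [h]
    simp only [Matrix.mul_assoc, hc, hU, Matrix.mul_one]
  have hΛ : ∀ i, 0 < Λ i := by
    have h1 : D.PosDef := by
      rw [hDP]
      exact hP.conjTranspose_mul_mul_same
        (Matrix.mulVec_injective_of_isUnit (IsUnit.of_mul_eq_one_right _ hU))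
    rw [hD, Matrix.posDef_diagonal_iff] at h1
    exact fun i => by exact_mod_cast h1 i
  have hDD : D * D' = 1 := by
    rw [hD, hD', Matrix.diagonal_mul_diagonal, ← Matrix.diagonal_one]
    congr 1
    funext i
    have : (Λ i : 𝕜) ≠ 0 := by exact_mod_cast (hΛ i).ne'
    exact mul_inv_cancel₀ this
  have hPi : P⁻¹ = U * D' * Uᴴ := by
    refine Matrix.inv_eq_right_inv ?_
    rw [h]
    simp only [Matrix.mul_assoc, hc]
    rw [← Matrix.mul_assoc D, hDD, Matrix.one_mul, hU']
  set X : Matrix (Fin p) (Fin p) 𝕜 := Matrix.of fun i j => (Uᴴ * B * U) i j /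
      ((α₁ + β * ((Λ i)⁻¹ * Λ j + Λ i * (Λ j)⁻¹ - 2) : ℝ) : 𝕜) with hX
  have hent : (α₁ - 2 * β) • X + β • (D * X * D' + D' * X * D) = Uᴴ * B * U := by
    ext i j
    have hne : ((α₁ + β * ((Λ i)⁻¹ * Λ j + Λ i * (Λ j)⁻¹ - 2) : ℝ) : 𝕜) ≠ 0 := by
      exact_mod_cast (lyap_weight_pos hα₁ hβ (hΛ i) (hΛ j)).ne'
    have hXe : X i j * ((α₁ + β * ((Λ i)⁻¹ * Λ j + Λ i * (Λ j)⁻¹ - 2) : ℝ) : 𝕜) =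
        (Uᴴ * B * U) i j := by
      rw [hX, Matrix.of_apply, div_mul_cancel₀ _ hne]
    rw [← hXe]
    simp only [hD, hD', Matrix.add_apply, Matrix.smul_apply, Matrix.mul_diagonal,
      Matrix.diagonal_mul, RCLike.real_smul_eq_coe_mul]
    push_cast
    ring
  calc lyap α₁ β P (U * X * Uᴴ)
      = U * ((α₁ - 2 * β) • X + β • (D * X * D' + D' * X * D)) * Uᴴ := by
        rw [lyap_apply, hPi, h]
        simp only [Matrix.mul_assoc, hc, Matrix.mul_add, Matrix.add_mul, Matrix.mul_smul,
          Matrix.smul_mul]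
    _ = B := by
        rw [hent]
        simp only [Matrix.mul_assoc, hc', hU', Matrix.mul_one]

include hα₁ hβ in
theorem bijective_lyap {P : Matrix (Fin p) (Fin p) 𝕜} (hP : P.PosDef) :
    Function.Bijective (lyap α₁ β P) := by
  obtain ⟨U, hU, h⟩ := exists_unitary_diagonal hP.1
  have hs : Function.Surjective (lyap α₁ β P) := fun B =>
    ⟨_, lyap_diagonal hα₁ hβ hP (mem_unitaryGroup_iff_conjTranspose.1 hU) h B⟩
  exact ⟨LinearMap.injective_iff_surjective.2 hs, hs⟩

section Lyap

variable {P : Matrix (Fin p) (Fin p) 𝕜} (hP : P.PosDef)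

include hα₁ hβ hP

theorem lyap_lyapInv (B : Matrix (Fin p) (Fin p) 𝕜) : lyap α₁ β P (lyapInv α₁ β P B) = B :=
  apply_ringInverse (bijective_lyap hα₁ hβ hP) B

theorem lyapInv_eq {X B : Matrix (Fin p) (Fin p) 𝕜} (h : lyap α₁ β P X = B) :
    lyapInv α₁ β P B = X := by
  rw [← h]
  exact ringInverse_apply (bijective_lyap hα₁ hβ hP) X

theorem lyapInv_conjTranspose {B : Matrix (Fin p) (Fin p) 𝕜} (hB : Bᴴ = B) :
    (lyapInv α₁ β P B)ᴴ = lyapInv α₁ β P B := by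
  refine (lyapInv_eq hα₁ hβ hP ?_).symm
  rw [← lyap_conjTranspose hP, lyap_lyapInv hα₁ hβ hP, hB]

end Lyap

end Algebra

end FixedRankPSD

/-! ### Horizontal projection and horizontal lift. -/

namespace FixedRankPSD

noncomputable section Projection

variable {𝕜 : Type*} [RCLike 𝕜] {n p : ℕ} {S : Amb 𝕜 n p} (hS : S ∈ stiefelPD 𝕜 n p)
  {α₀ α₁ β : ℝ} (hα₀ : 0 < α₀) (hα₁ : 0 < α₁) (hβ : 0 < β)

/-! ### The horizontal projection -/

theorem symm_add {m : ℕ} (A B : Matrix (Fin m) (Fin m) 𝕜) :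
    FixedRankPSD.symm (A + B) = FixedRankPSD.symm A + FixedRankPSD.symm B := by
  simp only [FixedRankPSD.symm, conjTranspose_add]
  module

theorem symm_smul {m : ℕ} (c : ℝ) (A : Matrix (Fin m) (Fin m) 𝕜) :
    FixedRankPSD.symm (c • A) = c • FixedRankPSD.symm A := by
  simp only [FixedRankPSD.symm, Matrix.conjTranspose_smul, star_trivial]
  module

/-- The symmetrizer as a linear map. -/
def symmLin (𝕜 : Type*) [RCLike 𝕜] (m : ℕ) :
    Matrix (Fin m) (Fin m) 𝕜 →ₗ[ℝ] Matrix (Fin m) (Fin m) 𝕜 where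
  toFun := FixedRankPSD.symm
  map_add' := symm_add
  map_smul' := symm_smul

/-- The argument of the symmetrizer in the definition of `calD`. -/
def calDArg (S : Amb 𝕜 n p) : Amb 𝕜 n p →ₗ[ℝ] Matrix (Fin p) (Fin p) 𝕜 where
  toFun w := w.2 + S.1ᴴ * w.1 * S.2 - S.2 * S.1ᴴ * w.1
  map_add' v w := by
    simp only [Prod.fst_add, Prod.snd_add, Matrix.mul_add, Matrix.add_mul]
    abel
  map_smul' c w := by
    simp only [Prod.smul_fst, Prod.smul_snd, Matrix.mul_smul, Matrix.smul_mul, smul_add, smul_sub,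
      RingHom.id_apply]

/-- `calD` as a linear map. -/
def calDLin (α₁ β : ℝ) (S : Amb 𝕜 n p) : Amb 𝕜 n p →ₗ[ℝ] Matrix (Fin p) (Fin p) 𝕜 :=
  lyapInv α₁ β S.2 ∘ₗ symmLin 𝕜 p ∘ₗ calDArg S

theorem calDLin_apply (S w : Amb 𝕜 n p) : calDLin α₁ β S w = calD α₁ β S w := rfl

/-- `projFormula` as a linear map. -/
def projLin (α₁ β : ℝ) (S : Amb 𝕜 n p) : Amb 𝕜 n p →ₗ[ℝ] Amb 𝕜 n p where
  toFun := projFormula α₁ β S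
  map_add' v w := by
    simp only [projFormula, ← calDLin_apply, map_add, Prod.fst_add, Matrix.mul_add, Matrix.add_mul,
      Matrix.mul_sub]
    exact Prod.ext (by simp only [Prod.fst_add]; module) (by simp only [Prod.snd_add]; module)
  map_smul' c w := by
    simp only [projFormula, ← calDLin_apply, map_smul, Prod.smul_fst, Matrix.mul_smul,
      Matrix.smul_mul, RingHom.id_apply, Matrix.mul_sub]
    exact Prod.ext (by simp only [Prod.smul_fst]; module) (by simp only [Prod.smul_snd]; module)

theorem projLin_apply (S w : Amb 𝕜 n p) : projLin α₁ β S w = projFormula α₁ β S w := rfl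

include hS hα₁ hβ in
theorem lyap_calD (w : Amb 𝕜 n p) : lyap α₁ β S.2 (calD α₁ β S w) =
    FixedRankPSD.symm (w.2 + S.1ᴴ * w.1 * S.2 - S.2 * S.1ᴴ * w.1) :=
  lyap_lyapInv hα₁ hβ hS.2 _

include hS hα₁ hβ in
theorem conjTranspose_calD (w : Amb 𝕜 n p) : (calD α₁ β S w)ᴴ = calD α₁ β S w :=
  lyapInv_conjTranspose hα₁ hβ hS.2 (conjTranspose_symm _)

include hS in
theorem conjTranspose_mul_projFormula (w : Amb 𝕜 n p) : S.1ᴴ * (projFormula α₁ β S w).1 =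
    β • (S.2⁻¹ * calD α₁ β S w - calD α₁ β S w * S.2⁻¹) := by
  simp only [projFormula, Matrix.mul_add, Matrix.mul_sub, Matrix.mul_smul, Matrix.mul_assoc,
    stiefel_cancel hS.1]
  abel

include hS hα₁ hβ in
theorem projFormula_mem (w : Amb 𝕜 n p) : projFormula α₁ β S w ∈ horizontal α₀ α₁ β S := by
  rw [mem_horizontal hS hα₁, conjTranspose_mul_projFormula hS]
  refine ⟨?_, ?_⟩
  · simp only [projFormula, Matrix.conjTranspose_smul, star_trivial,
      conjTranspose_calD hS hα₁ hβ]
  · simp only [projFormula, Matrix.smul_mul, Matrix.mul_smul]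
    module

include hS in
/-- The metric between a vector with first component in the range of `Y` and a horizontal one. -/
theorem gMet_range (A B : Matrix (Fin p) (Fin p) 𝕜) {ζ : Amb 𝕜 n p} (h2 : ζ.2ᴴ = ζ.2)
    (he : α₁ • (S.1ᴴ * ζ.1) + β • (ζ.2 * S.2⁻¹) - β • (S.2⁻¹ * ζ.2) = 0) :
    gMet α₀ α₁ β S (S.1 * A, B) ζ =
      β * trR ((A * S.2 - S.2 * A + B) * (S.2⁻¹ * ζ.2 * S.2⁻¹)) := by
  have hi : (S.2⁻¹)ᴴ = S.2⁻¹ := hS.2.inv.1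
  have e1 : α₁ • (ζ.1ᴴ * S.1) = β • (ζ.2 * S.2⁻¹ - S.2⁻¹ * ζ.2) := by
    have h4 := congrArg conjTranspose (smul_skew_eq S ζ he)
    simpa only [Matrix.conjTranspose_smul, star_trivial, conjTranspose_mul, conjTranspose_sub, hi,
      conjTranspose_conjTranspose, h2] using h4
  have e2 : (α₀ • ζ.1 + (α₁ - α₀) • (S.1 * S.1ᴴ * ζ.1))ᴴ * S.1 = α₁ • (ζ.1ᴴ * S.1) := by
    simp only [conjTranspose_add, Matrix.conjTranspose_smul, star_trivial, conjTranspose_mul,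
      conjTranspose_conjTranspose, Matrix.add_mul, Matrix.smul_mul, Matrix.mul_assoc, hS.1,
      Matrix.mul_one]
    module
  have hP1 : ∀ X : Matrix (Fin p) (Fin p) 𝕜, S.2 * (S.2⁻¹ * X) = X := PosDef_mul_inv_cancel hS.2
  rw [gMet, gOp_apply, ambInner]
  simp only
  rw [Matrix.mul_assoc, trR_mul_comm S.1, Matrix.mul_assoc, e2, e1]
  simp only [Matrix.conjTranspose_smul, star_trivial, conjTranspose_mul, hi, h2, Matrix.mul_smul,
    Matrix.mul_sub, Matrix.add_mul, Matrix.sub_mul, trR_add, trR_sub, trR_smul, Matrix.mul_assoc,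
    hP1]
  rw [trR_mul_comm S.2 (A * _)]
  simp only [Matrix.mul_assoc, PosDef_inv_mul hS.2, Matrix.mul_one]
  ring

include hS hα₁ hβ in
-- The residual `w - Π w` has the form `(Y A, B)`. By `gMet_range` its product with a horizontal `ζ`
-- is the trace of `A P - P A + B` against the Hermitian `P⁻¹ ζ_P P⁻¹`. The equation defining `𝒟`
-- makes the first factor `R - sym R`, which is skew, so the trace vanishes.
theorem gMet_projFormula (w : Amb 𝕜 n p) {ζ : Amb 𝕜 n p} (hζ : ζ ∈ horizontal α₀ α₁ β S) :
    gMet α₀ α₁ β S (projFormula α₁ β S w) ζ = gMet α₀ α₁ β S w ζ := by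
  rw [mem_horizontal hS hα₁] at hζ
  have hi : (S.2⁻¹)ᴴ = S.2⁻¹ := hS.2.inv.1
  set D := calD α₁ β S w with hD
  set A := S.1ᴴ * w.1 - β • (S.2⁻¹ * D - D * S.2⁻¹) with hA
  have e : w - projFormula α₁ β S w = (S.1 * A, w.2 - α₁ • D) := by
    refine Prod.ext ?_ rfl
    simp only [projFormula, Prod.fst_sub, hA, Matrix.mul_sub, Matrix.mul_smul, ← hD,
      Matrix.mul_assoc]
    abel
  set R := w.2 + S.1ᴴ * w.1 * S.2 - S.2 * S.1ᴴ * w.1 with hR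
  have e2 : A * S.2 - S.2 * A + (w.2 - α₁ • D) = R - FixedRankPSD.symm R := by
    rw [hR, ← lyap_calD hS hα₁ hβ w, ← hD, lyap_apply, hA]
    simp only [Matrix.sub_mul, Matrix.mul_sub, Matrix.smul_mul, Matrix.mul_smul, Matrix.mul_assoc,
      PosDef_mul_inv_cancel hS.2, PosDef_inv_mul hS.2, Matrix.mul_one]
    module
  have h3 : gMet α₀ α₁ β S (w - projFormula α₁ β S w) ζ = 0 := by
    rw [e, gMet_range hS _ _ hζ.1 hζ.2, e2, trR_mul_eq_zero, mul_zero]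
    · simp only [conjTranspose_sub, FixedRankPSD.symm, Matrix.conjTranspose_smul, star_trivial,
        conjTranspose_add, conjTranspose_conjTranspose]
      module
    · simp only [conjTranspose_mul, hi, hζ.1, Matrix.mul_assoc]
  rw [gMet_sub_left] at h3
  linarith

include hS hα₀ hα₁ hβ in
theorem IsHorizontalProjection.unique {w η ζ : Amb 𝕜 n p}
    (hη : IsHorizontalProjection α₀ α₁ β S w η) (hζ : IsHorizontalProjection α₀ α₁ β S w ζ) :
    η = ζ := by
  by_contra hne
  have h1 := gMet_pos hS hα₀ hα₁ hβ (sub_ne_zero.2 hne)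
  have h2 := horizontal_sub hS hα₁ hη.1 hζ.1
  rw [gMet_sub_left, hη.2 _ h2, hζ.2 _ h2, sub_self] at h1
  exact lt_irrefl _ h1

include hS hα₀ hα₁ hβ in
theorem projH_spec (w : Amb 𝕜 n p) : IsHorizontalProjection α₀ α₁ β S w (projH α₀ α₁ β S w) ∧
    projH α₀ α₁ β S w = projFormula α₁ β S w := by
  have h : IsHorizontalProjection α₀ α₁ β S w (projFormula α₁ β S w) :=
    ⟨projFormula_mem hS hα₁ hβ w, fun ζ hζ => gMet_projFormula hS hα₁ hβ w hζ⟩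
  have h1 : ∃ η, IsHorizontalProjection α₀ α₁ β S w η := ⟨_, h⟩
  have h2 : IsHorizontalProjection α₀ α₁ β S w (projH α₀ α₁ β S w) := by
    rw [projH, dif_pos h1]
    exact h1.choose_spec
  exact ⟨h2, h2.unique hS hα₀ hα₁ hβ h⟩

include hS hα₀ hα₁ hβ in
theorem projH_eq (w : Amb 𝕜 n p) : projH α₀ α₁ β S w = projLin α₁ β S w :=
  (projH_spec hS hα₀ hα₁ hβ w).2

include hS hα₀ hα₁ hβ in
theorem projLin_of_mem {w : Amb 𝕜 n p} (hw : w ∈ horizontal α₀ α₁ β S) :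
    projLin α₁ β S w = w := by
  rw [← projH_eq hS hα₀ hα₁ hβ]
  exact (projH_spec hS hα₀ hα₁ hβ w).1.unique hS hα₀ hα₁ hβ ⟨hw, fun _ _ => rfl⟩

/-! ### The parametrization of the horizontal space -/

theorem fromCols_orthogonal {Y : Matrix (Fin n) (Fin p) 𝕜} {Z : Matrix (Fin n) (Fin (n - p)) 𝕜}
    (h : (Matrix.fromCols Y Z)ᴴ * Matrix.fromCols Y Z = 1) :
    Yᴴ * Z = 0 ∧ Zᴴ * Y = 0 ∧ Zᴴ * Z = 1 := by
  rw [Matrix.conjTranspose_fromCols_eq_fromRows_conjTranspose, Matrix.fromRows_mul_fromCols,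
    ← Matrix.fromBlocks_one, Matrix.fromBlocks_inj] at h
  exact h.2

include hS hα₁ in
-- Split `η_Y` along the ranges of `Y` and `Yperp`. The horizontal equation prescribes `Yᴴ η_Y` in
-- terms of `η_P = α₁ D` and leaves the component `B = Yperpᴴ η_Y` free.
theorem bijOn_nOp {Yperp : Matrix (Fin n) (Fin (n - p)) 𝕜}
    (h1 : (Matrix.fromCols S.1 Yperp)ᴴ * Matrix.fromCols S.1 Yperp = 1)
    (h2 : Matrix.fromCols S.1 Yperp * (Matrix.fromCols S.1 Yperp)ᴴ = 1) :
    Set.BijOn (nOp α₁ β S Yperp) {x | x.2ᴴ = x.2} (horizontal α₀ α₁ β S) := by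
  obtain ⟨ha, hb, hc⟩ := fromCols_orthogonal h1
  have hd : S.1 * S.1ᴴ + Yperp * Yperpᴴ = 1 := by
    rwa [Matrix.conjTranspose_fromCols_eq_fromRows_conjTranspose,
      Matrix.fromCols_mul_fromRows] at h2
  have hap : ∀ x, nOp α₁ β S Yperp x =
    (β • (S.1 * (S.2⁻¹ * x.2 - x.2 * S.2⁻¹)) + Yperp * x.1, α₁ • x.2) := fun _ => rfl
  refine ⟨fun x hx => ?_, fun x _ y _ hxy => ?_, fun η hη => ?_⟩
  · rw [mem_horizontal hS hα₁, hap]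
    refine ⟨?_, ?_⟩
    · simp only [Matrix.conjTranspose_smul, star_trivial]
      rw [show x.2ᴴ = x.2 from hx]
    · simp only [Matrix.mul_add, Matrix.mul_smul, stiefel_cancel hS.1, ← Matrix.mul_assoc S.1ᴴ Yperp,
        ha, Matrix.zero_mul, Matrix.smul_mul]
      module
  · rw [hap, hap] at hxy
    have e2 : x.2 = y.2 := smul_right_injective _ hα₁.ne' (congrArg Prod.snd hxy)
    have e1 := congrArg Prod.fst hxy
    simp only [e2, add_right_inj] at e1
    refine Prod.ext ?_ e2
    rw [← Matrix.one_mul x.1, ← Matrix.one_mul y.1, ← hc, Matrix.mul_assoc, e1, Matrix.mul_assoc]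
  · rw [mem_horizontal hS hα₁] at hη
    refine ⟨(Yperpᴴ * η.1, α₁⁻¹ • η.2), ?_, ?_⟩
    · simp [Matrix.conjTranspose_smul, hη.1]
    · rw [hap]
      refine Prod.ext ?_ ?_
      · have e1 := smul_skew_eq S η hη.2
        have e2 : S.1ᴴ * η.1 = α₁⁻¹ • β • (S.2⁻¹ * η.2 - η.2 * S.2⁻¹) := by
          rw [← e1, smul_smul, inv_mul_cancel₀ hα₁.ne', one_smul]
        have e3 : η.1 = S.1 * (S.1ᴴ * η.1) + Yperp * (Yperpᴴ * η.1) := by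
          rw [← Matrix.mul_assoc, ← Matrix.mul_assoc, ← Matrix.add_mul, hd, Matrix.one_mul]
        conv_rhs => rw [e3, e2]
        simp only [Matrix.mul_smul, Matrix.smul_mul, Matrix.mul_sub, smul_sub]
        rw [smul_comm β, smul_comm β]
      · simp only [smul_smul, mul_inv_cancel₀ hα₁.ne', one_smul]

/-! ### The differential of `proj` on the horizontal space -/

theorem dproj_sub (S η ζ : Amb 𝕜 n p) : dproj S (η - ζ) = dproj S η - dproj S ζ := by
  simp only [dproj_eq, Prod.fst_sub, Prod.snd_sub, Matrix.sub_mul, Matrix.mul_sub,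
    conjTranspose_sub]
  abel

include hS in
theorem dproj_mul (η : Amb 𝕜 n p) :
    dproj S η * S.1 = η.1 * S.2 + S.1 * (η.2 + S.2 * (η.1ᴴ * S.1)) := by
  rw [dproj_eq]
  simp only [Matrix.add_mul, Matrix.mul_add, Matrix.mul_assoc, hS.1, Matrix.mul_one]
  abel

include hS hα₁ hβ in
-- For a horizontal `δ` in the kernel put `a = Yᴴ δ_Y`, which is skew. Compressing `dproj S δ = 0`
-- by `Y` gives `a P + δ_P - P a = 0`, and inserting `α₁ a = β (P⁻¹ δ_P - δ_P P⁻¹)` turns this into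
-- `L(P) δ_P = 0`. Then `δ_P = 0`, `a = 0`, and what remains is `δ_Y P = 0`.
theorem injOn_dproj : Set.InjOn (dproj S) (horizontal α₀ α₁ β S) := by
  intro η hη ζ hζ he
  have hδ := horizontal_sub hS hα₁ hη hζ
  have h0 : dproj S (η - ζ) = 0 := by rw [dproj_sub, he, sub_self]
  rw [← sub_eq_zero]
  generalize η - ζ = δ at hδ h0
  have ht := (mem_tangentSpaceAt_stiefelPD hS).1 hδ.1
  rw [mem_horizontal hS hα₁] at hδ
  have h1 := dproj_mul hS δ
  rw [h0, Matrix.zero_mul] at h1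
  have h2 := congrArg (S.1ᴴ * ·) h1
  simp only [Matrix.mul_zero, Matrix.mul_add, stiefel_cancel hS.1, ← Matrix.mul_assoc S.1ᴴ δ.1,
    eq_neg_of_add_eq_zero_right ht.1, Matrix.mul_neg] at h2
  have h3 := smul_skew_eq S δ hδ.2
  have h4 : lyap α₁ β S.2 δ.2 = 0 := by
    have h5 : α₁ • (S.1ᴴ * δ.1 * S.2 + (δ.2 + -(S.2 * (S.1ᴴ * δ.1)))) = 0 := by
      rw [← h2, smul_zero]
    have h6 : α₁ • (S.1ᴴ * δ.1 * S.2) = (α₁ • (S.1ᴴ * δ.1)) * S.2 := (Matrix.smul_mul _ _ _).symm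
    have h7 : α₁ • (S.2 * (S.1ᴴ * δ.1)) = S.2 * (α₁ • (S.1ᴴ * δ.1)) := (Matrix.mul_smul _ _ _).symm
    rw [smul_add, smul_add, smul_neg, h6, h7, h3] at h5
    rw [← h5, lyap_apply]
    simp only [Matrix.sub_mul, Matrix.mul_sub, Matrix.smul_mul, Matrix.mul_smul, Matrix.mul_assoc,
      PosDef_mul_inv_cancel hS.2, PosDef_inv_mul hS.2, Matrix.mul_one]
    module
  have h5 : δ.2 = 0 := (bijective_lyap hα₁ hβ hS.2).1 (by rw [h4, map_zero])
  have h6 : S.1ᴴ * δ.1 = 0 := by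
    rw [h5, Matrix.mul_zero, Matrix.zero_mul, sub_zero, smul_zero] at h3
    exact (smul_eq_zero.1 h3).resolve_left hα₁.ne'
  have h7 : δ.1 * S.2 = 0 := by
    rw [h5, eq_neg_of_add_eq_zero_right ht.1, h6] at h1
    simpa using h1.symm
  refine Prod.ext ?_ h5
  rw [← Matrix.mul_one δ.1, ← PosDef_mul_inv hS.2, ← Matrix.mul_assoc, h7, Matrix.zero_mul]
  rfl

/-- The image depends only on the part of `η_Y` normal to the range of `Y` and on one `p × p` block;
comparing images reduces to comparing these two. -/
theorem dproj_eq_of_eq {η ζ : Amb 𝕜 n p}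
    (h1 : η.1 - S.1 * S.1ᴴ * η.1 = ζ.1 - S.1 * S.1ᴴ * ζ.1)
    (h2 : S.1ᴴ * η.1 * S.2 + η.2 + S.2 * (S.1ᴴ * η.1)ᴴ =
      S.1ᴴ * ζ.1 * S.2 + ζ.2 + S.2 * (S.1ᴴ * ζ.1)ᴴ) : dproj S η = dproj S ζ := by
  have key : ∀ η : Amb 𝕜 n p, dproj S η = (η.1 - S.1 * S.1ᴴ * η.1) * S.2 * S.1ᴴ
      + S.1 * (S.1ᴴ * η.1 * S.2 + η.2 + S.2 * (S.1ᴴ * η.1)ᴴ) * S.1ᴴ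
      + S.1 * S.2 * (η.1 - S.1 * S.1ᴴ * η.1)ᴴ := by
    intro η
    rw [dproj_eq]
    simp only [conjTranspose_sub, conjTranspose_mul, conjTranspose_conjTranspose, Matrix.sub_mul,
      Matrix.mul_sub, Matrix.mul_add, Matrix.add_mul, Matrix.mul_assoc]
    abel
  rw [key η, key ζ, h1, h2]

include hS hα₁ hβ in
/-- The horizontal projection does not change the image of a tangent vector under `dproj`. -/
theorem dproj_projFormula {w : Amb 𝕜 n p} (hw : w ∈ tangentSpaceAt (stiefelPD 𝕜 n p) S) :
    dproj S (projFormula α₁ β S w) = dproj S w := by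
  obtain ⟨hw1, hw2⟩ := (mem_tangentSpaceAt_stiefelPD hS).1 hw
  have hi : (S.2⁻¹)ᴴ = S.2⁻¹ := hS.2.inv.1
  have hD := conjTranspose_calD hS hα₁ hβ w
  refine dproj_eq_of_eq ?_ ?_
  · simp only [projFormula, Matrix.mul_add, Matrix.mul_sub, Matrix.mul_smul, Matrix.mul_assoc,
      stiefel_cancel hS.1]
    abel
  · have hsk : (S.1ᴴ * w.1)ᴴ = -(S.1ᴴ * w.1) := by
      rw [conjTranspose_mul, conjTranspose_conjTranspose, eq_neg_of_add_eq_zero_right hw1]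
    rw [conjTranspose_mul_projFormula hS, hsk]
    have e := lyap_calD hS hα₁ hβ w
    -- For tangent `w` the argument of the symmetrizer is already Hermitian and is the `p × p` block
    -- of `w`. The block of the projection works out to `L(P) 𝒟`, so the two agree.
    rw [symm_eq_self] at e
    · have e' : S.1ᴴ * w.1 * S.2 + w.2 + S.2 * -(S.1ᴴ * w.1) =
          w.2 + S.1ᴴ * w.1 * S.2 - S.2 * S.1ᴴ * w.1 := by
        rw [Matrix.mul_neg, Matrix.mul_assoc S.2]
        abel
      rw [e', ← e, lyap_apply]
      simp only [projFormula, Matrix.conjTranspose_smul, star_trivial, conjTranspose_sub,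
        conjTranspose_mul, hi, hD, Matrix.sub_mul, Matrix.mul_sub, Matrix.smul_mul,
        Matrix.mul_smul, Matrix.mul_assoc, PosDef_mul_inv_cancel hS.2, PosDef_inv_mul hS.2,
        Matrix.mul_one]
      module
    · rw [conjTranspose_sub, conjTranspose_add, conjTranspose_mul, Matrix.mul_assoc S.2,
        conjTranspose_mul S.2, hsk, hw2, hS.2.1.eq, Matrix.mul_neg, Matrix.neg_mul]
      abel

include hS hα₁ hβ in
theorem bijOn_dproj : Set.BijOn (dproj S) (horizontal α₀ α₁ β S)
    (tangentSpaceAt (psdRank 𝕜 n p) (proj S)) := by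
  refine ⟨fun η hη => dproj_mem_tangentSpaceAt hη.1, injOn_dproj hS hα₁ hβ, fun v hv => ?_⟩
  obtain ⟨η, hη, rfl⟩ := exists_dproj_eq hS hv
  exact ⟨_, projFormula_mem hS hα₁ hβ η, dproj_projFormula hS hα₁ hβ hη⟩

/-- A linear lift of symmetric matrices to the tangent vectors at `S` with `Yᴴ η_Y = 0`. -/
def preLift (S : Amb 𝕜 n p) : Matrix (Fin n) (Fin n) 𝕜 →ₗ[ℝ] Amb 𝕜 n p where
  toFun v := ((v - S.1 * S.1ᴴ * v) * S.1 * S.2⁻¹, S.1ᴴ * v * S.1)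
  map_add' v w := by
    simp only [Matrix.mul_add, Matrix.add_mul, Matrix.sub_mul]
    exact Prod.ext (by simp only [Prod.fst_add]; abel) rfl
  map_smul' c v := by
    simp only [Matrix.mul_smul, Matrix.smul_mul, RingHom.id_apply, Matrix.sub_mul]
    exact Prod.ext (by simp only [Prod.smul_fst]; module) rfl

/-- The horizontal lift of tangent vectors of the positive semidefinite matrices of rank `p`. -/
def horLift (α₁ β : ℝ) (S : Amb 𝕜 n p) : Matrix (Fin n) (Fin n) 𝕜 →ₗ[ℝ] Amb 𝕜 n p :=
  projLin α₁ β S ∘ₗ preLift S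

include hS hα₁ hβ in
theorem horLift_mem (v : Matrix (Fin n) (Fin n) 𝕜) :
    horLift α₁ β S v ∈ horizontal α₀ α₁ β S :=
  projFormula_mem hS hα₁ hβ _

include hS hα₁ hβ in
-- A tangent `v` is some `dproj S η`. The vector `preLift S v` has the same normal part and the same
-- `p × p` block as `η`, hence the same image, and horizontal projection preserves that image.
theorem dproj_horLift {v : Matrix (Fin n) (Fin n) 𝕜}
    (hv : v ∈ tangentSpaceAt (psdRank 𝕜 n p) (proj S)) : dproj S (horLift α₁ β S v) = v := by
  obtain ⟨η, hη, rfl⟩ := exists_dproj_eq hS hv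
  obtain ⟨h1, h2⟩ := (mem_tangentSpaceAt_stiefelPD hS).1 hη
  set v := dproj S η with hv'
  have hvh : vᴴ = v := by
    rw [hv', dproj_eq]
    simp only [conjTranspose_add, conjTranspose_mul, conjTranspose_conjTranspose, hS.2.1.eq, h2,
      Matrix.mul_assoc]
    abel
  have e0 : S.1ᴴ * (preLift S v).1 = 0 := by
    change S.1ᴴ * ((v - S.1 * S.1ᴴ * v) * S.1 * S.2⁻¹) = 0
    simp only [Matrix.mul_sub, Matrix.sub_mul, Matrix.mul_assoc, stiefel_cancel hS.1, sub_self]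
  have ht : preLift S v ∈ tangentSpaceAt (stiefelPD 𝕜 n p) S := by
    refine (mem_tangentSpaceAt_stiefelPD hS).2 ⟨?_, ?_⟩
    · have e1 : (preLift S v).1ᴴ * S.1 = 0 := by
        rw [← conjTranspose_conjTranspose S.1, ← conjTranspose_mul, e0, conjTranspose_zero]
      rw [e0, e1, add_zero]
    · change (S.1ᴴ * v * S.1)ᴴ = S.1ᴴ * v * S.1
      rw [conjTranspose_mul, conjTranspose_mul, conjTranspose_conjTranspose, hvh, Matrix.mul_assoc]
  refine (dproj_projFormula hS hα₁ hβ ht).trans (dproj_eq_of_eq ?_ ?_)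
  · rw [Matrix.mul_assoc S.1, e0, Matrix.mul_zero, sub_zero]
    change (v - S.1 * S.1ᴴ * v) * S.1 * S.2⁻¹ = _
    rw [Matrix.sub_mul, Matrix.mul_assoc (S.1 * S.1ᴴ), hv', dproj_mul hS]
    simp only [Matrix.mul_add, Matrix.mul_assoc, stiefel_cancel hS.1, Matrix.sub_mul,
      Matrix.add_mul, PosDef_mul_inv hS.2, Matrix.mul_one]
    abel
  · rw [e0, conjTranspose_zero, Matrix.mul_zero, Matrix.zero_mul, zero_add, add_zero]
    change S.1ᴴ * v * S.1 = _
    rw [Matrix.mul_assoc, hv', dproj_mul hS, Matrix.mul_add, stiefel_cancel hS.1, conjTranspose_mul,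
      conjTranspose_conjTranspose]
    simp only [Matrix.mul_assoc]
    abel

include hS hα₁ hβ in
theorem eq_horLift {η : Amb 𝕜 n p} (hη : η ∈ horizontal α₀ α₁ β S) :
    η = horLift α₁ β S (dproj S η) :=
  injOn_dproj hS hα₁ hβ hη (horLift_mem hS hα₁ hβ _)
    (dproj_horLift hS hα₁ hβ (dproj_mem_tangentSpaceAt hη.1)).symm

/-! ### Equivariance -/

theorem dproj_act {U : Matrix (Fin p) (Fin p) 𝕜} (hU : Uᴴ * U = 1) (S η : Amb 𝕜 n p) :
    dproj (act U S) (act U η) = dproj S η := by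
  have hU' : U * Uᴴ = 1 := mul_eq_one_comm.1 hU
  have hc : ∀ {k : ℕ} (X : Matrix (Fin p) (Fin k) 𝕜), U * (Uᴴ * X) = X := fun X => by
    rw [← Matrix.mul_assoc, hU', Matrix.one_mul]
  rw [dproj_eq, dproj_eq]
  simp only [act, conjTranspose_mul, Matrix.mul_assoc, hc]

include hS hα₁ in
theorem act_mem_horizontal {U : Matrix (Fin p) (Fin p) 𝕜} (hU : Uᴴ * U = 1) {η : Amb 𝕜 n p}
    (hη : η ∈ horizontal α₀ α₁ β S) : act U η ∈ horizontal α₀ α₁ β (act U S) := by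
  have hU' : U * Uᴴ = 1 := mul_eq_one_comm.1 hU
  have hc : ∀ {k : ℕ} (X : Matrix (Fin p) (Fin k) 𝕜), U * (Uᴴ * X) = X := fun X => by
    rw [← Matrix.mul_assoc, hU', Matrix.one_mul]
  rw [mem_horizontal hS hα₁] at hη
  rw [mem_horizontal (act_mem hU hS) hα₁]
  have hi : (act U S).2⁻¹ = Uᴴ * S.2⁻¹ * U := inv_unitary_conj hU hS.2
  refine ⟨?_, ?_⟩
  · simp only [act, conjTranspose_mul, conjTranspose_conjTranspose, hη.1, Matrix.mul_assoc]
  · rw [hi]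
    have h : Uᴴ * (α₁ • (S.1ᴴ * η.1) + β • (η.2 * S.2⁻¹) - β • (S.2⁻¹ * η.2)) * U = 0 := by
      rw [hη.2, Matrix.mul_zero, Matrix.zero_mul]
    rw [← h]
    simp only [act, conjTranspose_mul, Matrix.mul_assoc, hc, Matrix.mul_add, Matrix.add_mul,
      Matrix.mul_sub, Matrix.sub_mul, Matrix.mul_smul, Matrix.smul_mul]

include hS hα₁ hβ in
/-- The metric of horizontal lifts only depends on the point of the quotient. -/
theorem gMet_horLift_eq {S' : Amb 𝕜 n p} (hS' : S' ∈ stiefelPD 𝕜 n p) (h : proj S = proj S')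
    {u v : Matrix (Fin n) (Fin n) 𝕜} (hu : u ∈ tangentSpaceAt (psdRank 𝕜 n p) (proj S))
    (hv : v ∈ tangentSpaceAt (psdRank 𝕜 n p) (proj S)) :
    gMet α₀ α₁ β S (horLift α₁ β S u) (horLift α₁ β S v) =
      gMet α₀ α₁ β S' (horLift α₁ β S' u) (horLift α₁ β S' v) := by
  obtain ⟨U, hU, rfl⟩ := (proj_eq_iff hS hS').1 h
  rw [mem_unitaryGroup_iff_conjTranspose] at hU
  -- The lift at the moved point is the moved lift, since both are horizontal with the same image;
  -- invariance of the metric then finishes the proof.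
  have key : ∀ {u}, u ∈ tangentSpaceAt (psdRank 𝕜 n p) (proj S) →
      horLift α₁ β (act U S) u = act U (horLift α₁ β S u) := by
    intro u hu
    refine injOn_dproj (α₀ := α₀) hS' hα₁ hβ (horLift_mem hS' hα₁ hβ u)
      (act_mem_horizontal hS hα₁ hU (horLift_mem hS hα₁ hβ u)) ?_
    rw [dproj_act hU, dproj_horLift hS hα₁ hβ hu, dproj_horLift hS' hα₁ hβ (by rwa [h] at hu)]
  rw [key hu, key hv, gMet_act hS hU]

end Projection

end FixedRankPSD

/-! ### Smooth families of linear maps. -/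

namespace EmbeddedGeometry

section LinearFamilies

variable {E V W : Type*} [NormedAddCommGroup E] [NormedSpace ℝ E] [NormedAddCommGroup V]
  [NormedSpace ℝ V] [FiniteDimensional ℝ V] [NormedAddCommGroup W] [NormedSpace ℝ W]
  {s : Set E} {x v : E} {N : WithTop ℕ∞}

/-! ### Families of linear maps -/

theorem linearMap_apply_eq_sum (A : V →ₗ[ℝ] W) (w : V) :
    A w = ∑ i, (Module.finBasis ℝ V).coord i w • A (Module.finBasis ℝ V i) := by
  conv_lhs => rw [← (Module.finBasis ℝ V).sum_repr w, map_sum]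
  simp only [map_smul, Module.Basis.coord_apply]

theorem contDiffWithinAt_toContinuousLinearMap {A : E → V →ₗ[ℝ] W}
    (hA : ∀ u, ContDiffWithinAt ℝ N (fun y => A y u) s x) :
    ContDiffWithinAt ℝ N (fun y => LinearMap.toContinuousLinearMap (A y)) s x := by
  have e : (fun y => LinearMap.toContinuousLinearMap (A y)) = fun y => ∑ i,
      ContinuousLinearMap.smulRight (LinearMap.toContinuousLinearMap
        ((Module.finBasis ℝ V).coord i)) (A y (Module.finBasis ℝ V i)) := by
    funext y
    ext w
    rw [_root_.sum_apply]
    exact linearMap_apply_eq_sum (A y) w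
  rw [e]
  exact ContDiffWithinAt.sum fun i _ => contDiffWithinAt_const.smulRight (hA _)

/-- In finite dimension the endomorphisms form a Banach algebra, where inversion is analytic at
units. -/
theorem contDiffWithinAt_ringInverse_apply {A : E → V →ₗ[ℝ] V} {w : E → V}
    (hA : ∀ u, ContDiffWithinAt ℝ N (fun y => A y u) s x) (hb : Function.Bijective (A x))
    (hw : ContDiffWithinAt ℝ N w s x) :
    ContDiffWithinAt ℝ N (fun y => (Ring.inverse (A y) : Module.End ℝ V) (w y)) s x := by
  have _ : CompleteSpace V := FiniteDimensional.complete ℝ V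
  let Φ := Module.End.toContinuousLinearMap (𝕜 := ℝ) V
  -- This includes the non-units, where both inverses are `0`. The functions therefore agree
  -- everywhere, and nearby invertibility need not be discussed.
  have hinv : ∀ B : Module.End ℝ V, Ring.inverse (Φ B) = Φ (Ring.inverse B) := by
    intro B
    by_cases hB : IsUnit B
    · obtain ⟨u, rfl⟩ := hB
      rw [Ring.inverse_unit]
      exact Ring.inverse_unit (Units.map (Φ : Module.End ℝ V →* (V →L[ℝ] V)) u)
    · rw [Ring.inverse_non_unit _ hB, map_zero, Ring.inverse_non_unit]
      intro h
      exact hB (by simpa using h.map Φ.symm)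
  have hu : IsUnit (Φ (A x)) := ((Module.End.isUnit_iff (A x)).2 hb).map Φ
  have h1 : ContDiffWithinAt ℝ N (fun y => Ring.inverse (Φ (A y))) s x := by
    obtain ⟨u, hu⟩ := hu
    have h2 := contDiffAt_ringInverse ℝ (n := N) u
    rw [hu] at h2
    exact h2.comp_contDiffWithinAt x (contDiffWithinAt_toContinuousLinearMap hA)
  have h3 := h1.clm_apply hw
  simp only [hinv] at h3
  exact h3

theorem HasDirDeriv.congr_val {f : E → W} {a b : W} (h : HasDirDeriv s f x v a) (e : a = b) :
    HasDirDeriv s f x v b := e ▸ h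

theorem HasDirDeriv.sum {ι : Type*} (t : Finset ι) {f : ι → E → W} {a : ι → W}
    (h : ∀ i ∈ t, HasDirDeriv s (f i) x v (a i)) :
    HasDirDeriv s (fun y => ∑ i ∈ t, f i y) x v (∑ i ∈ t, a i) := by
  classical
  induction t using Finset.induction_on with
  | empty => simpa using HasDirDeriv.const 0
  | insert i t hi ih =>
    simp only [Finset.sum_insert hi]
    exact (h i (Finset.mem_insert_self i t)).add
      (ih fun j hj => h j (Finset.mem_insert_of_mem hj))

/-- The product rule for the application of a family of linear maps. -/
theorem HasDirDeriv.linearMap_apply {A : E → V →ₗ[ℝ] W} {w : E → V} {w' : V}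
    (hA : ∀ u, DifferentiableWithinAt ℝ (fun y => A y u) s x) (hw : HasDirDeriv s w x v w')
    (hv : v ∈ tangentSpaceAt s x) :
    HasDirDeriv s (fun y => A y (w y)) x v (dirDeriv s (fun y => A y (w x)) x v + A x w') := by
  have e : ∀ w : E → V, (fun y => A y (w y)) = fun y => ∑ i,
      (LinearMap.toContinuousLinearMap ((Module.finBasis ℝ V).coord i)) (w y) •
        A y (Module.finBasis ℝ V i) := fun w => by
    funext y
    exact linearMap_apply_eq_sum (A y) (w y)
  have key : ∀ {w : E → V} {w' : V}, HasDirDeriv s w x v w' → HasDirDeriv s (fun y => A y (w y)) x v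
      (∑ i, ((Module.finBasis ℝ V).coord i (w x) •
        dirDeriv s (fun y => A y (Module.finBasis ℝ V i)) x v +
        (Module.finBasis ℝ V).coord i w' • A x (Module.finBasis ℝ V i))) := by
    intro w w' hw
    rw [e w]
    exact HasDirDeriv.sum _ fun i _ => (hw.clm _).smul (hasDirDeriv_dirDeriv (hA _) v)
  -- The coordinate formula is used twice, for `w` itself and for `w` frozen at `x`. The frozen
  -- version identifies the first sum as the derivative of the family.
  have h1 := key hw
  have h2 := (key (HasDirDeriv.const (s := s) (x := x) (v := v) (w x))).dirDeriv_eq hv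
  simp only [map_zero, zero_smul, add_zero] at h2
  rwa [Finset.sum_add_distrib, ← h2, ← linearMap_apply_eq_sum] at h1

end LinearFamilies

end EmbeddedGeometry

/-! ### Smoothness and derivatives of the operators. -/

namespace FixedRankPSD

section Smoothness

variable {𝕜 : Type*} [RCLike 𝕜] {n p : ℕ} {S : Amb 𝕜 n p} (hS : S ∈ stiefelPD 𝕜 n p)
  {α₀ α₁ β : ℝ} (hα₀ : 0 < α₀) (hα₁ : 0 < α₁) (hβ : 0 < β)
  {N : WithTop ℕ∞} {s : Set (Amb 𝕜 n p)}

/-! ### Smoothness of the operators -/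

theorem contDiffWithinAt_pt_fst : ContDiffWithinAt ℝ N (fun T : Amb 𝕜 n p => T.1) s S :=
  contDiffWithinAt_fst

theorem contDiffWithinAt_pt_snd : ContDiffWithinAt ℝ N (fun T : Amb 𝕜 n p => T.2) s S :=
  contDiffWithinAt_snd

theorem contDiffWithinAt_pt_ct : ContDiffWithinAt ℝ N (fun T : Amb 𝕜 n p => T.1ᴴ) s S :=
  ContDiffWithinAt.conjTranspose contDiffWithinAt_pt_fst

include hS

theorem contDiffWithinAt_pt_inv : ContDiffWithinAt ℝ N (fun T : Amb 𝕜 n p => T.2⁻¹) s S :=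
  ContDiffWithinAt.matrix_inv contDiffWithinAt_pt_snd hS.2.isUnit

theorem contDiffWithinAt_gOp {w : Amb 𝕜 n p → Amb 𝕜 n p} (hw : ContDiffWithinAt ℝ N w s S) :
    ContDiffWithinAt ℝ N (fun T => gOp α₀ α₁ β T (w T)) s S := by
  have hi := contDiffWithinAt_pt_inv (N := N) (s := s) hS
  exact ((hw.fst.const_smul α₀).add ((ContDiffWithinAt.matMul (ContDiffWithinAt.matMul
    contDiffWithinAt_pt_fst contDiffWithinAt_pt_ct) hw.fst).const_smul (α₁ - α₀))).prodMk
    ((ContDiffWithinAt.matMul (ContDiffWithinAt.matMul hi hw.snd) hi).const_smul β)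

include hα₀ hα₁ hβ in
theorem contDiffWithinAt_gInv {w : Amb 𝕜 n p → Amb 𝕜 n p} (hw : ContDiffWithinAt ℝ N w s S) :
    ContDiffWithinAt ℝ N (fun T => gInv α₀ α₁ β T (w T)) s S := by
  have _ : FiniteDimensional ℝ (Amb 𝕜 n p) := finiteDimensional_amb
  exact contDiffWithinAt_ringInverse_apply (fun u => contDiffWithinAt_gOp hS contDiffWithinAt_const)
    (bijective_gOp hS hα₀ hα₁ hβ) hw

include hα₁ hβ in
theorem contDiffWithinAt_lyapInv {B : Amb 𝕜 n p → Matrix (Fin p) (Fin p) 𝕜}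
    (hB : ContDiffWithinAt ℝ N B s S) :
    ContDiffWithinAt ℝ N (fun T => lyapInv α₁ β T.2 (B T)) s S := by
  have hi := contDiffWithinAt_pt_inv (N := N) (s := s) hS
  refine contDiffWithinAt_ringInverse_apply (A := fun T => lyap α₁ β T.2) (fun u => ?_)
    (bijective_lyap hα₁ hβ hS.2) hB
  exact contDiffWithinAt_const.add (((ContDiffWithinAt.matMul (ContDiffWithinAt.matMul
    contDiffWithinAt_pt_snd contDiffWithinAt_const) hi).add (ContDiffWithinAt.matMul
    (ContDiffWithinAt.matMul hi contDiffWithinAt_const) contDiffWithinAt_pt_snd)).const_smul β)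

include hα₁ hβ in
theorem contDiffWithinAt_calD {w : Amb 𝕜 n p → Amb 𝕜 n p} (hw : ContDiffWithinAt ℝ N w s S) :
    ContDiffWithinAt ℝ N (fun T => calD α₁ β T (w T)) s S :=
  contDiffWithinAt_lyapInv hS hα₁ hβ (ContDiffWithinAt.symm
    ((hw.snd.add (ContDiffWithinAt.matMul (ContDiffWithinAt.matMul
      contDiffWithinAt_pt_ct hw.fst) contDiffWithinAt_pt_snd)).sub
      (ContDiffWithinAt.matMul (ContDiffWithinAt.matMul contDiffWithinAt_pt_snd
        contDiffWithinAt_pt_ct) hw.fst)))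

include hα₁ hβ in
theorem contDiffWithinAt_projLin {w : Amb 𝕜 n p → Amb 𝕜 n p} (hw : ContDiffWithinAt ℝ N w s S) :
    ContDiffWithinAt ℝ N (fun T => projLin α₁ β T (w T)) s S := by
  have hi := contDiffWithinAt_pt_inv (N := N) (s := s) hS
  have hD := contDiffWithinAt_calD hS hα₁ hβ hw
  exact ((((ContDiffWithinAt.matMul contDiffWithinAt_pt_fst ((ContDiffWithinAt.matMul hi hD).sub
    (ContDiffWithinAt.matMul hD hi))).const_smul β).add hw.fst).sub
    (ContDiffWithinAt.matMul (ContDiffWithinAt.matMul contDiffWithinAt_pt_fst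
      contDiffWithinAt_pt_ct) hw.fst)).prodMk (hD.const_smul α₁)

include hα₁ hβ in
theorem contDiffWithinAt_horLift {v : Amb 𝕜 n p → Matrix (Fin n) (Fin n) 𝕜}
    (hv : ContDiffWithinAt ℝ N v s S) :
    ContDiffWithinAt ℝ N (fun T => horLift α₁ β T (v T)) s S := by
  have hi := contDiffWithinAt_pt_inv (N := N) (s := s) hS
  refine contDiffWithinAt_projLin hS hα₁ hβ (w := fun T => preLift T (v T)) ?_
  exact (ContDiffWithinAt.matMul (ContDiffWithinAt.matMul (hv.sub (ContDiffWithinAt.matMul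
    (ContDiffWithinAt.matMul contDiffWithinAt_pt_fst contDiffWithinAt_pt_ct) hv))
    contDiffWithinAt_pt_fst) hi).prodMk (ContDiffWithinAt.matMul (ContDiffWithinAt.matMul
    contDiffWithinAt_pt_ct hv) contDiffWithinAt_pt_fst)

omit hS in
theorem contDiffWithinAt_trR {m : ℕ} {f : Amb 𝕜 n p → Matrix (Fin m) (Fin m) 𝕜}
    (hf : ContDiffWithinAt ℝ N f s S) : ContDiffWithinAt ℝ N (fun T => trR (f T)) s S := by
  let L : Matrix (Fin m) (Fin m) 𝕜 →ₗ[ℝ] ℝ :=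
    { toFun := trR, map_add' := trR_add, map_smul' := trR_smul }
  exact ContDiffWithinAt.continuousLinearMap_comp (LinearMap.toContinuousLinearMap L) hf

omit hS in
theorem contDiffWithinAt_ambInner {v w : Amb 𝕜 n p → Amb 𝕜 n p} (hv : ContDiffWithinAt ℝ N v s S)
    (hw : ContDiffWithinAt ℝ N w s S) :
    ContDiffWithinAt ℝ N (fun T => ambInner (v T) (w T)) s S :=
  (contDiffWithinAt_trR (ContDiffWithinAt.matMul hv.fst
    (ContDiffWithinAt.conjTranspose hw.fst))).add
    (contDiffWithinAt_trR (ContDiffWithinAt.matMul hv.snd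
      (ContDiffWithinAt.conjTranspose hw.snd)))

omit hS in
theorem _root_.EmbeddedGeometry.HasDirDeriv.trR {m : ℕ} {f : Amb 𝕜 n p → Matrix (Fin m) (Fin m) 𝕜}
    {v : Amb 𝕜 n p} {a : Matrix (Fin m) (Fin m) 𝕜}
    (hf : HasDirDeriv s f S v a) : HasDirDeriv s (fun T => trR (f T)) S v (trR a) := by
  let L : Matrix (Fin m) (Fin m) 𝕜 →ₗ[ℝ] ℝ :=
    { toFun := FixedRankPSD.trR, map_add' := trR_add, map_smul' := trR_smul }
  exact hf.clm (LinearMap.toContinuousLinearMap L)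

omit hS in
theorem hasDirDeriv_ambInner {v w : Amb 𝕜 n p → Amb 𝕜 n p} {ξ v' w' : Amb 𝕜 n p}
    (hv : HasDirDeriv s v S ξ v') (hw : HasDirDeriv s w S ξ w') :
    HasDirDeriv s (fun T => ambInner (v T) (w T)) S ξ (ambInner v' (w S) + ambInner (v S) w') := by
  have h := (hv.fst.matMul hw.fst.conjTranspose).trR.add (hv.snd.matMul hw.snd.conjTranspose).trR
  refine h.congr_val (Eq.trans (congrArg₂ (· + ·) (trR_add _ _) (trR_add _ _)) ?_)
  simp only [ambInner]
  ring

omit hS in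
include hα₀ hα₁ hβ in
theorem isRiemannianMetric_gMet : IsRiemannianMetric (stiefelPD 𝕜 n p) (gMet α₀ α₁ β) where
  symm _ hS u _ v _ := gMet_comm hS α₀ α₁ β u v
  add_left S _ u _ v _ w _ := gMet_add_left α₀ α₁ β S u v w
  smul_left S _ c u _ v _ := gMet_smul_left α₀ α₁ β S c u v
  pos _ hS _ _ hu := gMet_pos hS hα₀ hα₁ hβ hu
  smooth _ _ hξ hη S hS := contDiffWithinAt_ambInner (hξ.smooth S hS)
    (contDiffWithinAt_gOp hS (hη.smooth S hS))

/-! ### Derivatives of the operators -/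

theorem hasDirDeriv_gOp (φ w : Amb 𝕜 n p) : HasDirDeriv s (fun T => gOp α₀ α₁ β T w) S φ
    ((α₁ - α₀) • ((φ.1 * S.1ᴴ + S.1 * φ.1ᴴ) * w.1),
      -(β • (S.2⁻¹ * φ.2 * S.2⁻¹ * w.2 * S.2⁻¹ + S.2⁻¹ * w.2 * S.2⁻¹ * φ.2 * S.2⁻¹))) := by
  have h1 := (HasDirDeriv.id (s := s) (x := S) (v := φ)).fst
  have h2 := (HasDirDeriv.id (s := s) (x := S) (v := φ)).snd.matrix_inv hS.2.isUnit
  have h := ((HasDirDeriv.const (s := s) (x := S) (v := φ) (α₀ • w.1)).add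
    (((h1.matMul h1.conjTranspose).matMul (HasDirDeriv.const w.1)).const_smul (α₁ - α₀))).prodMk
    (((h2.matMul (HasDirDeriv.const w.2)).matMul h2).const_smul β)
  refine h.congr_val (Prod.ext ?_ ?_)
  · simp only [Matrix.mul_zero, zero_add, add_zero]
  · simp only [Matrix.mul_zero, add_zero, Matrix.neg_mul, Matrix.mul_neg, Matrix.mul_assoc]
    module

theorem dg_eq (φ w : Amb 𝕜 n p) : dg α₀ α₁ β S φ w =
    ((α₁ - α₀) • ((φ.1 * S.1ᴴ + S.1 * φ.1ᴴ) * w.1),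
      -(β • (S.2⁻¹ * φ.2 * S.2⁻¹ * w.2 * S.2⁻¹ + S.2⁻¹ * w.2 * S.2⁻¹ * φ.2 * S.2⁻¹))) := by
  obtain ⟨f', hf, he⟩ := hasDirDeriv_gOp (s := Set.univ) (α₀ := α₀) (α₁ := α₁) (β := β) hS φ w
  rw [hasFDerivWithinAt_univ] at hf
  rw [← he]
  exact congrArg (fun f => f φ) hf.fderiv

theorem hasDirDeriv_gOp' (φ w : Amb 𝕜 n p) :
    HasDirDeriv s (fun T => gOp α₀ α₁ β T w) S φ (dg α₀ α₁ β S φ w) := by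
  rw [dg_eq hS]
  exact hasDirDeriv_gOp hS φ w

include hα₁ hβ in
-- The derivative exists by smoothness. Its value comes from differentiating `L(P) 𝒟 = sym(...)` and
-- solving with `L(P)⁻¹`, not from differentiating the inverse operator. The equation is used only
-- on the manifold, hence the tangent direction.
theorem hasDirDeriv_calD {ξ : Amb 𝕜 n p} (hξ : ξ ∈ tangentSpaceAt (stiefelPD 𝕜 n p) S)
    (w : Amb 𝕜 n p) :
    HasDirDeriv (stiefelPD 𝕜 n p) (fun T => calD α₁ β T w) S ξ (calDdot α₁ β S ξ w) := by
  have hd := hasDirDeriv_dirDeriv ((contDiffWithinAt_calD (N := 1) (s := stiefelPD 𝕜 n p) hS hα₁ hβ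
    (w := fun _ => w) contDiffWithinAt_const).differentiableWithinAt (by simp)) ξ
  set d := dirDeriv (stiefelPD 𝕜 n p) (fun T => calD α₁ β T w) S ξ
  suffices h : d = calDdot α₁ β S ξ w by rwa [← h]
  have h1 := (HasDirDeriv.id (s := stiefelPD 𝕜 n p) (x := S) (v := ξ)).fst
  have h2 := (HasDirDeriv.id (s := stiefelPD 𝕜 n p) (x := S) (v := ξ)).snd
  have h3 := h2.matrix_inv hS.2.isUnit
  have hc : ∀ {a b : ℕ} (c : Matrix (Fin a) (Fin b) 𝕜),
      HasDirDeriv (stiefelPD 𝕜 n p) (fun _ => c) S ξ 0 := fun c => HasDirDeriv.const c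
  have hl := (hd.const_smul (α₁ - 2 * β)).add
    ((((h2.matMul hd).matMul h3).add ((h3.matMul hd).matMul h2)).const_smul β)
  have hr := (((hc w.2).add ((h1.conjTranspose.matMul (hc w.1)).matMul h2)).sub
    ((h2.matMul h1.conjTranspose).matMul (hc w.1))).symm
  have he := hl.unique (hr.congr (fun T hT => lyap_calD hT hα₁ hβ w) hS) hξ
  rw [calDdot]
  refine (lyapInv_eq hα₁ hβ hS.2 ?_).symm
  simp only [Matrix.mul_zero, add_zero, zero_add] at he
  have e2 : (ξ.1ᴴ * w.1 * S.2 + S.1ᴴ * w.1 * ξ.2 - (ξ.2 * S.1ᴴ + S.2 * ξ.1ᴴ) * w.1) =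
      ξ.1ᴴ * w.1 * S.2 - S.2 * ξ.1ᴴ * w.1 + S.1ᴴ * w.1 * ξ.2 - ξ.2 * S.1ᴴ * w.1 := by
    rw [Matrix.add_mul]
    abel
  rw [e2] at he
  rw [← he, lyap_apply]
  simp only [Matrix.add_mul, Matrix.neg_mul, Matrix.mul_neg, Matrix.mul_assoc]
  module

include hα₁ hβ in
theorem hasDirDeriv_projLin {ξ : Amb 𝕜 n p} (hξ : ξ ∈ tangentSpaceAt (stiefelPD 𝕜 n p) S)
    (w : Amb 𝕜 n p) :
    HasDirDeriv (stiefelPD 𝕜 n p) (fun T => projLin α₁ β T w) S ξ (dprojFormula α₁ β S ξ w) := by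
  have hd := hasDirDeriv_calD hS hα₁ hβ hξ w
  have h1 := (HasDirDeriv.id (s := stiefelPD 𝕜 n p) (x := S) (v := ξ)).fst
  have h3 := (HasDirDeriv.id (s := stiefelPD 𝕜 n p) (x := S) (v := ξ)).snd.matrix_inv hS.2.isUnit
  have h := ((((h1.matMul ((h3.matMul hd).sub (hd.matMul h3))).const_smul β).add
    (HasDirDeriv.const w.1)).sub ((h1.matMul h1.conjTranspose).matMul
      (HasDirDeriv.const w.1))).prodMk (hd.const_smul α₁)
  refine h.congr_val (Prod.ext ?_ rfl)
  simp only [dprojFormula, Matrix.mul_zero, add_zero, Matrix.neg_mul,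
    Matrix.mul_neg, Matrix.mul_add, Matrix.mul_sub, Matrix.add_mul, Matrix.mul_assoc]
  module

end Smoothness

end FixedRankPSD

/-! ### The Levi-Civita connection upstairs and the Hessian formulas. -/

namespace FixedRankPSD

noncomputable section Connection

variable {𝕜 : Type*} [RCLike 𝕜] {n p : ℕ} {S : Amb 𝕜 n p} (hS : S ∈ stiefelPD 𝕜 n p)
  {α₀ α₁ β : ℝ} (hα₀ : 0 < α₀) (hα₁ : 0 < α₁) (hβ : 0 < β)

/-! ### The Christoffel metric term -/

/-- The index-raising term: `⟨xTerm S ξ η, φ⟩ = ⟨ξ, (D_φ g) η⟩`. -/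
def xTerm (α₀ α₁ β : ℝ) (S ξ η : Amb 𝕜 n p) : Amb 𝕜 n p :=
  ((α₁ - α₀) • ((ξ.1 * η.1ᴴ + η.1 * ξ.1ᴴ) * S.1),
    -(β • (S.2⁻¹ * ξ.2 * S.2⁻¹ * η.2 * S.2⁻¹ + S.2⁻¹ * η.2 * S.2⁻¹ * ξ.2 * S.2⁻¹)))

include hS in
-- Cyclicity of the trace isolates `φ`. In the `Y` part, one term also needs invariance of the real
-- trace under conjugate transposition; in the `P` part the Hermitian `η_P` and `P⁻¹` are unchanged
-- by it.
theorem ambInner_xTerm (ξ : Amb 𝕜 n p) {η : Amb 𝕜 n p} (hη : η.2ᴴ = η.2) (φ : Amb 𝕜 n p) :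
    ambInner (xTerm α₀ α₁ β S ξ η) φ = ambInner ξ (dg α₀ α₁ β S φ η) := by
  have hi : (S.2⁻¹)ᴴ = S.2⁻¹ := hS.2.inv.1
  have hneg : ∀ {m : ℕ} (A : Matrix (Fin m) (Fin m) 𝕜), trR (-A) = -trR A := fun A => by simp [trR]
  rw [dg_eq hS, ambInner, ambInner, xTerm]
  have e1 : trR (ξ.1 * (η.1ᴴ * (φ.1 * S.1ᴴ))) = trR (η.1 * (ξ.1ᴴ * (S.1 * φ.1ᴴ))) := by
    rw [← trR_conjTranspose, ← Matrix.mul_assoc ξ.1, conjTranspose_mul, trR_mul_comm]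
    simp only [conjTranspose_mul, conjTranspose_conjTranspose, Matrix.mul_assoc]
  have e2 : ∀ A : Matrix (Fin p) (Fin p) 𝕜, trR (ξ.2 * (A * S.2⁻¹)) = trR (S.2⁻¹ * (ξ.2 * A)) :=
    fun A => by rw [← Matrix.mul_assoc, trR_mul_comm]
  have e3 : trR (ξ.2 * (S.2⁻¹ * (φ.2ᴴ * (S.2⁻¹ * (η.2 * S.2⁻¹))))) =
      trR (S.2⁻¹ * (η.2 * (S.2⁻¹ * (ξ.2 * (S.2⁻¹ * φ.2ᴴ))))) := by
    rw [← Matrix.mul_assoc S.2⁻¹ φ.2ᴴ, ← Matrix.mul_assoc ξ.2, trR_mul_comm]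
    simp only [Matrix.mul_assoc]
  have e4 : trR (ξ.2 * (S.2⁻¹ * (η.2 * (S.2⁻¹ * (φ.2ᴴ * S.2⁻¹))))) =
      trR (S.2⁻¹ * (ξ.2 * (S.2⁻¹ * (η.2 * (S.2⁻¹ * φ.2ᴴ))))) := by
    have := e2 (S.2⁻¹ * (η.2 * (S.2⁻¹ * φ.2ᴴ)))
    simpa only [Matrix.mul_assoc] using this
  simp only [Matrix.conjTranspose_smul, conjTranspose_neg, star_trivial, conjTranspose_mul,
    conjTranspose_add, conjTranspose_conjTranspose, hi, hη, Matrix.smul_mul, Matrix.mul_smul,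
    Matrix.add_mul, Matrix.mul_add, Matrix.neg_mul, Matrix.mul_neg, hneg, trR_add, trR_smul,
    Matrix.mul_assoc, e1, e3, e4]

variable {ξ η φ : Amb 𝕜 n p} (hξ : ξ ∈ tangentSpaceAt (stiefelPD 𝕜 n p) S)
  (hη : η ∈ tangentSpaceAt (stiefelPD 𝕜 n p) S) (hφ : φ ∈ tangentSpaceAt (stiefelPD 𝕜 n p) S)

include hS hξ hη in
-- Tangency, in the form `Yᴴ ξ_Y = -ξ_Yᴴ Y`, rewrites `ξ_Y Yᴴ η_Y` as `-ξ_Y η_Yᴴ Y`; together with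
-- the index-raising term this makes the coefficient `2`.
theorem kFormula_eq : kFormula α₀ α₁ β S ξ η = (1 / 2 : ℝ) •
    (dg α₀ α₁ β S ξ η + dg α₀ α₁ β S η ξ - xTerm α₀ α₁ β S ξ η) := by
  have h1 := ((mem_tangentSpaceAt_stiefelPD hS).1 hξ).1
  have h2 := ((mem_tangentSpaceAt_stiefelPD hS).1 hη).1
  rw [dg_eq hS, dg_eq hS]
  refine Prod.ext ?_ ?_
  · simp only [kFormula, xTerm, Prod.smul_fst, Prod.fst_sub, Prod.fst_add, Matrix.add_mul,
      Matrix.mul_assoc, eq_neg_of_add_eq_zero_left h1, eq_neg_of_add_eq_zero_left h2,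
      Matrix.mul_neg, Matrix.mul_add]
    module
  · simp only [kFormula, xTerm, Prod.smul_snd, Prod.snd_sub, Prod.snd_add]
    module

include hS hξ hη in
theorem isChristoffelTerm_iff (κ : Amb 𝕜 n p) :
    IsChristoffelTerm α₀ α₁ β S ξ η κ ↔ κ = kFormula α₀ α₁ β S ξ η := by
  have hx := ambInner_xTerm (α₀ := α₀) (α₁ := α₁) (β := β) hS ξ
    ((mem_tangentSpaceAt_stiefelPD hS).1 hη).2
  rw [kFormula_eq hS hξ hη]
  constructor
  · rintro ⟨X, hX, rfl⟩
    rw [eq_of_forall_ambInner fun φ => (hX φ).trans (hx φ).symm]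
  · rintro rfl
    exact ⟨_, hx, rfl⟩

theorem kFormula_comm (S ξ η : Amb 𝕜 n p) :
    kFormula α₀ α₁ β S ξ η = kFormula α₀ α₁ β S η ξ := by
  simp only [kFormula]
  rw [add_comm (η.1ᴴ * ξ.1), add_comm (η.1 * ξ.1ᴴ), add_comm (S.2⁻¹ * η.2 * _ * _ * _)]

theorem kFormula_add_left (S ξ ξ' η : Amb 𝕜 n p) : kFormula α₀ α₁ β S (ξ + ξ') η =
    kFormula α₀ α₁ β S ξ η + kFormula α₀ α₁ β S ξ' η := by
  refine Prod.ext ?_ ?_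
  · simp only [kFormula, Prod.fst_add, conjTranspose_add, Matrix.mul_add, Matrix.add_mul]
    module
  · simp only [kFormula, Prod.snd_add, Matrix.mul_add, Matrix.add_mul]
    module

theorem kFormula_smul_left (S : Amb 𝕜 n p) (c : ℝ) (ξ η : Amb 𝕜 n p) :
    kFormula α₀ α₁ β S (c • ξ) η = c • kFormula α₀ α₁ β S ξ η := by
  refine Prod.ext ?_ ?_
  · simp only [kFormula, Prod.smul_fst, Matrix.conjTranspose_smul, star_trivial, Matrix.mul_add,
      Matrix.add_mul, Matrix.mul_smul, Matrix.smul_mul]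
    module
  · simp only [kFormula, Prod.smul_snd, Matrix.mul_smul, Matrix.smul_mul]
    module

theorem kFormula_add_right (S ξ η η' : Amb 𝕜 n p) : kFormula α₀ α₁ β S ξ (η + η') =
    kFormula α₀ α₁ β S ξ η + kFormula α₀ α₁ β S ξ η' := by
  rw [kFormula_comm, kFormula_add_left, kFormula_comm S η, kFormula_comm S η']

theorem kFormula_smul_right (S : Amb 𝕜 n p) (c : ℝ) (ξ η : Amb 𝕜 n p) :
    kFormula α₀ α₁ β S ξ (c • η) = c • kFormula α₀ α₁ β S ξ η := by
  rw [kFormula_comm, kFormula_smul_left, kFormula_comm]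

include hS hφ in
-- The derivative of a family of self-adjoint operators is self-adjoint. Self-adjointness is
-- available only on the manifold, so `φ` must be tangent.
theorem ambInner_dg_left (u w : Amb 𝕜 n p) :
    ambInner (dg α₀ α₁ β S φ u) w = ambInner u (dg α₀ α₁ β S φ w) := by
  have hg : ∀ w, HasDirDeriv (stiefelPD 𝕜 n p) (fun T => gOp α₀ α₁ β T w) S φ
    (dg α₀ α₁ β S φ w) := hasDirDeriv_gOp' hS φ
  have h1 := hasDirDeriv_ambInner (hg u) (HasDirDeriv.const w)
  have h2 := hasDirDeriv_ambInner (HasDirDeriv.const u) (hg w)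
  have h := h1.unique (h2.congr (fun T hT => ambInner_gOp_left hT α₀ α₁ β u w) hS) hφ
  have e : ∀ v : Amb 𝕜 n p, ambInner (0 : Amb 𝕜 n p) v = 0 := fun v => by
    simpa using ambInner_smul_left (0 : ℝ) v v
  rwa [ambInner_comm _ 0, e, e, add_zero, zero_add] at h

include hS hξ hη hφ in
-- The infinitesimal form of metric compatibility: the terms differentiating `g` along `η` and `φ`
-- cancel, and the two halves along `ξ` add up.
theorem ambInner_kFormula : ambInner (kFormula α₀ α₁ β S ξ η) φ +
    ambInner η (kFormula α₀ α₁ β S ξ φ) = ambInner η (dg α₀ α₁ β S ξ φ) := by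
  rw [kFormula_eq hS hξ hη, kFormula_eq hS hξ hφ, ambInner_smul_left, ambInner_smul_right,
    ambInner_sub_left, ambInner_sub_right, ambInner_add_left, ambInner_add_right,
    ambInner_xTerm hS ξ ((mem_tangentSpaceAt_stiefelPD hS).1 hη).2, ambInner_comm η (xTerm _ _ _ _ _ _),
    ambInner_xTerm hS ξ ((mem_tangentSpaceAt_stiefelPD hS).1 hφ).2, ambInner_dg_left hS hξ,
    ambInner_dg_left hS hη, ← ambInner_dg_left hS hφ, ambInner_comm (dg α₀ α₁ β S φ ξ)]
  ring

include hS in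
theorem contDiffWithinAt_kFormula {N : WithTop ℕ∞} {s : Set (Amb 𝕜 n p)}
    {ξ η : Amb 𝕜 n p → Amb 𝕜 n p} (hξ : ContDiffWithinAt ℝ N ξ s S)
    (hη : ContDiffWithinAt ℝ N η s S) :
    ContDiffWithinAt ℝ N (fun T => kFormula α₀ α₁ β T (ξ T) (η T)) s S := by
  have hi := contDiffWithinAt_pt_inv (N := N) (s := s) hS
  have hY : ContDiffWithinAt ℝ N (fun T : Amb 𝕜 n p => T.1) s S := contDiffWithinAt_pt_fst
  have hm : ∀ {a b c : ℕ} {f : Amb 𝕜 n p → Matrix (Fin a) (Fin b) 𝕜}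
      {g : Amb 𝕜 n p → Matrix (Fin b) (Fin c) 𝕜}, ContDiffWithinAt ℝ N f s S →
      ContDiffWithinAt ℝ N g s S → ContDiffWithinAt ℝ N (fun T => f T * g T) s S :=
    fun hf hg => ContDiffWithinAt.matMul hf hg
  have hξ1 := ContDiffWithinAt.conjTranspose hξ.fst
  have hη1 := ContDiffWithinAt.conjTranspose hη.fst
  exact (((hm hY ((hm hη1 hξ.fst).add (hm hξ1 hη.fst))).sub ((hm ((hm hη.fst hξ1).add
    (hm hξ.fst hη1)) hY).const_smul (2 : ℝ))).const_smul ((α₁ - α₀) / 2)).prodMk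
    (((hm (hm (hm (hm hi hη.snd) hi) hξ.snd) hi).add
      (hm (hm (hm (hm hi hξ.snd) hi) hη.snd) hi)).const_smul (-(β / 2)))

/-! ### The tangential projection -/

/-- The projection of the ambient space to the tangent space at `S`. -/
def tanProj (S : Amb 𝕜 n p) : Amb 𝕜 n p →ₗ[ℝ] Amb 𝕜 n p where
  toFun w := (w.1 - S.1 * FixedRankPSD.symm (S.1ᴴ * w.1), FixedRankPSD.symm w.2)
  map_add' v w := by
    refine Prod.ext ?_ ?_
    · simp only [Prod.fst_add, Matrix.mul_add, symm_add]
      abel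
    · simp only [Prod.snd_add, symm_add]
  map_smul' c w := by
    refine Prod.ext ?_ ?_
    · simp only [Prod.smul_fst, Matrix.mul_smul, symm_smul, RingHom.id_apply, smul_sub]
    · simp only [Prod.smul_snd, symm_smul, RingHom.id_apply]

theorem tanProj_apply (S w : Amb 𝕜 n p) : tanProj S w =
    (w.1 - S.1 * FixedRankPSD.symm (S.1ᴴ * w.1), FixedRankPSD.symm w.2) := rfl

include hS in
theorem tanProj_mem (w : Amb 𝕜 n p) : tanProj S w ∈ tangentSpaceAt (stiefelPD 𝕜 n p) S := by
  rw [mem_tangentSpaceAt_stiefelPD hS, tanProj_apply]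
  refine ⟨?_, conjTranspose_symm _⟩
  have e := conjTranspose_symm (S.1ᴴ * w.1)
  simp only [Matrix.mul_sub, conjTranspose_sub, conjTranspose_mul, stiefel_cancel hS.1, e,
    Matrix.sub_mul, Matrix.mul_assoc, hS.1, Matrix.mul_one]
  simp only [FixedRankPSD.symm, conjTranspose_mul, conjTranspose_conjTranspose]
  module

include hS hη in
theorem tanProj_of_mem : tanProj S η = η := by
  obtain ⟨h1, h2⟩ := (mem_tangentSpaceAt_stiefelPD hS).1 hη
  rw [tanProj_apply, symm_eq_self h2, FixedRankPSD.symm, conjTranspose_mul,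
    conjTranspose_conjTranspose, h1, smul_zero, Matrix.mul_zero, sub_zero]

include hS hφ in
-- The residual is `(Y a, k)` with `a` Hermitian and `k` skew. The operator `g` scales `Y a` by `α₁`
-- and keeps `P⁻¹ k P⁻¹` skew, so both parts are orthogonal to the skew `Yᴴ φ_Y` and the Hermitian
-- `φ_P`.
theorem gMet_tanProj (w : Amb 𝕜 n p) :
    gMet α₀ α₁ β S (tanProj S w) φ = gMet α₀ α₁ β S w φ := by
  obtain ⟨h1, h2⟩ := (mem_tangentSpaceAt_stiefelPD hS).1 hφ
  have hi : (S.2⁻¹)ᴴ = S.2⁻¹ := hS.2.inv.1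
  set a := FixedRankPSD.symm (S.1ᴴ * w.1) with ha
  set k := w.2 - FixedRankPSD.symm w.2 with hk
  have e : w - tanProj S w = (S.1 * a, k) := by
    rw [tanProj_apply]
    exact Prod.ext (by simp [ha]) rfl
  have hks : kᴴ = -k := by
    rw [hk, conjTranspose_sub, conjTranspose_symm]
    simp only [FixedRankPSD.symm]
    module
  have h0 : gMet α₀ α₁ β S (w - tanProj S w) φ = 0 := by
    rw [e, gMet, ← ambInner_gOp_left hS, gOp_apply, ambInner]
    have e1 : α₀ • (S.1 * a) + (α₁ - α₀) • (S.1 * S.1ᴴ * (S.1 * a)) = α₁ • (S.1 * a) := by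
      rw [Matrix.mul_assoc S.1, stiefel_cancel hS.1]
      module
    simp only [e1, h2, Matrix.smul_mul, trR_smul]
    rw [Matrix.mul_assoc, trR_mul_comm, Matrix.mul_assoc, trR_mul_comm, trR_mul_eq_zero,
      trR_mul_eq_zero, mul_zero, mul_zero, add_zero]
    · simp only [conjTranspose_mul, hi, hks, Matrix.mul_neg, Matrix.neg_mul, Matrix.mul_assoc]
    · exact h2
    · rw [conjTranspose_mul, conjTranspose_conjTranspose]
      exact eq_neg_of_add_eq_zero_left h1
    · exact conjTranspose_symm _
  rw [gMet_sub_left] at h0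
  linarith

theorem contDiffWithinAt_tanProj {N : WithTop ℕ∞} {s : Set (Amb 𝕜 n p)}
    {w : Amb 𝕜 n p → Amb 𝕜 n p} (hw : ContDiffWithinAt ℝ N w s S) :
    ContDiffWithinAt ℝ N (fun T => tanProj T (w T)) s S :=
  (hw.fst.sub (ContDiffWithinAt.matMul contDiffWithinAt_pt_fst (ContDiffWithinAt.symm
    (ContDiffWithinAt.matMul contDiffWithinAt_pt_ct hw.fst)))).prodMk
    (ContDiffWithinAt.symm hw.snd)

theorem isVectorField_tanProj (w : Amb 𝕜 n p) :
    IsVectorField (stiefelPD 𝕜 n p) (fun T => tanProj T w) :=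
  ⟨fun _ _ => contDiffWithinAt_tanProj contDiffWithinAt_const, fun _ hT => tanProj_mem hT w⟩

include hS hα₀ hα₁ hβ in
theorem projLin_tanProj (w : Amb 𝕜 n p) : projLin α₁ β S (tanProj S w) = projLin α₁ β S w := by
  rw [← projH_eq hS hα₀ hα₁ hβ, ← projH_eq hS hα₀ hα₁ hβ]
  have h := (projH_spec hS hα₀ hα₁ hβ w).1
  refine (projH_spec hS hα₀ hα₁ hβ _).1.unique hS hα₀ hα₁ hβ ⟨h.1, fun ζ hζ => ?_⟩
  rw [h.2 ζ hζ, gMet_tanProj hS hζ.1]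

/-! ### The Levi-Civita connection -/

/-- The Levi-Civita connection of the Stiefel × positive-definite manifold. -/
def leviCivita (α₀ α₁ β : ℝ) (ξ η : Amb 𝕜 n p → Amb 𝕜 n p) (S : Amb 𝕜 n p) : Amb 𝕜 n p :=
  tanProj S (dirDeriv (stiefelPD 𝕜 n p) η S (ξ S) +
    gInv α₀ α₁ β S (kFormula α₀ α₁ β S (ξ S) (η S)))

include hS in
-- Differentiating the tangency equation of `η` along `ξ` leaves the terms `ξ_Yᴴ η_Y + η_Yᴴ ξ_Y`.
-- They are symmetric in the two fields and cancel in the bracket.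
theorem bracket_mem_tangentSpaceAt {ξ η : Amb 𝕜 n p → Amb 𝕜 n p}
    (hξ : IsVectorField (stiefelPD 𝕜 n p) ξ) (hη : IsVectorField (stiefelPD 𝕜 n p) η) :
    dirDeriv (stiefelPD 𝕜 n p) η S (ξ S) - dirDeriv (stiefelPD 𝕜 n p) ξ S (η S) ∈
      tangentSpaceAt (stiefelPD 𝕜 n p) S := by
  have key : ∀ {ξ η : Amb 𝕜 n p → Amb 𝕜 n p}, IsVectorField (stiefelPD 𝕜 n p) ξ →
      IsVectorField (stiefelPD 𝕜 n p) η →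
      (ξ S).1ᴴ * (η S).1 + S.1ᴴ * (dirDeriv (stiefelPD 𝕜 n p) η S (ξ S)).1 +
        ((dirDeriv (stiefelPD 𝕜 n p) η S (ξ S)).1ᴴ * S.1 + (η S).1ᴴ * (ξ S).1) = 0 ∧
      (dirDeriv (stiefelPD 𝕜 n p) η S (ξ S)).2ᴴ = (dirDeriv (stiefelPD 𝕜 n p) η S (ξ S)).2 := by
    intro ξ η hξ hη
    have hd := hη.hasDirDeriv hS (ξ S)
    have hid := (HasDirDeriv.id (s := stiefelPD 𝕜 n p) (x := S) (v := ξ S)).fst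
    have ht := hξ.tangent S hS
    refine ⟨?_, ?_⟩
    · exact ((hid.conjTranspose.matMul hd.fst).add (hd.fst.conjTranspose.matMul hid)).unique
        ((HasDirDeriv.const 0).congr (fun T hT =>
          ((mem_tangentSpaceAt_stiefelPD hT).1 (hη.tangent T hT)).1) hS) ht
    · exact hd.snd.conjTranspose.unique (hd.snd.congr (fun T hT =>
        ((mem_tangentSpaceAt_stiefelPD hT).1 (hη.tangent T hT)).2) hS) ht
  obtain ⟨h1, h2⟩ := key hξ hη
  obtain ⟨h3, h4⟩ := key hη hξ
  rw [mem_tangentSpaceAt_stiefelPD hS]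
  refine ⟨?_, by rw [Prod.snd_sub, conjTranspose_sub, h2, h4]⟩
  rw [← sub_eq_zero_of_eq (h1.trans h3.symm)]
  simp only [Prod.fst_sub, conjTranspose_sub, Matrix.mul_sub, Matrix.sub_mul]
  abel

include hα₀ hα₁ hβ in
-- For compatibility the projections are dropped against tangent vectors, and `ambInner_kFormula`
-- supplies the derivative of the metric. Torsion vanishes because `K` is symmetric and the bracket
-- is already tangent.
theorem isLeviCivita_leviCivita :
    IsLeviCivita (stiefelPD 𝕜 n p) (gMet α₀ α₁ β) (leviCivita α₀ α₁ β) where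
  isVectorField ξ η hξ hη := by
    refine ⟨fun S hS => contDiffWithinAt_tanProj ?_, fun S hS => tanProj_mem hS _⟩
    exact (contDiffOn_dirDeriv hasLocalRetractions_stiefelPD hη.smooth hξ S hS).add
      (contDiffWithinAt_gInv hS hα₀ hα₁ hβ
        (contDiffWithinAt_kFormula hS (hξ.smooth S hS) (hη.smooth S hS)))
  congr ξ ξ' η η' _ _ _ _ h h' S hS := by
    rw [leviCivita, leviCivita, h hS, h' hS, dirDeriv_congr h' hS]
  add_left ξ ξ' η _ _ _ S _ := by
    simp only [leviCivita, dirDeriv_add_right, kFormula_add_left, map_add]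
    abel
  smul_left f ξ η _ _ _ S _ := by
    simp only [leviCivita, dirDeriv_smul_right, kFormula_smul_left, map_smul, map_add, smul_add]
  add_right ξ η η' hξ hη hη' S hS := by
    have h := ((hη.hasDirDeriv hS (ξ S)).add (hη'.hasDirDeriv hS (ξ S))).dirDeriv_eq
      (hξ.tangent S hS)
    simp only [leviCivita, h, kFormula_add_right, map_add]
    abel
  leibniz f ξ η hf hξ hη S hS := by
    have h := ((ContDiffOn.hasDirDeriv hf hS (ξ S)).smul (hη.hasDirDeriv hS (ξ S))).dirDeriv_eq
      (hξ.tangent S hS)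
    simp only [leviCivita, h, kFormula_smul_right, map_add, map_smul,
      tanProj_of_mem hS (hη.tangent S hS), smul_add]
    abel
  metric_compat ξ η φ hξ hη hφ S hS := by
    have _ : FiniteDimensional ℝ (Amb 𝕜 n p) := finiteDimensional_amb
    have ht := hξ.tangent S hS
    have h1 := HasDirDeriv.linearMap_apply (A := gOp α₀ α₁ β) (fun u =>
      (contDiffWithinAt_gOp (N := 1) hS contDiffWithinAt_const).differentiableWithinAt (by simp))
      (hφ.hasDirDeriv hS (ξ S)) ht
    rw [(hasDirDeriv_gOp' hS (ξ S) (φ S)).dirDeriv_eq ht] at h1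
    have h2 := (hasDirDeriv_ambInner (hη.hasDirDeriv hS (ξ S)) h1).dirDeriv_eq ht
    have h3 := ambInner_kFormula (α₀ := α₀) (α₁ := α₁) (β := β) hS ht (hη.tangent S hS)
      (hφ.tangent S hS)
    refine h2.trans ?_
    rw [leviCivita, leviCivita, gMet_tanProj hS (hφ.tangent S hS),
      gMet_comm hS α₀ α₁ β (η S), gMet_tanProj hS (hη.tangent S hS), gMet_add_left, gMet_add_left,
      gMet_gInv hS hα₀ hα₁ hβ, gMet_gInv hS hα₀ hα₁ hβ, gMet_comm hS α₀ α₁ β _ (η S), gMet, gMet,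
      ambInner_add_right, ambInner_comm (kFormula α₀ α₁ β S (ξ S) (φ S)), ← h3]
    ring
  torsion_free ξ η hξ hη S hS := by
    rw [leviCivita, leviCivita, kFormula_comm S (η S), ← map_sub, add_sub_add_right_eq_sub,
      tanProj_of_mem hS (bracket_mem_tangentSpaceAt hS hξ hη)]

/-! ### The horizontal part of the connection -/

variable {u v : Amb 𝕜 n p → Amb 𝕜 n p}

include hS hα₀ hα₁ hβ in
theorem dirDeriv_projH (w : Amb 𝕜 n p) (ξ : Amb 𝕜 n p) :
    dirDeriv (stiefelPD 𝕜 n p) (fun T => projH α₀ α₁ β T w) S ξ =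
      dirDeriv (stiefelPD 𝕜 n p) (fun T => projLin α₁ β T w) S ξ :=
  dirDeriv_congr (fun _ hT => projH_eq hT hα₀ hα₁ hβ w) hS ξ

include hS hα₀ hα₁ hβ in
theorem projLin_idem (w : Amb 𝕜 n p) :
    projLin α₁ β S (projLin α₁ β S w) = projLin α₁ β S w :=
  projLin_of_mem hS hα₀ hα₁ hβ (projFormula_mem hS hα₁ hβ w)

include hS hα₁ hβ in
theorem differentiableWithinAt_projLin (w : Amb 𝕜 n p) :
    DifferentiableWithinAt ℝ (fun T => projLin α₁ β T w) (stiefelPD 𝕜 n p) S :=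
  (contDiffWithinAt_projLin (N := 1) (w := fun _ => w) hS hα₁ hβ
    contDiffWithinAt_const).differentiableWithinAt (by simp)

include hS hα₀ hα₁ hβ in
theorem differentiableWithinAt_gInv (w : Amb 𝕜 n p) :
    DifferentiableWithinAt ℝ (fun T => gInv α₀ α₁ β T w) (stiefelPD 𝕜 n p) S :=
  (contDiffWithinAt_gInv (N := 1) (w := fun _ => w) hS hα₀ hα₁ hβ
    contDiffWithinAt_const).differentiableWithinAt (by simp)

include hS hα₀ hα₁ hβ in
-- Differentiating `v = Π_H v` gives `D v = (D Π_H) v + Π_H D v`. Hence the first two terms of the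
-- formula are `Π_H D v`.
theorem connFormula_eq (hu : u S ∈ tangentSpaceAt (stiefelPD 𝕜 n p) S)
    (hv : IsHorizontalField α₀ α₁ β v) : connFormula α₀ α₁ β u v S =
      projLin α₁ β S (dirDeriv (stiefelPD 𝕜 n p) v S (u S) +
        gInv α₀ α₁ β S (kFormula α₀ α₁ β S (u S) (v S))) := by
  have _ : FiniteDimensional ℝ (Amb 𝕜 n p) := finiteDimensional_amb
  have h := (HasDirDeriv.linearMap_apply (A := projLin α₁ β)
    (differentiableWithinAt_projLin hS hα₁ hβ) (hv.1.hasDirDeriv hS (u S)) hu).congr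
    (fun T hT => (projLin_of_mem hT hα₀ hα₁ hβ (hv.2 T hT)).symm) hS
  rw [connFormula, projH_eq hS hα₀ hα₁ hβ, dirDeriv_projH hS hα₀ hα₁ hβ, map_add,
    (hv.1.hasDirDeriv hS (u S)).unique h hu, map_add, projLin_idem hS hα₀ hα₁ hβ]
  have h2 := h.dirDeriv_eq hu
  have h3 : projLin α₁ β S (dirDeriv (stiefelPD 𝕜 n p) (fun T => projLin α₁ β T (v S)) S (u S)) = 0 := by
    have := congrArg (projLin α₁ β S) h2
    rw [map_add, projLin_idem hS hα₀ hα₁ hβ] at this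
    simpa using this
  rw [h3]
  abel

include hS hα₀ hα₁ hβ in
-- Uniqueness replaces `nabla` by the explicit connection, with constant vectors projected to the
-- tangent spaces as the extending fields. Horizontal projection absorbs the tangential one.
theorem projH_nabla {nabla} (hn : IsLeviCivita (stiefelPD 𝕜 n p) (gMet α₀ α₁ β) nabla)
    (hu : IsVectorField (stiefelPD 𝕜 n p) u) (hv : IsHorizontalField α₀ α₁ β v) :
    projH α₀ α₁ β S (nabla u v S) = connFormula α₀ α₁ β u v S := by
  rw [hn.eq_of_extends (isLeviCivita_leviCivita hα₀ hα₁ hβ) (isRiemannianMetric_gMet hα₀ hα₁ hβ)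
    (fun w hw => ⟨_, isVectorField_tanProj w, tanProj_of_mem hS hw⟩) hu hv.1 hS,
    projH_eq hS hα₀ hα₁ hβ, leviCivita, projLin_tanProj hS hα₀ hα₁ hβ,
    connFormula_eq hS hα₀ hα₁ hβ (hu.tangent S hS) hv]

/-! ### The Hessian -/

variable {F : Amb 𝕜 n p → Amb 𝕜 n p}

include hα₀ hα₁ hβ in
theorem isHorizontalField_grad (hF : ContDiffOn ℝ ∞ F (stiefelPD 𝕜 n p)) :
    IsHorizontalField α₀ α₁ β (fun T => projLin α₁ β T (gInv α₀ α₁ β T (F T))) := by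
  have hm : ∀ T ∈ stiefelPD 𝕜 n p, projLin α₁ β T (gInv α₀ α₁ β T (F T)) ∈
    horizontal α₀ α₁ β T := fun T hT => projFormula_mem hT hα₁ hβ _
  exact ⟨⟨fun T hT => contDiffWithinAt_projLin hT hα₁ hβ
    (contDiffWithinAt_gInv hT hα₀ hα₁ hβ (hF T hT)), fun T hT => (hm T hT).1⟩, hm⟩

include hS hα₀ hα₁ hβ in
-- The product rule for the family `Π_H g⁻¹` applied to `F`. Idempotence of `Π_H` and `g⁻¹ g = 1`
-- match the terms.
theorem connFormula_grad (hu : u S ∈ tangentSpaceAt (stiefelPD 𝕜 n p) S)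
    (hF : ContDiffOn ℝ ∞ F (stiefelPD 𝕜 n p)) :
    connFormula α₀ α₁ β u (fun T => projLin α₁ β T (gInv α₀ α₁ β T (F T))) S =
      hessFormula₁ α₀ α₁ β F S (u S) := by
  have _ : FiniteDimensional ℝ (Amb 𝕜 n p) := finiteDimensional_amb
  have h := HasDirDeriv.linearMap_apply (A := fun T => projLin α₁ β T ∘ₗ gInv α₀ α₁ β T)
    (fun w => (contDiffWithinAt_projLin (N := 1) hS hα₁ hβ (contDiffWithinAt_gInv hS hα₀ hα₁ hβ
      (w := fun _ => w) contDiffWithinAt_const)).differentiableWithinAt (by simp))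
    (ContDiffOn.hasDirDeriv hF hS (u S)) hu
  simp only [LinearMap.comp_apply] at h
  have e : dirDeriv (stiefelPD 𝕜 n p) (fun T => projH α₀ α₁ β T (gInv α₀ α₁ β T (F S))) S (u S) =
      dirDeriv (stiefelPD 𝕜 n p) (fun T => projLin α₁ β T (gInv α₀ α₁ β T (F S))) S (u S) :=
    dirDeriv_congr (fun _ hT => projH_eq hT hα₀ hα₁ hβ _) hS _
  rw [connFormula_eq hS hα₀ hα₁ hβ hu (isHorizontalField_grad hα₀ hα₁ hβ hF), h.dirDeriv_eq hu,
    hessFormula₁, e, projH_eq hS hα₀ hα₁ hβ, projH_eq hS hα₀ hα₁ hβ]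
  simp only [map_add, projLin_idem hS hα₀ hα₁ hβ, gInv_gOp hS hα₀ hα₁ hβ]
  abel

include hS hα₀ hα₁ hβ hξ in
-- Obtained by differentiating `g g⁻¹ w = w` along the manifold.
theorem dirDeriv_gInv (w : Amb 𝕜 n p) :
    dirDeriv (stiefelPD 𝕜 n p) (fun T => gInv α₀ α₁ β T w) S ξ =
      -gInv α₀ α₁ β S (dg α₀ α₁ β S ξ (gInv α₀ α₁ β S w)) := by
  have _ : FiniteDimensional ℝ (Amb 𝕜 n p) := finiteDimensional_amb
  have h := (HasDirDeriv.linearMap_apply (A := gOp α₀ α₁ β) (fun u =>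
      (contDiffWithinAt_gOp (N := 1) hS contDiffWithinAt_const).differentiableWithinAt (by simp))
      (hasDirDeriv_dirDeriv (differentiableWithinAt_gInv hS hα₀ hα₁ hβ w) ξ) hξ).unique
    ((HasDirDeriv.const w).congr (fun T hT => gOp_gInv hT hα₀ hα₁ hβ w) hS) hξ
  rw [(hasDirDeriv_gOp' hS ξ _).dirDeriv_eq hξ] at h
  rw [← map_neg, ← eq_neg_of_add_eq_zero_right h, gInv_gOp hS hα₀ hα₁ hβ]

include hS hα₀ hα₁ hβ hξ in
theorem hessFormula_eq (F : Amb 𝕜 n p → Amb 𝕜 n p) :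
    hessFormula₁ α₀ α₁ β F S ξ = hessFormula₂ α₀ α₁ β F S ξ := by
  have _ : FiniteDimensional ℝ (Amb 𝕜 n p) := finiteDimensional_amb
  have h := (HasDirDeriv.linearMap_apply (A := projLin α₁ β)
    (differentiableWithinAt_projLin hS hα₁ hβ)
    (hasDirDeriv_dirDeriv (differentiableWithinAt_gInv hS hα₀ hα₁ hβ (F S)) ξ) hξ).dirDeriv_eq hξ
  have e : dirDeriv (stiefelPD 𝕜 n p) (fun T => projH α₀ α₁ β T (gInv α₀ α₁ β T (F S))) S ξ =
      dirDeriv (stiefelPD 𝕜 n p) (fun T => projLin α₁ β T (gInv α₀ α₁ β T (F S))) S ξ :=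
    dirDeriv_congr (fun _ hT => projH_eq hT hα₀ hα₁ hβ _) hS _
  rw [hessFormula₁, hessFormula₂, e, h, dirDeriv_projH hS hα₀ hα₁ hβ,
    dirDeriv_gInv hS hα₀ hα₁ hβ hξ, projH_eq hS hα₀ hα₁ hβ, projH_eq hS hα₀ hα₁ hβ,
    projH_eq hS hα₀ hα₁ hβ]
  simp only [map_add, map_sub, map_neg, projLin_idem hS hα₀ hα₁ hβ, gInv_gOp hS hα₀ hα₁ hβ]
  abel

end Connection

end FixedRankPSD

/-! ### The quotient metric, its connection, gradient and Hessian. -/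

namespace FixedRankPSD

noncomputable section Quotient

variable {𝕜 : Type*} [RCLike 𝕜] {n p : ℕ} {S : Amb 𝕜 n p} (hS : S ∈ stiefelPD 𝕜 n p)
  {α₀ α₁ β : ℝ} (hα₀ : 0 < α₀) (hα₁ : 0 < α₁) (hβ : 0 < β)

/-! ### The quotient map and the vector fields of the quotient -/

theorem mapsTo_proj : Set.MapsTo proj (stiefelPD 𝕜 n p) (psdRank 𝕜 n p) := fun _ hS => proj_mem hS

theorem contDiffOn_proj : ContDiffOn ℝ ∞ proj (stiefelPD 𝕜 n p) :=
  (contDiff_proj.of_le le_top).contDiffOn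

theorem exists_section_psdRank (X : Matrix (Fin n) (Fin n) 𝕜) (hX : X ∈ psdRank 𝕜 n p) :
    ∃ σ : Matrix (Fin n) (Fin n) 𝕜 → Amb 𝕜 n p, ContDiffAt ℝ ω σ X ∧
      (∀ᶠ Z in 𝓝 X, σ Z ∈ stiefelPD 𝕜 n p) ∧ ∀ᶠ Z in 𝓝[psdRank 𝕜 n p] X, proj (σ Z) = Z := by
  obtain ⟨S, hS, rfl⟩ := exists_proj_eq hX
  obtain ⟨σ, h1, -, h3, h4⟩ := exists_section_proj hS
  refine ⟨σ, h1, h3, ?_⟩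
  filter_upwards [nhdsWithin_le_nhds h3, eventually_mem_nhdsWithin] with Z ha hb
  exact h4 Z hb ha

theorem contDiffOn_psdRank_iff (f : Matrix (Fin n) (Fin n) 𝕜 → ℝ) :
    ContDiffOn ℝ ∞ f (psdRank 𝕜 n p) ↔
      ContDiffOn ℝ ∞ (fun S => f (proj S)) (stiefelPD 𝕜 n p) :=
  ⟨fun hf => hf.comp contDiffOn_proj mapsTo_proj, contDiffOn_of_section exists_section_psdRank⟩

/-- This is the velocity of the congruences `(1 + t A) X (1 + t A)ᴴ`, which preserve positivity, and
also the rank while `1 + t A` is invertible. It makes `X ↦ A X + X Aᴴ` a vector field on the whole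
base. -/
theorem mem_tangentSpaceAt_psdRank {X : Matrix (Fin n) (Fin n) 𝕜} (hX : X ∈ psdRank 𝕜 n p)
    (A : Matrix (Fin n) (Fin n) 𝕜) : A * X + X * Aᴴ ∈ tangentSpaceAt (psdRank 𝕜 n p) X := by
  set c : ℝ → Matrix (Fin n) (Fin n) 𝕜 := fun t => X + (t • (A * X + X * Aᴴ) +
    (t * t) • (A * X * Aᴴ)) with hc
  have hc' : ∀ t, c t = (1 + t • A) * X * (1 + t • A)ᴴ := by
    intro t
    simp only [hc, conjTranspose_add, conjTranspose_one, Matrix.conjTranspose_smul, star_trivial,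
      Matrix.add_mul, Matrix.mul_add, Matrix.one_mul, Matrix.mul_one, Matrix.smul_mul,
      Matrix.mul_smul]
    module
  have hcs : ContDiff ℝ ∞ c := contDiff_const.add ((contDiff_id.smul contDiff_const).add
    ((contDiff_id.mul contDiff_id).smul contDiff_const))
  refine mem_tangentSpaceAt_of_curve (c := c) (Eventually.of_forall fun t => hcs.contDiffAt) ?_
    (by simp [hc]) ?_
  · have hcont : ContinuousAt (fun t : ℝ => (1 : Matrix (Fin n) (Fin n) 𝕜) + t • A) 0 :=
      continuousAt_const.add (continuousAt_id.smul continuousAt_const)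
    have h1 : IsUnit ((1 : Matrix (Fin n) (Fin n) 𝕜) + (0 : ℝ) • A) := by
      rw [zero_smul, add_zero]
      exact isUnit_one
    filter_upwards [hcont.eventually (eventually_isUnit h1)] with t ht
    rw [hc']
    refine ⟨hX.1.mul_mul_conjTranspose_same _, ?_⟩
    rw [Matrix.rank_mul_eq_left_of_isUnit_det, Matrix.rank_mul_eq_right_of_isUnit_det, hX.2]
    · exact (Matrix.isUnit_iff_isUnit_det _).1 ht
    · exact (Matrix.isUnit_iff_isUnit_det _).1 ((Matrix.isUnit_conjTranspose _).2 ht)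
  · have h1 := ((hasDerivAt_id (0 : ℝ)).smul_const (A * X + X * Aᴴ)).add
      (((hasDerivAt_id (0 : ℝ)).mul (hasDerivAt_id (0 : ℝ))).smul_const (A * X * Aᴴ))
    exact HasDerivAt.congr_deriv (h1.const_add X) (by simp)

theorem exists_isVectorField_psdRank (X : Matrix (Fin n) (Fin n) 𝕜) (hX : X ∈ psdRank 𝕜 n p)
    (v : Matrix (Fin n) (Fin n) 𝕜) (hv : v ∈ tangentSpaceAt (psdRank 𝕜 n p) X) :
    ∃ u, IsVectorField (psdRank 𝕜 n p) u ∧ u X = v := by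
  obtain ⟨S, hS, rfl⟩ := exists_proj_eq hX
  obtain ⟨η, hη, rfl⟩ := exists_dproj_eq hS hv
  have h2 := ((mem_tangentSpaceAt_stiefelPD hS).1 hη).2
  set B := (η.1 * S.2 + (1 / 2 : ℝ) • (S.1 * η.2)) * S.1ᴴ with hB
  -- Chosen so that `A * proj S = B`, where `B` is half of the tangent vector: `B + Bᴴ = dproj S η`.
  -- The factor `1 / 2` shares the Hermitian `P` part between the two summands.
  set A := (η.1 * S.2 + (1 / 2 : ℝ) • (S.1 * η.2)) * S.2⁻¹ * S.1ᴴ with hA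
  have e1 : A * proj S = B := by
    simp only [hA, hB, proj, Matrix.mul_assoc, stiefel_cancel hS.1, PosDef_inv_mul_cancel hS.2]
  have e2 : proj S * Aᴴ = Bᴴ := by
    have h := (proj_mem hS).1.1.eq
    rw [← e1, conjTranspose_mul A, h]
  refine ⟨fun X => A * X + X * Aᴴ, ⟨fun X _ => ?_, fun X hX => mem_tangentSpaceAt_psdRank hX A⟩, ?_⟩
  · exact (ContDiffWithinAt.matMul contDiffWithinAt_const contDiffWithinAt_id).add
      (ContDiffWithinAt.matMul contDiffWithinAt_id contDiffWithinAt_const)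
  · simp only [e1, e2, dproj_eq]
    simp only [hB, conjTranspose_mul, conjTranspose_add, Matrix.conjTranspose_smul, star_trivial,
      conjTranspose_conjTranspose, h2, hS.2.1.eq, Matrix.add_mul, Matrix.smul_mul,
      Matrix.mul_assoc]
    module

/-! ### The quotient metric -/

open Classical in
/-- A point of the fiber of `proj` over `X`. -/
def fiberPoint (p : ℕ) (X : Matrix (Fin n) (Fin n) 𝕜) : Amb 𝕜 n p :=
  if h : ∃ S ∈ stiefelPD 𝕜 n p, proj S = X then h.choose else 0

theorem fiberPoint_spec {X : Matrix (Fin n) (Fin n) 𝕜} (hX : X ∈ psdRank 𝕜 n p) :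
    fiberPoint p X ∈ stiefelPD 𝕜 n p ∧ proj (fiberPoint p X) = X := by
  have h : ∃ S ∈ stiefelPD 𝕜 n p, proj S = X := exists_proj_eq hX
  rw [fiberPoint, dif_pos h]
  exact h.choose_spec

/-- The metric of the quotient, for which the horizontal lifts are isometries. -/
def quotMetric (p : ℕ) (α₀ α₁ β : ℝ) (X u v : Matrix (Fin n) (Fin n) 𝕜) : ℝ :=
  gMet α₀ α₁ β (fiberPoint p X) (horLift α₁ β (fiberPoint p X) u)
    (horLift α₁ β (fiberPoint p X) v)

include hS hα₁ hβ in
theorem quotMetric_proj {u v : Matrix (Fin n) (Fin n) 𝕜}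
    (hu : u ∈ tangentSpaceAt (psdRank 𝕜 n p) (proj S))
    (hv : v ∈ tangentSpaceAt (psdRank 𝕜 n p) (proj S)) :
    quotMetric p α₀ α₁ β (proj S) u v =
      gMet α₀ α₁ β S (horLift α₁ β S u) (horLift α₁ β S v) := by
  have h := fiberPoint_spec (proj_mem hS)
  exact (gMet_horLift_eq hS hα₁ hβ h.1 h.2.symm hu hv).symm

include hS hα₁ hβ in
theorem quotMetric_dproj {η ζ : Amb 𝕜 n p} (hη : η ∈ horizontal α₀ α₁ β S)
    (hζ : ζ ∈ horizontal α₀ α₁ β S) :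
    quotMetric p α₀ α₁ β (proj S) (dproj S η) (dproj S ζ) = gMet α₀ α₁ β S η ζ := by
  rw [quotMetric_proj hS hα₁ hβ (dproj_mem_tangentSpaceAt hη.1) (dproj_mem_tangentSpaceAt hζ.1),
    ← eq_horLift hS hα₁ hβ hη, ← eq_horLift hS hα₁ hβ hζ]

include hα₁ hβ in
theorem isHorizontalField_horLift {u : Matrix (Fin n) (Fin n) 𝕜 → Matrix (Fin n) (Fin n) 𝕜}
    (hu : IsVectorField (psdRank 𝕜 n p) u) :
    IsHorizontalField (n := n) (p := p) α₀ α₁ β (fun S => horLift α₁ β S (u (proj S))) :=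
  have hm : ∀ S ∈ stiefelPD 𝕜 n p, horLift α₁ β S (u (proj S)) ∈ horizontal α₀ α₁ β S :=
    fun _ hS => horLift_mem hS hα₁ hβ _
  ⟨⟨fun S hS => contDiffWithinAt_horLift hS hα₁ hβ
    (hu.smooth.comp contDiffOn_proj mapsTo_proj S hS), fun S hS => (hm S hS).1⟩, hm⟩

include hα₁ hβ in
theorem isHorizontalLift_horLift {u : Matrix (Fin n) (Fin n) 𝕜 → Matrix (Fin n) (Fin n) 𝕜}
    (hu : IsVectorField (psdRank 𝕜 n p) u) :
    IsHorizontalLift (n := n) (p := p) α₀ α₁ β u (fun S => horLift α₁ β S (u (proj S))) :=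
  fun _ hS => ⟨horLift_mem hS hα₁ hβ _,
    dproj_horLift hS hα₁ hβ (hu.tangent _ (proj_mem hS))⟩

include hα₁ hβ in
theorem IsHorizontalLift.eqOn {u : Matrix (Fin n) (Fin n) 𝕜 → Matrix (Fin n) (Fin n) 𝕜}
    {ξ : Amb 𝕜 n p → Amb 𝕜 n p} (hξ : IsHorizontalLift α₀ α₁ β u ξ) :
    Set.EqOn ξ (fun S => horLift α₁ β S (u (proj S))) (stiefelPD 𝕜 n p) := by
  intro S hS
  obtain ⟨h1, h2⟩ := hξ S hS
  simp only [← h2]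
  exact eq_horLift hS hα₁ hβ h1

include hα₀ hα₁ hβ in
theorem isRiemannianMetric_quotMetric :
    IsRiemannianMetric (psdRank 𝕜 n p) (quotMetric p α₀ α₁ β) where
  symm X hX u _ v _ := gMet_comm (fiberPoint_spec hX).1 α₀ α₁ β _ _
  add_left X _ u _ v _ w _ := by
    rw [quotMetric, map_add, gMet_add_left]
    rfl
  smul_left X _ c u _ v _ := by
    rw [quotMetric, map_smul, gMet_smul_left]
    rfl
  pos X hX u hu hne := by
    obtain ⟨h1, h2⟩ := fiberPoint_spec hX
    refine gMet_pos h1 hα₀ hα₁ hβ fun h0 => hne ?_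
    rw [← h2] at hu
    rw [← dproj_horLift h1 hα₁ hβ hu, h0, dproj_eq]
    simp
  smooth u v hu hv := by
    -- The fiber points are not chosen smoothly. Pulled back to the total space, however, the
    -- function is the metric of two smooth lifts, and smoothness descends along the local sections.
    refine contDiffOn_of_section exists_section_psdRank
      (((isRiemannianMetric_gMet hα₀ hα₁ hβ).smooth _ _ (isHorizontalField_horLift
        (α₀ := α₀) hα₁ hβ hu).1 (isHorizontalField_horLift (α₀ := α₀) hα₁ hβ hv).1).congr ?_)
    intro S hS
    exact quotMetric_proj hS hα₁ hβ (hu.tangent _ (proj_mem hS)) (hv.tangent _ (proj_mem hS))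

include hα₀ hα₁ hβ in
theorem isRiemannianSubmersion_proj : IsRiemannianSubmersion (stiefelPD 𝕜 n p) (psdRank 𝕜 n p)
    (gMet α₀ α₁ β) (quotMetric p α₀ α₁ β) proj (horizontal α₀ α₁ β)
    (fun S w => projLin α₁ β S w) (horLift α₁ β) where
  contDiff := contDiff_proj.of_le le_top
  mapsTo := mapsTo_proj
  exists_section := exists_section_psdRank
  metric := isRiemannianMetric_gMet hα₀ hα₁ hβ
  metric_base := isRiemannianMetric_quotMetric hα₀ hα₁ hβ
  tangent _ _ _ hη := hη.1
  proj_mem _ hS w := projFormula_mem hS hα₁ hβ w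
  proj_orth _ hS w _ _ hζ := gMet_projFormula hS hα₁ hβ w hζ
  fderiv_proj _ hS _ hw := dproj_projFormula hS hα₁ hβ hw
  lift_mem _ hS v _ := horLift_mem hS hα₁ hβ v
  fderiv_lift _ hS _ hv := dproj_horLift hS hα₁ hβ hv
  lift_smooth _ hu := (isHorizontalField_horLift (α₀ := α₀) hα₁ hβ hu).1.smooth
  isometry _ hS _ hη _ hζ := quotMetric_dproj hS hα₁ hβ hη hζ
  extends_base := exists_isVectorField_psdRank

/-! ### The connection of the quotient -/

variable {nablaB : (Matrix (Fin n) (Fin n) 𝕜 → Matrix (Fin n) (Fin n) 𝕜) →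
    (Matrix (Fin n) (Fin n) 𝕜 → Matrix (Fin n) (Fin n) 𝕜) →
    Matrix (Fin n) (Fin n) 𝕜 → Matrix (Fin n) (Fin n) 𝕜}
  (hB : IsLeviCivita (psdRank 𝕜 n p) (quotMetric p α₀ α₁ β) nablaB)
  {u v : Matrix (Fin n) (Fin n) 𝕜 → Matrix (Fin n) (Fin n) 𝕜}
  (hu : IsVectorField (psdRank 𝕜 n p) u) (hv : IsVectorField (psdRank 𝕜 n p) v)
  {ξ η : Amb 𝕜 n p → Amb 𝕜 n p}

include hα₀ hα₁ hβ hB hu hv in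
theorem isHorizontalLift_connFormula (hξ : IsHorizontalLift α₀ α₁ β u ξ)
    (hη : IsHorizontalLift α₀ α₁ β v η) :
    IsHorizontalLift α₀ α₁ β (nablaB u v) (connFormula α₀ α₁ β ξ η) := by
  intro S hS
  have h1 := hξ.eqOn hα₁ hβ
  have h2 := hη.eqOn hα₁ hβ
  have hu' := isHorizontalField_horLift (p := p) (α₀ := α₀) hα₁ hβ hu
  have hv' := isHorizontalField_horLift (p := p) (α₀ := α₀) hα₁ hβ hv
  -- `IsHorizontalLift` does not assume smoothness. The formula depends only on values on the
  -- manifold, where `ξ` and `η` agree with the smooth canonical lifts.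
  have e : connFormula α₀ α₁ β ξ η S = connFormula α₀ α₁ β (fun S => horLift α₁ β S (u (proj S)))
      (fun S => horLift α₁ β S (v (proj S))) S := by
    rw [connFormula, connFormula, dirDeriv_congr h2 hS, h1 hS, h2 hS]
  rw [e]
  refine ⟨?_, ?_⟩
  · rw [connFormula_eq hS hα₀ hα₁ hβ (hu'.1.tangent S hS) hv']
    exact projFormula_mem hS hα₁ hβ _
  · have hn := isLeviCivita_leviCivita (𝕜 := 𝕜) (n := n) (p := p) hα₀ hα₁ hβ
    rw [← projH_nabla hS hα₀ hα₁ hβ hn hu'.1 hv', projH_eq hS hα₀ hα₁ hβ]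
    exact (isRiemannianSubmersion_proj hα₀ hα₁ hβ).fderiv_proj_nabla hn hu hv hS hB

/-! ### The gradient and the Hessian -/

variable {f : Matrix (Fin n) (Fin n) 𝕜 → ℝ} (hf : ContDiffOn ℝ ∞ f (psdRank 𝕜 n p))
  {F : Amb 𝕜 n p → Amb 𝕜 n p} (hF : IsAmbientGradient (fun S => f (proj S)) F)

/-- The Riemannian gradient on the quotient of the function with ambient gradient `F`. -/
def quotGrad (α₀ α₁ β : ℝ) (F : Amb 𝕜 n p → Amb 𝕜 n p) (X : Matrix (Fin n) (Fin n) 𝕜) :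
    Matrix (Fin n) (Fin n) 𝕜 :=
  dproj (fiberPoint p X) (projLin α₁ β (fiberPoint p X)
    (gInv α₀ α₁ β (fiberPoint p X) (F (fiberPoint p X))))

include hS hα₀ hα₁ hβ hf hF in
-- Against a horizontal `ζ` the projection drops out and `g⁻¹` turns the metric into the trace
-- product. The ambient gradient property and the chain rule for `f ∘ proj` then give the derivative
-- of `f`.
theorem quotMetric_grad {w : Matrix (Fin n) (Fin n) 𝕜}
    (hw : w ∈ tangentSpaceAt (psdRank 𝕜 n p) (proj S)) :
    quotMetric p α₀ α₁ β (proj S) (dproj S (projLin α₁ β S (gInv α₀ α₁ β S (F S)))) w =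
      dirDeriv (psdRank 𝕜 n p) f (proj S) w := by
  obtain ⟨ζ, hζ, rfl⟩ := (bijOn_dproj (α₀ := α₀) hS hα₁ hβ).surjOn hw
  have h1 := gMet_projFormula hS hα₁ hβ (gInv α₀ α₁ β S (F S)) hζ
  rw [projLin_apply, quotMetric_dproj hS hα₁ hβ (projFormula_mem hS hα₁ hβ _) hζ, h1, gMet_gInv hS hα₀ hα₁ hβ, ambInner_comm, hF.2 S hS ζ hζ.1]
  exact ((ContDiffOn.hasDirDeriv hf (proj_mem hS) _).comp (hasDirDeriv_proj' _ S ζ)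
    mapsTo_proj).dirDeriv_eq hζ.1

include hS hα₀ hα₁ hβ hf hF in
-- At every point of a fiber the projected vector represents the same differential of `f`, so by
-- nondegeneracy it does not depend on that point.
theorem quotGrad_proj : quotGrad α₀ α₁ β F (proj S) =
    dproj S (projLin α₁ β S (gInv α₀ α₁ β S (F S))) := by
  obtain ⟨h1, h2⟩ := fiberPoint_spec (proj_mem hS)
  have hm : ∀ {T : Amb 𝕜 n p}, T ∈ stiefelPD 𝕜 n p →
      dproj T (projLin α₁ β T (gInv α₀ α₁ β T (F T))) ∈
        tangentSpaceAt (psdRank 𝕜 n p) (proj T) := fun hT =>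
    dproj_mem_tangentSpaceAt (projFormula_mem (α₀ := α₀) hT hα₁ hβ _).1
  have h3 := hm h1
  rw [h2] at h3
  refine (isRiemannianMetric_quotMetric hα₀ hα₁ hβ).eq_of_forall (proj_mem hS) h3 (hm hS)
    fun w hw => ?_
  have h4 := quotMetric_grad h1 hα₀ hα₁ hβ hf hF (w := w) (by rwa [h2])
  rw [h2] at h4
  exact h4.trans (quotMetric_grad hS hα₀ hα₁ hβ hf hF hw).symm

include hα₀ hα₁ hβ hf hF in
theorem quotMetric_quotGrad {X w : Matrix (Fin n) (Fin n) 𝕜} (hX : X ∈ psdRank 𝕜 n p)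
    (hw : w ∈ tangentSpaceAt (psdRank 𝕜 n p) X) :
    quotMetric p α₀ α₁ β X (quotGrad α₀ α₁ β F X) w = dirDeriv (psdRank 𝕜 n p) f X w := by
  obtain ⟨S, hS, rfl⟩ := exists_proj_eq hX
  rw [quotGrad_proj hS hα₀ hα₁ hβ hf hF, quotMetric_grad hS hα₀ hα₁ hβ hf hF hw]

include hα₀ hα₁ hβ hf hF in
theorem isVectorField_quotGrad : IsVectorField (psdRank 𝕜 n p) (quotGrad α₀ α₁ β F) := by
  refine ⟨contDiffOn_of_section exists_section_psdRank (ContDiffOn.congr ?_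
    fun S hS => quotGrad_proj hS hα₀ hα₁ hβ hf hF), fun X hX => ?_⟩
  · intro S hS
    have hG := (isHorizontalField_grad hα₀ hα₁ hβ hF.1).1.smooth S hS
    simp only [dproj_eq]
    exact ((ContDiffWithinAt.matMul (ContDiffWithinAt.matMul hG.fst contDiffWithinAt_pt_snd)
      contDiffWithinAt_pt_ct).add (ContDiffWithinAt.matMul (ContDiffWithinAt.matMul
      contDiffWithinAt_pt_fst hG.snd) contDiffWithinAt_pt_ct)).add (ContDiffWithinAt.matMul
      (ContDiffWithinAt.matMul contDiffWithinAt_pt_fst contDiffWithinAt_pt_snd)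
      (ContDiffWithinAt.conjTranspose hG.fst))
  · obtain ⟨S, hS, rfl⟩ := exists_proj_eq hX
    rw [quotGrad_proj hS hα₀ hα₁ hβ hf hF]
    exact dproj_mem_tangentSpaceAt (projFormula_mem (α₀ := α₀) hS hα₁ hβ _).1

include hα₀ hα₁ hβ hf hF in
theorem isHorizontalLift_quotGrad : IsHorizontalLift α₀ α₁ β (quotGrad α₀ α₁ β F)
    (fun S => projLin α₁ β S (gInv α₀ α₁ β S (F S))) := fun _ hS =>
  ⟨projFormula_mem hS hα₁ hβ _, (quotGrad_proj hS hα₀ hα₁ hβ hf hF).symm⟩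

include hα₀ hα₁ hβ hB hu hf hF in
theorem isHorizontalLift_hessFormula (hξ : IsHorizontalLift α₀ α₁ β u ξ) :
    IsHorizontalLift α₀ α₁ β (nablaB u (quotGrad α₀ α₁ β F))
      (fun S => hessFormula₁ α₀ α₁ β F S (ξ S)) := by
  intro S hS
  beta_reduce
  rw [← connFormula_grad hS hα₀ hα₁ hβ (hξ S hS).1.1 hF.1]
  exact isHorizontalLift_connFormula hα₀ hα₁ hβ hB hu
    (isVectorField_quotGrad hα₀ hα₁ hβ hf hF) hξ
    (isHorizontalLift_quotGrad hα₀ hα₁ hβ hf hF) S hS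

end Quotient

end FixedRankPSD

/-! ### The theorem. -/

theorem mainTheorem4 {𝕜 : Type*} [RCLike 𝕜] (n p : ℕ) (α₀ α₁ β : ℝ)
    (hα₀ : 0 < α₀) (hα₁ : 0 < α₁) (hβ : 0 < β) :
    -- the quotient of the Stiefel × positive-definite manifold by the action is the set of
    -- positive-semidefinite matrices of rank `p`, with its smooth functions
    ((∀ U ∈ Matrix.unitaryGroup (Fin p) 𝕜, ∀ S ∈ stiefelPD 𝕜 n p, act U S ∈ stiefelPD 𝕜 n p) ∧
      proj '' stiefelPD 𝕜 n p = psdRank 𝕜 n p ∧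
      (∀ S ∈ stiefelPD 𝕜 n p, ∀ S' ∈ stiefelPD 𝕜 n p,
        proj S = proj S' ↔ ∃ U ∈ Matrix.unitaryGroup (Fin p) 𝕜, S' = act U S) ∧
      (∀ f : Matrix (Fin n) (Fin n) 𝕜 → ℝ, ContDiffOn ℝ ∞ f (psdRank 𝕜 n p) ↔
        ContDiffOn ℝ ∞ (fun S => f (proj S)) (stiefelPD 𝕜 n p))) ∧
    -- the metric operator, the inner product, the induced metric and its invariance
    ((∀ S ∈ stiefelPD 𝕜 n p,
        (∀ w w' : Amb 𝕜 n p,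
          ambInner (gOp α₀ α₁ β S w) w' = ambInner w (gOp α₀ α₁ β S w')) ∧
        Function.Bijective (gOp α₀ α₁ β S) ∧
        (∀ w w' : Amb 𝕜 n p, gMet α₀ α₁ β S w w' =
          trR (α₀ • (w.1ᴴ * w'.1) + (α₁ - α₀) • (w.1ᴴ * S.1 * S.1ᴴ * w'.1)
            + β • (w.2ᴴ * S.2⁻¹ * w'.2 * S.2⁻¹))) ∧
        (∀ w : Amb 𝕜 n p, w ≠ 0 → 0 < gMet α₀ α₁ β S w w) ∧
        (∀ U ∈ Matrix.unitaryGroup (Fin p) 𝕜, ∀ w w' : Amb 𝕜 n p,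
          gMet α₀ α₁ β (act U S) (act U w) (act U w') = gMet α₀ α₁ β S w w')) ∧
      IsRiemannianMetric (stiefelPD 𝕜 n p) (gMet α₀ α₁ β)) ∧
    -- the horizontal space, its parametrization, the projection, and the derivatives
    (∀ S ∈ stiefelPD 𝕜 n p,
      (∀ η ∈ tangentSpaceAt (stiefelPD 𝕜 n p) S, η ∈ horizontal α₀ α₁ β S ↔
        α₁ • (S.1ᴴ * η.1) + β • (η.2 * S.2⁻¹) - β • (S.2⁻¹ * η.2) = 0) ∧
      (∀ η : Amb 𝕜 n p, η ∈ horizontal α₀ α₁ β S ↔ η.2ᴴ = η.2 ∧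
        α₁ • (S.1ᴴ * η.1) + β • (η.2 * S.2⁻¹) - β • (S.2⁻¹ * η.2) = 0) ∧
      (∀ Yperp : Matrix (Fin n) (Fin (n - p)) 𝕜,
        (Matrix.fromCols S.1 Yperp)ᴴ * Matrix.fromCols S.1 Yperp = 1 →
        Matrix.fromCols S.1 Yperp * (Matrix.fromCols S.1 Yperp)ᴴ = 1 →
        Set.BijOn (nOp α₁ β S Yperp) {x | x.2ᴴ = x.2} (horizontal α₀ α₁ β S)) ∧
      Function.Bijective (lyap α₁ β S.2) ∧
      (∀ U ∈ Matrix.unitaryGroup (Fin p) 𝕜, ∀ Λ : Fin p → ℝ,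
        S.2 = U * Matrix.diagonal (fun i => (Λ i : 𝕜)) * Uᴴ →
        ∀ B : Matrix (Fin p) (Fin p) 𝕜, lyapInv α₁ β S.2 B =
          U * (Matrix.of fun i j => (Uᴴ * B * U) i j /
            ((α₁ + β * ((Λ i)⁻¹ * Λ j + Λ i * (Λ j)⁻¹ - 2) : ℝ) : 𝕜)) * Uᴴ) ∧
      (∀ w : Amb 𝕜 n p, IsHorizontalProjection α₀ α₁ β S w (projH α₀ α₁ β S w) ∧
        projH α₀ α₁ β S w = projFormula α₁ β S w) ∧
      (∀ ξ ∈ tangentSpaceAt (stiefelPD 𝕜 n p) S, ∀ w : Amb 𝕜 n p,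
        dirDeriv (stiefelPD 𝕜 n p) (fun S' => calD α₁ β S' w) S ξ = calDdot α₁ β S ξ w ∧
        dirDeriv (stiefelPD 𝕜 n p) (fun S' => projH α₀ α₁ β S' w) S ξ =
          dprojFormula α₁ β S ξ w) ∧
      (∀ ξ ∈ tangentSpaceAt (stiefelPD 𝕜 n p) S,
        ∀ η ∈ tangentSpaceAt (stiefelPD 𝕜 n p) S, ∀ κ : Amb 𝕜 n p,
          IsChristoffelTerm α₀ α₁ β S ξ η κ ↔ κ = kFormula α₀ α₁ β S ξ η)) ∧
    (∀ w : Amb 𝕜 n p,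
      ContDiffOn ℝ ∞ (fun S => calD α₁ β S w) (stiefelPD 𝕜 n p) ∧
      ContDiffOn ℝ ∞ (fun S => projH α₀ α₁ β S w) (stiefelPD 𝕜 n p)) ∧
    -- tangent vectors and vector fields of the quotient lift to horizontal ones
    (∀ S ∈ stiefelPD 𝕜 n p,
      Set.BijOn (dproj S) (horizontal α₀ α₁ β S) (tangentSpaceAt (psdRank 𝕜 n p) (proj S))) ∧
    (∀ u, IsVectorField (psdRank 𝕜 n p) u →
      ∃ ξ : Amb 𝕜 n p → Amb 𝕜 n p, IsHorizontalField α₀ α₁ β ξ ∧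
        IsHorizontalLift α₀ α₁ β u ξ) ∧
    -- the Levi-Civita connection `∇`, and `Π_H ∇` on horizontal vector fields
    (∃ nabla, IsLeviCivita (stiefelPD 𝕜 n p) (gMet α₀ α₁ β) nabla) ∧
    (∀ nabla, IsLeviCivita (stiefelPD 𝕜 n p) (gMet α₀ α₁ β) nabla →
      ∀ ξ η, IsHorizontalField α₀ α₁ β ξ → IsHorizontalField α₀ α₁ β η →
        ∀ S ∈ stiefelPD 𝕜 n p,
          projH α₀ α₁ β S (nabla ξ η S) = connFormula α₀ α₁ β ξ η S) ∧
    -- the quotient metric, the lift of its Levi-Civita connection, and the Riemannian Hessian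
    ∃ gB : Matrix (Fin n) (Fin n) 𝕜 → Matrix (Fin n) (Fin n) 𝕜 → Matrix (Fin n) (Fin n) 𝕜 → ℝ,
      IsRiemannianMetric (psdRank 𝕜 n p) gB ∧
      (∀ S ∈ stiefelPD 𝕜 n p, ∀ η ∈ horizontal α₀ α₁ β S, ∀ ζ ∈ horizontal α₀ α₁ β S,
        gB (proj S) (dproj S η) (dproj S ζ) = gMet α₀ α₁ β S η ζ) ∧
      (∃ nablaB, IsLeviCivita (psdRank 𝕜 n p) gB nablaB) ∧
      ∀ nablaB, IsLeviCivita (psdRank 𝕜 n p) gB nablaB →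
        (∀ u v, IsVectorField (psdRank 𝕜 n p) u → IsVectorField (psdRank 𝕜 n p) v →
          ∀ ξ η : Amb 𝕜 n p → Amb 𝕜 n p,
            IsHorizontalLift α₀ α₁ β u ξ → IsHorizontalLift α₀ α₁ β v η →
              IsHorizontalLift α₀ α₁ β (nablaB u v) (connFormula α₀ α₁ β ξ η)) ∧
        (∀ f : Matrix (Fin n) (Fin n) 𝕜 → ℝ, ContDiffOn ℝ ∞ f (psdRank 𝕜 n p) →
          ∀ F : Amb 𝕜 n p → Amb 𝕜 n p, IsAmbientGradient (fun S => f (proj S)) F →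
            ∃ r, IsVectorField (psdRank 𝕜 n p) r ∧
              (∀ X ∈ psdRank 𝕜 n p, ∀ u ∈ tangentSpaceAt (psdRank 𝕜 n p) X,
                gB X (r X) u = dirDeriv (psdRank 𝕜 n p) f X u) ∧
              IsHorizontalLift α₀ α₁ β r
                (fun S => projH α₀ α₁ β S (gInv α₀ α₁ β S (F S))) ∧
              ∀ u, IsVectorField (psdRank 𝕜 n p) u →
                ∀ ξ : Amb 𝕜 n p → Amb 𝕜 n p, IsHorizontalLift α₀ α₁ β u ξ →
                  IsHorizontalLift α₀ α₁ β (nablaB u r)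
                    (fun S => hessFormula₁ α₀ α₁ β F S (ξ S)) ∧
                  ∀ S ∈ stiefelPD 𝕜 n p,
                    hessFormula₁ α₀ α₁ β F S (ξ S) = hessFormula₂ α₀ α₁ β F S (ξ S)) := by
  have hsub := isRiemannianSubmersion_proj (𝕜 := 𝕜) (n := n) (p := p) hα₀ hα₁ hβ
  have hLC := isLeviCivita_leviCivita (𝕜 := 𝕜) (n := n) (p := p) hα₀ hα₁ hβ
  refine ⟨⟨fun U hU S hS => act_mem (mem_unitaryGroup_iff_conjTranspose.1 hU) hS, image_proj,
    fun S hS S' hS' => proj_eq_iff hS hS', contDiffOn_psdRank_iff⟩,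
    ⟨fun S hS => ⟨ambInner_gOp_left hS α₀ α₁ β, bijective_gOp hS hα₀ hα₁ hβ, gMet_eq α₀ α₁ β S,
      fun w hw => gMet_pos hS hα₀ hα₁ hβ hw,
      fun U hU => gMet_act hS (mem_unitaryGroup_iff_conjTranspose.1 hU)⟩,
      isRiemannianMetric_gMet hα₀ hα₁ hβ⟩,
    fun S hS => ⟨fun η hη => mem_horizontal_of_tangent hS hη, fun η => mem_horizontal hS hα₁,
      fun Yperp h1 h2 => bijOn_nOp hS hα₁ h1 h2, bijective_lyap hα₁ hβ hS.2, ?_,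
      projH_spec hS hα₀ hα₁ hβ, ?_,
      fun ξ hξ η hη κ => isChristoffelTerm_iff hS hξ hη κ⟩, fun w => ⟨fun S hS => ?_, ?_⟩,
    fun S hS => bijOn_dproj hS hα₁ hβ,
    fun u hu => ⟨_, isHorizontalField_horLift hα₁ hβ hu, isHorizontalLift_horLift hα₁ hβ hu⟩,
    ⟨_, hLC⟩, fun nabla hn ξ η hξ hη S hS => projH_nabla hS hα₀ hα₁ hβ hn hξ.1 hη,
    quotMetric p α₀ α₁ β, isRiemannianMetric_quotMetric hα₀ hα₁ hβ,
    fun S hS η hη ζ hζ => quotMetric_dproj hS hα₁ hβ hη hζ, hsub.exists_isLeviCivita hLC,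
    fun nablaB hB => ⟨fun u v hu hv ξ η hξ hη =>
      isHorizontalLift_connFormula hα₀ hα₁ hβ hB hu hv hξ hη, fun f hf F hF =>
      ⟨quotGrad α₀ α₁ β F, isVectorField_quotGrad hα₀ hα₁ hβ hf hF,
        fun X hX u hu => quotMetric_quotGrad hα₀ hα₁ hβ hf hF hX hu, fun S hS => ?_,
        fun u hu ξ hξ => ⟨isHorizontalLift_hessFormula hα₀ hα₁ hβ hB hu hf hF hξ,
          fun S hS => hessFormula_eq hS hα₀ hα₁ hβ (hξ S hS).1.1 F⟩⟩⟩⟩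
  · intro U hU Λ h B
    exact lyapInv_eq hα₁ hβ hS.2
      (lyap_diagonal hα₁ hβ hS.2 (mem_unitaryGroup_iff_conjTranspose.1 hU) h B)
  · intro ξ hξ w
    exact ⟨(hasDirDeriv_calD hS hα₁ hβ hξ w).dirDeriv_eq hξ,
      (dirDeriv_projH hS hα₀ hα₁ hβ w ξ).trans
        ((hasDirDeriv_projLin hS hα₁ hβ hξ w).dirDeriv_eq hξ)⟩
  · exact contDiffWithinAt_calD hS hα₁ hβ contDiffWithinAt_const
  · exact ContDiffOn.congr (f := fun S => projLin α₁ β S w) (fun S hS =>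
      contDiffWithinAt_projLin hS hα₁ hβ contDiffWithinAt_const)
      fun S hS => projH_eq hS hα₀ hα₁ hβ w
  · beta_reduce
    rw [projH_eq hS hα₀ hα₁ hβ]
    exact isHorizontalLift_quotGrad hα₀ hα₁ hβ hf hF S hS
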